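/- Let $\mathcal V$ be a symmetric monoidal closed category whose underlying ordinary category is complete and cocomplete; all categories and functors below are $\mathcal V$-categories and $\mathcal V$-functors. A *weight* is a functor $F:\mathcal A\to\mathcal V$ ($\mathcal A$ possibly large) that is a small colimit of representables; this is no restriction when $\mathcal A$ is small. For $S:\mathcal A\to\mathcal K$ the limit $\{F,S\}$ is defined by $\mathcal K(X,\{F,S\})\cong[\mathcal A,\mathcal V](F,\mathcal K(X,S))$, naturally in $X$; for $R:\mathcal A^{\rm op}\to\mathcal K$ the colimit $F*R$ is defined by $\mathcal K(F*R,X)\cong[\mathcal A,\mathcal V](F,\mathcal K(R,X))$, naturally in $X$. Let $\Phi$ be a class of weights. A category is *$\Phi$-complete* if it has all limits with weights in $\Phi$, and a functor is *$\Phi$-continuous* if it preserves them. A functor $G:\mathcal A\to\mathcal V$ with $\mathcal A$ small is *$\Phi$-flat* if $G*-:[\mathcal A^{\rm op},\mathcal V]\to\mathcal V$ is $\Phi$-continuous, and a *$\Phi$-flat colimit* is a colimit whose weight is $\Phi$-flat. Suppose that * $\Phi$ is locally small: the closure under $\Phi$-colimits of a small full subcategory is again (essentially) small, both for the representables in $[\mathcal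 A^{\rm op},\mathcal V]$ with $\mathcal A$ small, and for small full subcategories of arbitrary cocomplete categories; * (Axiom A) if $\mathcal A$ is a small $\Phi$-complete category, then every $\Phi$-continuous functor $F:\mathcal A\to\mathcal V$ is $\Phi$-flat. An object $M$ of a category $\mathcal M$ is *$\Phi$-presentable* if $\mathcal M(M,-):\mathcal M\to\mathcal V$ preserves $\Phi$-flat colimits. The category $\mathcal M$ is *locally $\Phi$-presentable* if it is cocomplete and has a small full subcategory $\mathcal G$ consisting of $\Phi$-presentable objects such that every object of $\mathcal M$ is a $\Phi$-flat colimit of objects in $\mathcal G$. **Theorem.** A category $\mathcal M$ is locally $\Phi$-presentable if and only if there is a small $\Phi$-complete category $\mathcal T$ such that $\mathcal M$ is equivalent to $\Phi\text{-}\mathbf{Cts}(\mathcal T,\mathcal V)$, the full subcategory of $[\mathcal T,\mathcal V]$ consisting of the $\Phi$-continuous functors. -/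

import Mathlib

open CategoryTheory MonoidalCategory Limits Opposite

universe d w w₁ w₂ w₃ v u

noncomputable section

namespace PhiTheory

attribute [local instance] MonoidalClosed.enrichedCategorySelf

variable {V : Type u} [Category.{v} V] [MonoidalCategory V]

section Basic

variable {A : Type w₁} {K : Type w₂} {N : Type w₃}
  [EnrichedCategory V A] [EnrichedCategory V K] [EnrichedCategory V N]

/-- The full sub-`V`-category on the objects satisfying `p`. -/
instance fullSubcategory (p : K → Prop) : EnrichedCategory V (Subtype p) where
  Hom x y := (x.1 ⟶[V] y.1)
  id x := eId V x.1
  comp x y z := eComp V x.1 y.1 z.1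
  id_comp x y := e_id_comp V x.1 y.1
  comp_id x y := e_comp_id V x.1 y.1
  assoc x y z t := e_assoc V x.1 y.1 z.1 t.1

/-- The inclusion of a full subcategory. -/
def incl (p : K → Prop) : EnrichedFunctor V (Subtype p) K where
  obj x := x.1
  map x y := 𝟙 (x.1 ⟶[V] y.1)
  map_id x := Category.comp_id _
  map_comp x y z := by
    change eComp V x.1 y.1 z.1 ≫ 𝟙 _ = (𝟙 _ ⊗ₘ 𝟙 _) ≫ eComp V x.1 y.1 z.1
    rw [Category.comp_id, id_tensorHom_id, Category.id_comp]

/-- Isomorphism in the underlying ordinary category. -/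
def Isomorphic (V : Type u) [Category.{v} V] [MonoidalCategory V] {K : Type w₂}
    [EnrichedCategory V K] (x y : K) : Prop :=
  Nonempty (ForgetEnrichment.of V x ≅ ForgetEnrichment.of V y)

/-- Equivalence of `V`-categories: there is a `V`-functor which is fully faithful (an isomorphism
on hom-objects) and essentially surjective on objects. -/
def Equivalent (V : Type u) [Category.{v} V] [MonoidalCategory V] (K : Type w₂) (N : Type w₃)
    [EnrichedCategory V K] [EnrichedCategory V N] : Prop :=
  ∃ P : EnrichedFunctor V K N, (∀ x y, IsIso (P.map x y)) ∧ ∀ n, ∃ k, Isomorphic V (P.obj k) n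

lemma curry_tensor_curry_comp [MonoidalClosed V] {a b c Y Z : V} (f : a ⊗ Y ⟶ b) (g : b ⊗ Z ⟶ c) :
    (MonoidalClosed.curry f ⊗ₘ MonoidalClosed.curry g) ≫ MonoidalClosed.comp a b c =
      MonoidalClosed.curry ((α_ _ _ _).inv ≫ f ▷ _ ≫ g) := by
  apply MonoidalClosed.uncurry_injective
  rw [MonoidalClosed.uncurry_curry, MonoidalClosed.uncurry_natural_left, MonoidalClosed.comp,
    MonoidalClosed.uncurry_curry, MonoidalClosed.compTranspose, MonoidalCategory.tensorHom_def]
  simp only [MonoidalCategory.whiskerLeft_comp, Category.assoc]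
  rw [associator_inv_naturality_right_assoc, whisker_exchange_assoc]
  dsimp only [Functor.id_obj]
  rw [MonoidalClosed.whiskerLeft_curry_ihom_ev_app, associator_inv_naturality_middle_assoc,
    ← comp_whiskerRight_assoc, MonoidalClosed.whiskerLeft_curry_ihom_ev_app]

/-- The representable `V`-functor `K(x, -) : K → V`. -/
def coyon [MonoidalClosed V] (x : K) : EnrichedFunctor V K V where
  obj y := (x ⟶[V] y)
  map y z := MonoidalClosed.curry (eComp V x y z)
  map_id y := by
    change _ = MonoidalClosed.id _
    apply MonoidalClosed.uncurry_injective
    rw [MonoidalClosed.uncurry_natural_left, MonoidalClosed.uncurry_curry,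
      MonoidalClosed.id, MonoidalClosed.uncurry_curry]
    have := e_comp_id V x y
    rwa [Iso.inv_comp_eq, Category.comp_id] at this
  map_comp y z t := by
    change _ = _ ≫ MonoidalClosed.comp _ _ _
    refine Eq.trans ?_ (curry_tensor_curry_comp _ _).symm
    rw [← MonoidalClosed.curry_natural_left, ← e_assoc V x y z t]

variable [SymmetricCategory V]

def opFunctor (P : EnrichedFunctor V K N) : EnrichedFunctor V Kᵒᵖ Nᵒᵖ where
  obj x := op (P.obj x.unop)
  map x y := P.map y.unop x.unop
  map_id x := P.map_id x.unop
  map_comp x y z := by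
    rw [tensorHom_eComp_op_eq, eComp_op_eq, Category.assoc, P.map_comp]
    rfl

/-- A contravariant diagram `Aᵒᵖ → K`, seen as a `V`-functor `A → Kᵒᵖ`. -/
def opDiagram (R : EnrichedFunctor V Aᵒᵖ K) : EnrichedFunctor V A Kᵒᵖ where
  obj a := op (R.obj (op a))
  map a b := R.map (op b) (op a)
  map_id a := R.map_id (op a)
  map_comp a b c := by
    rw [tensorHom_eComp_op_eq]
    have h := R.map_comp (op c) (op b) (op a)
    rw [eComp_op_eq] at h
    have h' := congrArg (fun t => (β_ (a ⟶[V] b) (b ⟶[V] c)).hom ≫ t) h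
    simp only at h'
    rw [← Category.assoc, ← Category.assoc] at h'
    erw [SymmetricCategory.symmetry, Category.id_comp] at h'
    exact h'

/-- `V`-naturality of a family `θ a : Z ⟶ K(F a, G a)`, a generalized `V`-natural transformation
`F ⟶ G` parametrized by `Z`. -/
def IsNat {Z : V} (F G : EnrichedFunctor V A K) (θ : ∀ a, Z ⟶ (F.obj a ⟶[V] G.obj a)) : Prop :=
  ∀ a b : A, (β_ Z (a ⟶[V] b)).hom ≫ (F.map a b ⊗ₘ θ b) ≫ eComp V _ _ _ =
    (θ a ⊗ₘ G.map a b) ≫ eComp V _ _ _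

lemma IsNat.precomp {Z Z' : V} {F G : EnrichedFunctor V A K}
    {θ : ∀ a, Z ⟶ (F.obj a ⟶[V] G.obj a)} (h : IsNat F G θ) (t : Z' ⟶ Z) :
    IsNat F G (fun a => t ≫ θ a) := by
  intro a b
  have h1 : (F.map a b ⊗ₘ (t ≫ θ b)) = _ ◁ t ≫ (F.map a b ⊗ₘ θ b) := by
    simp [MonoidalCategory.tensorHom_def']
  have h2 : ((t ≫ θ a) ⊗ₘ G.map a b) = t ▷ _ ≫ (θ a ⊗ₘ G.map a b) := by
    simp [MonoidalCategory.tensorHom_def]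
  rw [h1, h2, Category.assoc, Category.assoc, ← h a b,
    ← BraidedCategory.braiding_naturality_left_assoc]

lemma IsNat.id (F : EnrichedFunctor V A K) : IsNat F F (fun a => eId V (F.obj a)) := by
  intro a b
  have h1 := e_comp_id V (F.obj a) (F.obj b)
  have h2 := e_id_comp V (F.obj a) (F.obj b)
  rw [Iso.inv_comp_eq, Category.comp_id] at h1 h2
  rw [MonoidalCategory.tensorHom_def, MonoidalCategory.tensorHom_def', Category.assoc, Category.assoc, h1, h2]
  simp

lemma IsNat.comp {Z W : V} {F G H : EnrichedFunctor V A K}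
    {θ : ∀ a, Z ⟶ (F.obj a ⟶[V] G.obj a)} {φ : ∀ a, W ⟶ (G.obj a ⟶[V] H.obj a)}
    (hθ : IsNat F G θ) (hφ : IsNat G H φ) :
    IsNat F H (fun a => (θ a ⊗ₘ φ a) ≫ eComp V _ _ _) := by
  intro a b
  have e1 : (F.map a b ⊗ₘ ((θ b ⊗ₘ φ b) ≫ eComp V _ _ _)) ≫ eComp V _ _ _ =
      (α_ _ _ _).inv ≫ (((F.map a b ⊗ₘ θ b) ≫ eComp V _ _ _) ⊗ₘ φ b) ≫ eComp V _ _ _ := by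
    have := e_assoc V (F.obj a) (F.obj b) (G.obj b) (H.obj b)
    calc _ = (F.map a b ⊗ₘ (θ b ⊗ₘ φ b)) ≫ _ ◁ eComp V _ _ _ ≫ eComp V _ _ _ := by
          simp [MonoidalCategory.tensorHom_def]
      _ = _ := by
          rw [← this, associator_inv_naturality_assoc]
          simp [MonoidalCategory.tensorHom_def']
  have e2 : (((θ a ⊗ₘ φ a) ≫ eComp V _ _ _) ⊗ₘ H.map a b) ≫ eComp V _ _ _ =
      (α_ _ _ _).hom ≫ (θ a ⊗ₘ ((φ a ⊗ₘ H.map a b) ≫ eComp V _ _ _)) ≫ eComp V _ _ _ := by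
    have := e_assoc' V (F.obj a) (G.obj a) (H.obj a) (H.obj b)
    calc _ = ((θ a ⊗ₘ φ a) ⊗ₘ H.map a b) ≫ eComp V _ _ _ ▷ _ ≫ eComp V _ _ _ := by
          simp [MonoidalCategory.tensorHom_def']
      _ = _ := by
          rw [← this, associator_naturality_assoc]
          simp [MonoidalCategory.tensorHom_def]
  have e3 : (α_ _ _ _).hom ≫
      (θ a ⊗ₘ ((β_ W (a ⟶[V] b)).hom ≫ (G.map a b ⊗ₘ φ b) ≫ eComp V _ _ _)) ≫ eComp V _ _ _ =
      (α_ _ _ _).hom ≫ _ ◁ (β_ W (a ⟶[V] b)).hom ≫ (α_ _ _ _).inv ≫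
        (((θ a ⊗ₘ G.map a b) ≫ eComp V _ _ _) ⊗ₘ φ b) ≫ eComp V _ _ _ := by
    have := e_assoc V (F.obj a) (G.obj a) (G.obj b) (H.obj b)
    congr 1
    calc _ = _ ◁ (β_ W (a ⟶[V] b)).hom ≫ (θ a ⊗ₘ (G.map a b ⊗ₘ φ b)) ≫
            _ ◁ eComp V _ _ _ ≫ eComp V _ _ _ := by
          simp only [MonoidalCategory.tensorHom_def', MonoidalCategory.whiskerLeft_comp,
            Category.assoc, whisker_exchange_assoc]
          rw [← MonoidalCategory.whiskerLeft_comp_assoc _ (G.map a b ▷ _), ← whisker_exchange,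
            MonoidalCategory.whiskerLeft_comp_assoc]
      _ = _ := by
          rw [← this, associator_inv_naturality_assoc]
          simp only [MonoidalCategory.tensorHom_def', comp_whiskerRight, Category.assoc]
  have e4 : (((β_ Z (a ⟶[V] b)).hom ≫ (F.map a b ⊗ₘ θ b) ≫ eComp V _ _ _) ⊗ₘ φ b) =
      (β_ Z (a ⟶[V] b)).hom ▷ _ ≫ (((F.map a b ⊗ₘ θ b) ≫ eComp V _ _ _) ⊗ₘ φ b) := by
    simp [MonoidalCategory.tensorHom_def]
  rw [e1, e2, ← hφ a b, e3, ← hθ a b, e4]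
  simp [BraidedCategory.braiding_tensor_left_hom]

/-- `E`, with the projections `p`, is the object `[A, K](F, G)` of `V`-natural transformations. -/
structure IsNatObject (F G : EnrichedFunctor V A K) (E : V)
    (p : ∀ a, E ⟶ (F.obj a ⟶[V] G.obj a)) : Prop where
  isNat : IsNat F G p
  existsUnique : ∀ (Z : V) (θ : ∀ a, Z ⟶ (F.obj a ⟶[V] G.obj a)), IsNat F G θ →
    ∃! t : Z ⟶ E, ∀ a, t ≫ p a = θ a

end Basic

section FunctorCategory

variable [SymmetricCategory V] [MonoidalClosed V] [HasLimits V]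
variable {A : Type v} {K : Type w₂} [EnrichedCategory V A] [EnrichedCategory V K]

def natHomLeft (F G : EnrichedFunctor V A K) :
    (∏ᶜ fun a : A => ((F.obj a ⟶[V] G.obj a) : V)) ⟶
      ∏ᶜ fun p : A × A => (ihom ((p.1 ⟶[V] p.2) : V)).obj (F.obj p.1 ⟶[V] G.obj p.2) :=
  Pi.lift fun p => MonoidalClosed.curry ((F.map p.1 p.2 ⊗ₘ Pi.π _ p.2) ≫ eComp V _ _ _)

def natHomRight (F G : EnrichedFunctor V A K) :
    (∏ᶜ fun a : A => ((F.obj a ⟶[V] G.obj a) : V)) ⟶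
      ∏ᶜ fun p : A × A => (ihom ((p.1 ⟶[V] p.2) : V)).obj (F.obj p.1 ⟶[V] G.obj p.2) :=
  Pi.lift fun p => MonoidalClosed.curry
    ((β_ _ _).hom ≫ (Pi.π _ p.1 ⊗ₘ G.map p.1 p.2) ≫ eComp V _ _ _)

abbrev natHom (F G : EnrichedFunctor V A K) : V :=
  equalizer (natHomLeft F G) (natHomRight F G)

def natProj (F G : EnrichedFunctor V A K) (a : A) : natHom F G ⟶ (F.obj a ⟶[V] G.obj a) :=
  equalizer.ι (natHomLeft F G) (natHomRight F G) ≫ Pi.π _ a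

lemma isNat_iff {Z : V} (F G : EnrichedFunctor V A K)
    (t : Z ⟶ ∏ᶜ fun a : A => ((F.obj a ⟶[V] G.obj a) : V)) :
    IsNat F G (fun a => t ≫ Pi.π _ a) ↔ t ≫ natHomLeft F G = t ≫ natHomRight F G := by
  have key : ∀ a b : A,
      ((t ≫ natHomLeft F G) ≫ Pi.π _ (a, b) = (t ≫ natHomRight F G) ≫ Pi.π _ (a, b)) ↔
      ((F.map a b ⊗ₘ (t ≫ Pi.π _ b)) ≫ eComp V _ _ _ =
        (β_ (a ⟶[V] b) Z).hom ≫ ((t ≫ Pi.π _ a) ⊗ₘ G.map a b) ≫ eComp V _ _ _) := by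
    intro a b
    have h1 : (t ≫ natHomLeft F G) ≫ Pi.π _ (a, b) =
        MonoidalClosed.curry ((F.map a b ⊗ₘ (t ≫ Pi.π _ b)) ≫ eComp V _ _ _) := by
      rw [Category.assoc, natHomLeft, Pi.lift_π, ← MonoidalClosed.curry_natural_left]
      congr 1
      simp [MonoidalCategory.tensorHom_def']
    have h2 : (t ≫ natHomRight F G) ≫ Pi.π _ (a, b) =
        MonoidalClosed.curry
          ((β_ (a ⟶[V] b) Z).hom ≫ ((t ≫ Pi.π _ a) ⊗ₘ G.map a b) ≫ eComp V _ _ _) := by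
      rw [Category.assoc, natHomRight, Pi.lift_π, ← MonoidalClosed.curry_natural_left,
        BraidedCategory.braiding_naturality_right_assoc]
      congr 2
      simp [MonoidalCategory.tensorHom_def]
    rw [h1, h2, MonoidalClosed.curry_injective.eq_iff]
  constructor
  · intro h
    refine Pi.hom_ext _ _ fun p => ?_
    refine (key p.1 p.2).2 ?_
    rw [← h p.1 p.2, SymmetricCategory.symmetry_assoc]
  · intro h a b
    rw [(key a b).1 (by rw [h]), SymmetricCategory.symmetry_assoc]

lemma natHom_isNatObject (F G : EnrichedFunctor V A K) :
    IsNatObject F G (natHom F G) (natProj F G) where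
  isNat := (isNat_iff F G _).2 (equalizer.condition _ _)
  existsUnique Z θ hθ := by
    have h : IsNat F G (fun a => Pi.lift θ ≫ Pi.π _ a) := by
      simpa using hθ
    refine ⟨equalizer.lift (Pi.lift θ) ((isNat_iff F G _).1 h), fun a => ?_, fun t ht => ?_⟩
    · rw [natProj, equalizer.lift_ι_assoc, Pi.lift_π]
    · refine equalizer.hom_ext (Pi.hom_ext _ _ fun a => ?_)
      rw [equalizer.lift_ι, Pi.lift_π, Category.assoc]
      exact ht a

lemma natHom_ext {F G : EnrichedFunctor V A K} {Z : V} {s t : Z ⟶ natHom F G}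
    (h : ∀ a, s ≫ natProj F G a = t ≫ natProj F G a) : s = t :=
  equalizer.hom_ext (Pi.hom_ext _ _ fun a => by
    rw [Category.assoc, Category.assoc]
    exact h a)

def natLift {F G : EnrichedFunctor V A K} {Z : V} (θ : ∀ a, Z ⟶ (F.obj a ⟶[V] G.obj a))
    (hθ : IsNat F G θ) : Z ⟶ natHom F G :=
  ((natHom_isNatObject F G).existsUnique Z θ hθ).choose

lemma natLift_proj {F G : EnrichedFunctor V A K} {Z : V}
    (θ : ∀ a, Z ⟶ (F.obj a ⟶[V] G.obj a)) (hθ : IsNat F G θ) (a : A) :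
    natLift θ hθ ≫ natProj F G a = θ a :=
  ((natHom_isNatObject F G).existsUnique Z θ hθ).choose_spec.1 a

/-- The functor `V`-category `[A, K]`, for `A` small. -/
instance functorCategory : EnrichedCategory V (EnrichedFunctor V A K) where
  Hom F G := natHom F G
  id F := natLift _ (IsNat.id F)
  comp F G H := natLift _
    ((natHom_isNatObject F G).isNat.comp (natHom_isNatObject G H).isNat)
  id_comp F G := by
    refine natHom_ext fun a => ?_
    rw [Category.assoc, Category.assoc, natLift_proj, MonoidalCategory.tensorHom_def,
      Category.assoc, ← comp_whiskerRight_assoc, natLift_proj, ← whisker_exchange_assoc,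
      ← leftUnitor_inv_naturality_assoc, e_id_comp, Category.comp_id, Category.id_comp]
  comp_id F G := by
    refine natHom_ext fun a => ?_
    rw [Category.assoc, Category.assoc, natLift_proj, MonoidalCategory.tensorHom_def',
      Category.assoc, ← MonoidalCategory.whiskerLeft_comp_assoc, natLift_proj,
      whisker_exchange_assoc,
      ← rightUnitor_inv_naturality_assoc, e_comp_id, Category.comp_id, Category.id_comp]
  assoc F G H I := by
    refine natHom_ext fun a => ?_
    set p := natProj F G a
    set q := natProj G H a
    set r := natProj H I a
    simp only [Category.assoc, natLift_proj]
    have h1 : ∀ (t : natHom F G ⊗ natHom G H ⟶ natHom F H) (k : _),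
        t ≫ natProj F H a = k →
        t ▷ natHom H I ≫ (natProj F H a ⊗ₘ r) = (k ⊗ₘ r) := by
      rintro t k rfl
      simp [MonoidalCategory.tensorHom_def]
    have h2 : ∀ (t : natHom G H ⊗ natHom H I ⟶ natHom G I) (k : _),
        t ≫ natProj G I a = k →
        natHom F G ◁ t ≫ (p ⊗ₘ natProj G I a) = (p ⊗ₘ k) := by
      rintro t k rfl
      simp [MonoidalCategory.tensorHom_def']
    rw [← Category.assoc (natLift _ _ ▷ _), h1 _ _ (natLift_proj _ _ a),
      ← Category.assoc (_ ◁ natLift _ _), h2 _ _ (natLift_proj _ _ a)]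
    have h3 : ((p ⊗ₘ q) ≫ eComp V _ _ _ ⊗ₘ r) = ((p ⊗ₘ q) ⊗ₘ r) ≫ eComp V _ _ _ ▷ _ := by
      simp [MonoidalCategory.tensorHom_def']
    have h4 : (p ⊗ₘ (q ⊗ₘ r) ≫ eComp V _ _ _) = (p ⊗ₘ (q ⊗ₘ r)) ≫ _ ◁ eComp V _ _ _ := by
      simp [MonoidalCategory.tensorHom_def]
    rw [h3, h4, Category.assoc, Category.assoc, ← associator_inv_naturality_assoc, e_assoc]

/-- Evaluation at an object, as a `V`-functor. -/
def ev (a : A) : EnrichedFunctor V (EnrichedFunctor V A K) K where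
  obj F := F.obj a
  map F G := natProj F G a
  map_id F := natLift_proj _ (IsNat.id F) a
  map_comp F G H := natLift_proj _
    ((natHom_isNatObject F G).isNat.comp (natHom_isNatObject G H).isNat) a

end FunctorCategory

section Limits

variable [SymmetricCategory V] [MonoidalClosed V]
variable {A : Type w₁} {K : Type w₂} {N : Type w₃}
  [EnrichedCategory V A] [EnrichedCategory V K] [EnrichedCategory V N]

/-- The family `π a : F a ⟶ K(L, S a)` exhibits `L` as the limit `{F, S}` of `S` weighted by `F`:
for every `X`, the induced family `K(X, L) ⟶ [F a, K(X, S a)]` exhibits `K(X, L)` as the object of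
`V`-natural transformations from `F` to `K(X, S -)`. -/
def IsWeightedLimit (F : EnrichedFunctor V A V) (S : EnrichedFunctor V A K) (L : K)
    (π : ∀ a, F.obj a ⟶ (L ⟶[V] S.obj a)) : Prop :=
  ∀ X : K, IsNatObject F (S.comp V (coyon X)) (X ⟶[V] L) fun a =>
    MonoidalClosed.curry ((β_ (F.obj a) (X ⟶[V] L)).hom ≫
      ((X ⟶[V] L) ◁ π a) ≫ eComp V X L (S.obj a))

def HasWeightedLimit (F : EnrichedFunctor V A V) (S : EnrichedFunctor V A K) : Prop :=
  ∃ (L : K) (π : ∀ a, F.obj a ⟶ (L ⟶[V] S.obj a)), IsWeightedLimit F S L π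

def PreservesWeightedLimit (P : EnrichedFunctor V K N) (F : EnrichedFunctor V A V)
    (S : EnrichedFunctor V A K) : Prop :=
  ∀ (L : K) (π : ∀ a, F.obj a ⟶ (L ⟶[V] S.obj a)), IsWeightedLimit F S L π →
    IsWeightedLimit F (S.comp V P) (P.obj L) fun a => π a ≫ P.map L (S.obj a)

/-- The family `π a : F a ⟶ K(R a, L)` exhibits `L` as the colimit `F * R` of the contravariant
diagram `R` weighted by `F`, that is, as the corresponding weighted limit in `Kᵒᵖ`. -/
def IsWeightedColimit (F : EnrichedFunctor V A V) (R : EnrichedFunctor V Aᵒᵖ K) (L : K)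
    (π : ∀ a, F.obj a ⟶ (R.obj (op a) ⟶[V] L)) : Prop :=
  IsWeightedLimit (K := Kᵒᵖ) F (opDiagram R) (op L) π

def HasWeightedColimit (F : EnrichedFunctor V A V) (R : EnrichedFunctor V Aᵒᵖ K) : Prop :=
  ∃ (L : K) (π : ∀ a, F.obj a ⟶ (R.obj (op a) ⟶[V] L)), IsWeightedColimit F R L π

def PreservesWeightedColimit (P : EnrichedFunctor V K N) (F : EnrichedFunctor V A V)
    (R : EnrichedFunctor V Aᵒᵖ K) : Prop :=
  ∀ (L : K) (π : ∀ a, F.obj a ⟶ (R.obj (op a) ⟶[V] L)), IsWeightedColimit F R L π →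
    IsWeightedColimit F (R.comp V P) (P.obj L) fun a => π a ≫ P.map (R.obj (op a)) L

/-- Existence of all colimits with weights on small `V`-categories. -/
def Cocomplete (V : Type u) [Category.{v} V] [MonoidalCategory V] [SymmetricCategory V]
    [MonoidalClosed V] (K : Type w₂) [EnrichedCategory V K] : Prop :=
  ∀ (A : Type v) [EnrichedCategory V A] (F : EnrichedFunctor V A V)
    (R : EnrichedFunctor V Aᵒᵖ K), HasWeightedColimit F R

/-- `F : A → V` is a small colimit of representables: there is a small set `P` of objects such that
`F` is the (pointwise) left Kan extension of its restriction to the full subcategory on `P`, that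
is, each `F a` is canonically the colimit of the `A(p, a)`, `p ∈ P`, weighted by `F p`. -/
def IsSmallWeight (F : EnrichedFunctor V A V) : Prop :=
  ∃ P : Set A, Small.{v} P ∧ ∀ a : A,
    IsWeightedColimit ((incl (V := V) (fun x : A => x ∈ P)).comp V F)
      ((opFunctor (incl (V := V) (fun x : A => x ∈ P))).comp V (coyon (op a))) (F.obj a)
      fun p => MonoidalClosed.curry
        ((β_ (p.1 ⟶[V] a) (F.obj p.1)).hom ≫ MonoidalClosed.uncurry (F.map p.1 a))

end Limits

/-- A weight, on a possibly large `V`-category. A weight is written as a covariant functor; it is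
a presheaf on the opposite of its domain. -/
structure Weight (V : Type u) [Category.{v} V] [MonoidalCategory V] [SymmetricCategory V]
    [MonoidalClosed V] where
  dom : Type d
  enriched : EnrichedCategory V dom
  functor : EnrichedFunctor V dom V
  isSmall : IsSmallWeight functor

attribute [instance] Weight.enriched

section Phi

variable [SymmetricCategory V] [MonoidalClosed V] (Φ : Set (Weight.{d} V))

def PhiComplete (K : Type w) [EnrichedCategory V K] : Prop :=
  ∀ φ ∈ Φ, ∀ S : EnrichedFunctor V φ.dom K, HasWeightedLimit φ.functor S

/-- Preservation of all limits with weights in `Φ` which exist in the domain. -/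
def PhiContinuous {K : Type w₂} {N : Type w₃} [EnrichedCategory V K] [EnrichedCategory V N]
    (P : EnrichedFunctor V K N) : Prop :=
  ∀ φ ∈ Φ, ∀ S : EnrichedFunctor V φ.dom K, PreservesWeightedLimit P φ.functor S

/-- Closure of a collection of objects under `Φ`-colimits. -/
inductive PhiClosure {N : Type w} [EnrichedCategory V N] (G : Set N) : N → Prop
  | base (x : N) (hx : x ∈ G) : PhiClosure G x
  | colim (φ : Weight.{d} V) (hφ : φ ∈ Φ) (R : EnrichedFunctor V φ.domᵒᵖ N) (L : N)
      (π : ∀ a, φ.functor.obj a ⟶ (R.obj (op a) ⟶[V] L))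
      (hR : ∀ a, PhiClosure G (R.obj a)) (hL : IsWeightedColimit φ.functor R L π) :
      PhiClosure G L

/-- The full subcategory on the objects satisfying `p` is essentially small. -/
def IsEssentiallySmall (V : Type u) [Category.{v} V] [MonoidalCategory V] {N : Type w}
    [EnrichedCategory V N] (p : N → Prop) : Prop :=
  ∃ S : Set N, Small.{v} S ∧ ∀ x, p x → ∃ y ∈ S, Isomorphic V x y

variable [HasLimits V]

/-- `G : A → V`, with `A` small, is `Φ`-flat: `Φ`-limits commute in `V` with `G`-weighted colimits,
that is, the `V`-functor `G * - : [Aᵒᵖ, V] → V` is `Φ`-continuous. The functor `G * -` is the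
`V`-functor `C`, unique up to isomorphism, whose value at `R` is a colimit of `R` weighted by `G`,
with colimit cocone `V`-natural in `R`. -/
def IsFlat {A : Type v} [EnrichedCategory V A] (G : EnrichedFunctor V A V) : Prop :=
  ∃ (C : EnrichedFunctor V (EnrichedFunctor V Aᵒᵖ V) V)
    (η : ∀ (R : EnrichedFunctor V Aᵒᵖ V) (a : A),
      G.obj a ⟶ EnrichedCategory.Hom (V := V) (R.obj (op a)) (C.obj R)),
    (∀ R, IsWeightedColimit G R (C.obj R) (η R)) ∧
    (∀ a, IsNat (ev (op a)) C fun R => η R a) ∧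
    PhiContinuous Φ C

def AxiomA : Prop :=
  ∀ (A : Type v) [EnrichedCategory V A], PhiComplete Φ A →
    ∀ F : EnrichedFunctor V A V, PhiContinuous Φ F → IsFlat Φ F

/-- The closure under `Φ`-colimits of a small full subcategory is again small, both for the
representables in a presheaf category `[Aᵒᵖ, V]` with `A` small, and in a general cocomplete
`V`-category. -/
def PhiLocallySmall : Prop :=
  (∀ (A : Type v) [EnrichedCategory V A],
    IsEssentiallySmall V (PhiClosure Φ
      (Set.range fun a : A => (coyon (op a) : EnrichedFunctor V Aᵒᵖ V)))) ∧
  ∀ (N : Type w) [EnrichedCategory V N], Cocomplete V N →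
    ∀ G : Set N, Small.{v} G → IsEssentiallySmall V (PhiClosure Φ G)

def PhiPresentable {M : Type w} [EnrichedCategory V M] (m : M) : Prop :=
  ∀ (A : Type v) [EnrichedCategory V A] (F : EnrichedFunctor V A V), IsFlat Φ F →
    ∀ R : EnrichedFunctor V Aᵒᵖ M, PreservesWeightedColimit (coyon m) F R

def LocallyPhiPresentable (M : Type w) [EnrichedCategory V M] : Prop :=
  Cocomplete V M ∧
  ∃ G : Set M, Small.{v} G ∧ (∀ g ∈ G, PhiPresentable Φ g) ∧
    ∀ m : M, ∃ (A : Type v) (_ : EnrichedCategory V A) (F : EnrichedFunctor V A V)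
      (R : EnrichedFunctor V Aᵒᵖ M) (π : ∀ a, F.obj a ⟶ (R.obj (op a) ⟶[V] m)),
      IsFlat Φ F ∧ (∀ a, R.obj a ∈ G) ∧ IsWeightedColimit F R m π

/-- The full subcategory of `[T, V]` on the `Φ`-continuous functors. -/
def Cts (T : Type v) [EnrichedCategory V T] : Type (max u v) :=
  {F : EnrichedFunctor V T V // PhiContinuous Φ F}

instance (T : Type v) [EnrichedCategory V T] : EnrichedCategory V (Cts Φ T) :=
  fullSubcategory (fun F : EnrichedFunctor V T V => PhiContinuous Φ F)

end Phi

end PhiTheory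

end

/-!
All the categorical notions are handled through *generalized elements*: arrows `Z ⟶ K(x, y)` of
`V` with an arbitrary domain, composed by `cmp`. In these terms a weighted limit is a cone
satisfying an equational universal property at every object (`isWeightedLimit_iff`), and one can
speak of a cone which is only seen as a limit by a particular object `X` (`IsLimAt`). Colimits are
limits in the opposite category. An arrow `e` is *seen as invertible by `X`* if `K(X, e)`, written
`post X e`, is invertible; such arrows between diagrams induce such arrows between limits
(`IsLimAt.isIso_post`), and conversely a cone connected by such arrows to one that `X` sees as a
limit is itself seen as a limit (`IsLimAt.of_isIso_post`). These two facts carry most of the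
argument.

*A locally `Φ`-presentable category `M` is a category of continuous functors.* The `Φ`-presentable
objects are closed under `Φ`-colimits (`PhiPresentable.closure`): for a flat colimit, the
comparison `F * M(x, Q -) ⟶ M(x, m)` is natural in `x` and both sides send `Φ`-colimits in `x` to
limits, since `F * -` is `Φ`-continuous. So the closure of the given generators under
`Φ`-colimits, which is small by local smallness, consists of `Φ`-presentable objects, and its
opposite `T` is `Φ`-complete (`phiComplete_of_closure`). The restricted Yoneda functor sends `m`
to the continuous functor `M(J -, m)`. It preserves flat colimits, by presentability; it is fully
faithful because every object is a flat colimit of objects of `T` (`isIso_resYon_map_of_flat`);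
and every continuous `X : T → V` is in its image, because `X` is flat by Axiom A and is the
`X`-weighted colimit of the representables (`exists_isomorphic_resYon`).

*Continuous functors on a small `Φ`-complete `T` form a locally `Φ`-presentable category.* Flat
colimits of continuous functors are pointwise and continuous (`IsFlat.exists_pointwiseColimit`);
with the Yoneda lemma and Axiom A it follows that the representables are presentable and that
every continuous functor is a flat colimit of representables. What remains is cocompleteness,
which follows from the existence of reflections in `[T, V]` (`PhiComplete.exists_reflection`). The
closure `D` of the representables under `Φ`-colimits is small, it is dense, and each of its
objects is seen by the continuous functors as a representable (`PhiClosure.exists_isOrthogonal`),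
because `T` has `Φ`-limits and continuous functors preserve them. The weight `[T, V](-, W)` on
`Dᵒᵖ` is continuous, hence flat by Axiom A. Replacing, in the canonical colimit expressing `W`
through `D`, the objects of `D` by the representables that they are seen as, gives a flat colimit
of representables. It is continuous, and continuous functors see the comparison with `W` as
invertible: it is the reflection of `W`.
-/

noncomputable section

namespace PhiTheory

attribute [local instance] MonoidalClosed.enrichedCategorySelf

set_option linter.unusedSectionVars false

variable {V : Type u} [Category.{v} V] [MonoidalCategory V]

/-! ### Generalized elements of hom-objects -/

section Elements

variable {A : Type w₁} {K : Type w₂} {N : Type w₃}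
  [EnrichedCategory V A] [EnrichedCategory V K] [EnrichedCategory V N]

/-- Composition of generalized elements of hom-objects, that is, of arrows `Z ⟶ K(x, y)` with an
arbitrary domain `Z` in `V`. -/
def cmp {x y z : K} {Z W : V} (f : Z ⟶ (x ⟶[V] y)) (g : W ⟶ (y ⟶[V] z)) :
    Z ⊗ W ⟶ (x ⟶[V] z) :=
  (f ⊗ₘ g) ≫ eComp V x y z

lemma cmp_precomp_left {x y z : K} {Z Z' W : V} (s : Z' ⟶ Z)
    (f : Z ⟶ (x ⟶[V] y)) (g : W ⟶ (y ⟶[V] z)) :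
    cmp (s ≫ f) g = s ▷ W ≫ cmp f g := by
  simp [cmp, MonoidalCategory.tensorHom_def]

lemma cmp_precomp_right {x y z : K} {Z W W' : V} (t : W' ⟶ W)
    (f : Z ⟶ (x ⟶[V] y)) (g : W ⟶ (y ⟶[V] z)) :
    cmp f (t ≫ g) = Z ◁ t ≫ cmp f g := by
  simp [cmp, MonoidalCategory.tensorHom_def']

lemma cmp_assoc {x y z t : K} {Z W U : V} (f : Z ⟶ (x ⟶[V] y)) (g : W ⟶ (y ⟶[V] z))
    (h : U ⟶ (z ⟶[V] t)) :
    cmp (cmp f g) h = (α_ Z W U).hom ≫ cmp f (cmp g h) := by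
  have := e_assoc' V x y z t
  calc cmp (cmp f g) h = ((f ⊗ₘ g) ⊗ₘ h) ≫ eComp V _ _ _ ▷ _ ≫ eComp V _ _ _ := by
        simp [cmp, MonoidalCategory.tensorHom_def']
    _ = _ := by
        rw [← this, associator_naturality_assoc]
        simp [cmp, MonoidalCategory.tensorHom_def]

lemma cmp_eId {x y : K} {Z : V} (f : Z ⟶ (x ⟶[V] y)) : cmp f (eId V y) = (ρ_ Z).hom ≫ f := by
  have h := e_comp_id V x y
  rw [Iso.inv_comp_eq, Category.comp_id] at h
  rw [cmp, MonoidalCategory.tensorHom_def, Category.assoc, h, rightUnitor_naturality]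

lemma eId_cmp {x y : K} {Z : V} (f : Z ⟶ (x ⟶[V] y)) : cmp (eId V x) f = (λ_ Z).hom ≫ f := by
  have h := e_id_comp V x y
  rw [Iso.inv_comp_eq, Category.comp_id] at h
  rw [cmp, MonoidalCategory.tensorHom_def', Category.assoc, h, leftUnitor_naturality]

lemma cmp_map {x y z : K} {Z W : V} (P : EnrichedFunctor V K N) (f : Z ⟶ (x ⟶[V] y))
    (g : W ⟶ (y ⟶[V] z)) :
    cmp f g ≫ P.map x z = cmp (f ≫ P.map x y) (g ≫ P.map y z) := by
  simp [cmp]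

/-- Postcomposition with an arrow of the underlying category. -/
def post {y z : K} (x : K) (e : 𝟙_ V ⟶ (y ⟶[V] z)) : (x ⟶[V] y) ⟶ (x ⟶[V] z) :=
  (ρ_ _).inv ≫ cmp (𝟙 _) e

/-- Precomposition with an arrow of the underlying category. -/
def pre {x y : K} (e : 𝟙_ V ⟶ (x ⟶[V] y)) (z : K) : (y ⟶[V] z) ⟶ (x ⟶[V] z) :=
  (λ_ _).inv ≫ cmp e (𝟙 _)

lemma comp_post {x y z : K} {Z : V} (f : Z ⟶ (x ⟶[V] y)) (e : 𝟙_ V ⟶ (y ⟶[V] z)) :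
    f ≫ post x e = (ρ_ Z).inv ≫ cmp f e := by
  rw [post, rightUnitor_inv_naturality_assoc, ← cmp_precomp_left, Category.comp_id]

lemma comp_pre {x y z : K} {Z : V} (e : 𝟙_ V ⟶ (x ⟶[V] y)) (f : Z ⟶ (y ⟶[V] z)) :
    f ≫ pre e z = (λ_ Z).inv ≫ cmp e f := by
  rw [pre, leftUnitor_inv_naturality_assoc, ← cmp_precomp_right, Category.comp_id]

lemma cmp_eq_post {x y z : K} {Z : V} (f : Z ⟶ (x ⟶[V] y)) (e : 𝟙_ V ⟶ (y ⟶[V] z)) :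
    cmp f e = (ρ_ Z).hom ≫ f ≫ post x e := by
  rw [comp_post, Iso.hom_inv_id_assoc]

lemma cmp_eq_pre {x y z : K} {Z : V} (e : 𝟙_ V ⟶ (x ⟶[V] y)) (f : Z ⟶ (y ⟶[V] z)) :
    cmp e f = (λ_ Z).hom ≫ f ≫ pre e z := by
  rw [comp_pre, Iso.hom_inv_id_assoc]

lemma cmp_comp_post {x y z t : K} {Z W : V} (f : Z ⟶ (x ⟶[V] y)) (g : W ⟶ (y ⟶[V] z))
    (e : 𝟙_ V ⟶ (z ⟶[V] t)) : cmp f g ≫ post x e = cmp f (g ≫ post y e) := by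
  rw [comp_post, comp_post, cmp_assoc, cmp_precomp_right]
  simp

lemma cmp_comp_pre {x y z t : K} {Z W : V} (e : 𝟙_ V ⟶ (x ⟶[V] y)) (f : Z ⟶ (y ⟶[V] z))
    (g : W ⟶ (z ⟶[V] t)) : cmp f g ≫ pre e t = cmp (f ≫ pre e z) g := by
  rw [comp_pre, comp_pre, cmp_precomp_left, cmp_assoc]
  simp

lemma cmp_post_left {x y z t : K} {Z W : V} (f : Z ⟶ (x ⟶[V] y)) (e : 𝟙_ V ⟶ (y ⟶[V] z))
    (g : W ⟶ (z ⟶[V] t)) : cmp (f ≫ post x e) g = cmp f (g ≫ pre e t) := by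
  rw [comp_post, comp_pre, cmp_precomp_left, cmp_precomp_right, cmp_assoc]
  simp

lemma post_pre {x x' y z : K} (e : 𝟙_ V ⟶ (y ⟶[V] z)) (e' : 𝟙_ V ⟶ (x ⟶[V] x')) :
    post x' e ≫ pre e' z = pre e' y ≫ post x e := by
  change _ = ((λ_ _).inv ≫ cmp e' (𝟙 _)) ≫ post x e
  rw [Category.assoc, cmp_comp_post, Category.id_comp, comp_pre]

lemma one_post_eq_pre {x y z : K} (e : 𝟙_ V ⟶ (x ⟶[V] y)) (e' : 𝟙_ V ⟶ (y ⟶[V] z)) :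
    e ≫ post x e' = e' ≫ pre e z := by
  rw [comp_post, comp_pre, unitors_inv_equal]

lemma post_comp {x y z t : K} (e : 𝟙_ V ⟶ (y ⟶[V] z)) (e' : 𝟙_ V ⟶ (z ⟶[V] t)) :
    post x (e ≫ post y e') = post x e ≫ post x e' := by
  change _ = ((ρ_ _).inv ≫ cmp (𝟙 _) e) ≫ post x e'
  rw [post, ← cmp_comp_post, Category.assoc]

lemma pre_comp {x y z t : K} (e : 𝟙_ V ⟶ (x ⟶[V] y)) (e' : 𝟙_ V ⟶ (y ⟶[V] z)) :
    pre (e ≫ post x e') t = pre e' t ≫ pre e t := by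
  change _ = ((λ_ _).inv ≫ cmp e' (𝟙 _)) ≫ pre e t
  rw [one_post_eq_pre, pre, ← cmp_comp_pre, Category.assoc]

@[simp] lemma post_eId (x y : K) : post x (eId V y) = 𝟙 _ := by
  rw [post, cmp_eId]; simp

@[simp] lemma pre_eId (x y : K) : pre (eId V x) y = 𝟙 _ := by
  rw [pre, eId_cmp]; simp

@[simp] lemma eId_post {x y : K} (e : 𝟙_ V ⟶ (x ⟶[V] y)) : eId V x ≫ post x e = e := by
  rw [one_post_eq_pre, pre_eId, Category.comp_id]

lemma post_map (P : EnrichedFunctor V K N) {x y z : K} (e : 𝟙_ V ⟶ (y ⟶[V] z)) :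
    post x e ≫ P.map x z = P.map x y ≫ post (P.obj x) (e ≫ P.map y z) := by
  rw [comp_post, post, Category.assoc, cmp_map, Category.id_comp]

lemma pre_map (P : EnrichedFunctor V K N) {x y z : K} (e : 𝟙_ V ⟶ (x ⟶[V] y)) :
    pre e z ≫ P.map x z = P.map y z ≫ pre (e ≫ P.map x y) (P.obj z) := by
  rw [comp_pre, pre, Category.assoc, cmp_map, Category.id_comp]

/-- A pair of mutually inverse arrows of the underlying category. -/
structure InvPair {x y : K} (e : 𝟙_ V ⟶ (x ⟶[V] y)) (e' : 𝟙_ V ⟶ (y ⟶[V] x)) : Prop where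
  left : e ≫ post x e' = eId V x
  right : e' ≫ post y e = eId V y

lemma InvPair.symm {x y : K} {e : 𝟙_ V ⟶ (x ⟶[V] y)} {e' : 𝟙_ V ⟶ (y ⟶[V] x)}
    (h : InvPair e e') : InvPair e' e := ⟨h.2, h.1⟩

lemma InvPair.refl (x : K) : InvPair (eId V x) (eId V x) := ⟨by simp, by simp⟩

lemma InvPair.map {x y : K} {e : 𝟙_ V ⟶ (x ⟶[V] y)} {e' : 𝟙_ V ⟶ (y ⟶[V] x)}
    (h : InvPair e e') (P : EnrichedFunctor V K N) :
    InvPair (e ≫ P.map x y) (e' ≫ P.map y x) := by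
  constructor
  · rw [Category.assoc, ← post_map, ← Category.assoc, h.left, P.map_id]
  · rw [Category.assoc, ← post_map, ← Category.assoc, h.right, P.map_id]

lemma InvPair.isIso_post {x y : K} {e : 𝟙_ V ⟶ (x ⟶[V] y)} {e' : 𝟙_ V ⟶ (y ⟶[V] x)}
    (h : InvPair e e') (z : K) : IsIso (post z e) :=
  ⟨post z e', by rw [← post_comp, h.left, post_eId], by rw [← post_comp, h.right, post_eId]⟩

lemma InvPair.isIso_pre {x y : K} {e : 𝟙_ V ⟶ (x ⟶[V] y)} {e' : 𝟙_ V ⟶ (y ⟶[V] x)}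
    (h : InvPair e e') (z : K) : IsIso (pre e z) :=
  ⟨pre e' z, by rw [← pre_comp, h.right, pre_eId], by rw [← pre_comp, h.left, pre_eId]⟩

lemma InvPair.of_isIso_post {x y : K} {e : 𝟙_ V ⟶ (x ⟶[V] y)} (hx : IsIso (post x e))
    (hy : IsIso (post y e)) : ∃ e', InvPair e e' := by
  refine ⟨eId V y ≫ inv (post y e), ?_, by simp⟩
  rw [← cancel_mono (post x e)]
  rw [Category.assoc, ← post_comp, Category.assoc, IsIso.inv_hom_id, Category.comp_id, post_eId,
    Category.comp_id, eId_post]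

lemma homOf_comp_eq {x y z : K} (f : 𝟙_ V ⟶ (x ⟶[V] y)) (g : 𝟙_ V ⟶ (y ⟶[V] z)) :
    ForgetEnrichment.homOf V f ≫ ForgetEnrichment.homOf V g =
      ForgetEnrichment.homOf V (f ≫ post x g) := by
  rw [comp_post, cmp, ← ForgetEnrichment.homOf_comp, unitors_inv_equal]

lemma isomorphic_iff {x y : K} : Isomorphic V x y ↔
    ∃ (e : 𝟙_ V ⟶ (x ⟶[V] y)) (e' : 𝟙_ V ⟶ (y ⟶[V] x)), InvPair e e' := by
  constructor
  · rintro ⟨i⟩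
    refine ⟨ForgetEnrichment.homTo V i.hom, ForgetEnrichment.homTo V i.inv, ?_, ?_⟩
    · have := i.hom_inv_id
      rw [← ForgetEnrichment.homOf_homTo V i.hom, ← ForgetEnrichment.homOf_homTo V i.inv] at this
      exact (homOf_comp_eq _ _).symm.trans (this.trans (ForgetEnrichment.homOf_eId V x).symm)
    · have := i.inv_hom_id
      rw [← ForgetEnrichment.homOf_homTo V i.hom, ← ForgetEnrichment.homOf_homTo V i.inv] at this
      exact (homOf_comp_eq _ _).symm.trans (this.trans (ForgetEnrichment.homOf_eId V y).symm)
  · rintro ⟨e, e', h⟩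
    refine ⟨⟨ForgetEnrichment.homOf V e, ForgetEnrichment.homOf V e', ?_, ?_⟩⟩
    · rw [homOf_comp_eq, h.left, ForgetEnrichment.homOf_eId]
    · rw [homOf_comp_eq, h.right, ForgetEnrichment.homOf_eId]

/-- `V`-naturality of a family of arrows of the underlying category: the case `Z = 𝟙_ V` of `IsNat`,
written without unitors. -/
def IsNat₁ (F G : EnrichedFunctor V A K) (η : ∀ a, 𝟙_ V ⟶ (F.obj a ⟶[V] G.obj a)) : Prop :=
  ∀ a b, F.map a b ≫ post _ (η b) = G.map a b ≫ pre (η a) _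

end Elements

/-! ### Ends, weighted cones and weighted limits -/

section Closed

variable [MonoidalClosed V] {A : Type w₁} {K : Type w₂} {N : Type w₃}
  [EnrichedCategory V A] [EnrichedCategory V K] [EnrichedCategory V N]

/-- The action `F a ⊗ A(a, b) ⟶ F b` of a `V`-functor `F : A → V`. -/
def act (F : EnrichedFunctor V A V) (a b : A) : F.obj a ⊗ (a ⟶[V] b) ⟶ F.obj b :=
  MonoidalClosed.uncurry (F.map a b)

/-- Composition of internal homs is the composition of transposes. -/
lemma uncurry_cmp {X Y T Z W : V} (f : Z ⟶ EnrichedCategory.Hom (V := V) X Y)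
    (g : W ⟶ EnrichedCategory.Hom (V := V) Y T) :
    MonoidalClosed.uncurry (cmp f g) =
      (α_ _ _ _).inv ≫ MonoidalClosed.uncurry f ▷ W ≫ MonoidalClosed.uncurry g := by
  have := curry_tensor_curry_comp (MonoidalClosed.uncurry f) (MonoidalClosed.uncurry g)
  rw [MonoidalClosed.curry_uncurry, MonoidalClosed.curry_uncurry] at this
  change MonoidalClosed.uncurry ((f ⊗ₘ g) ≫ MonoidalClosed.comp _ _ _) = _
  rw [this, MonoidalClosed.uncurry_curry]

lemma act_act (F : EnrichedFunctor V A V) (a b c : A) :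
    act F a b ▷ (b ⟶[V] c) ≫ act F b c =
      (α_ _ _ _).hom ≫ F.obj a ◁ eComp V a b c ≫ act F a c := by
  have h : MonoidalClosed.uncurry (eComp V a b c ≫ F.map a c) = MonoidalClosed.uncurry
    (cmp (F.map a b) (F.map b c)) := congrArg _ (F.map_comp a b c)
  rw [uncurry_cmp, MonoidalClosed.uncurry_natural_left] at h
  change _ = _ ≫ _ ◁ _ ≫ MonoidalClosed.uncurry _
  rw [h, Iso.hom_inv_id_assoc]
  rfl

lemma act_eId (F : EnrichedFunctor V A V) (a : A) :
    F.obj a ◁ eId V a ≫ act F a a = (ρ_ _).hom := by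
  have h : MonoidalClosed.uncurry (eId V a ≫ F.map a a) =
    MonoidalClosed.uncurry (MonoidalClosed.id _) := congrArg _ (F.map_id a)
  rw [MonoidalClosed.uncurry_natural_left, MonoidalClosed.id, MonoidalClosed.uncurry_curry] at h
  exact h

@[simp] lemma act_coyon (x : K) (y z : K) : act (coyon x) y z = eComp V x y z :=
  MonoidalClosed.uncurry_curry _

@[simp] lemma act_comp (S : EnrichedFunctor V A K) (F : EnrichedFunctor V K V) (a b : A) :
    act (S.comp V F) a b = F.obj (S.obj a) ◁ S.map a b ≫ act F (S.obj a) (S.obj b) :=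
  MonoidalClosed.uncurry_natural_left _ _

/-- Naturality of a family `Z ⊗ F a ⟶ G a`: the transposed form of `IsNat` for functors to `V`. -/
def NatFam {Z : V} (F G : EnrichedFunctor V A V) (θ : ∀ a, Z ⊗ F.obj a ⟶ G.obj a) : Prop :=
  ∀ a b, (α_ _ _ _).hom ≫ Z ◁ act F a b ≫ θ b = θ a ▷ _ ≫ act G a b

lemma NatFam.precomp {Z Z' : V} {F G : EnrichedFunctor V A V}
    {θ : ∀ a, Z ⊗ F.obj a ⟶ G.obj a} (h : NatFam F G θ) (t : Z' ⟶ Z) :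
    NatFam F G (fun a => t ▷ _ ≫ θ a) := by
  intro a b
  have := h a b
  dsimp only
  rw [comp_whiskerRight, Category.assoc, ← this, whisker_exchange_assoc,
    associator_naturality_left_assoc]

lemma NatFam.id (F : EnrichedFunctor V A V) : NatFam F F (fun a => (λ_ (F.obj a)).hom) := by
  intro a b
  simp

/-- Naturality of a family of morphisms `F a ⟶ G a` of `V`. -/
def NatMor (F G : EnrichedFunctor V A V) (κ : ∀ a, F.obj a ⟶ G.obj a) : Prop :=
  ∀ a b, act F a b ≫ κ b = κ a ▷ _ ≫ act G a b

lemma NatFam.postcomp {Z : V} {F G H : EnrichedFunctor V A V}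
    {θ : ∀ a, Z ⊗ F.obj a ⟶ G.obj a} {κ : ∀ a, G.obj a ⟶ H.obj a}
    (hθ : NatFam F G θ) (hκ : NatMor G H κ) :
    NatFam F H (fun a => θ a ≫ κ a) := by
  intro a b
  have h1 := hθ a b
  rw [comp_whiskerRight, Category.assoc, ← hκ, ← reassoc_of% h1]

lemma NatMor.inv {F G : EnrichedFunctor V A V} {κ : ∀ a, F.obj a ⟶ G.obj a}
    (hκ : NatMor F G κ) (h : ∀ a, IsIso (κ a)) :
    NatMor G F (fun a => CategoryTheory.inv (κ a)) := by
  intro a b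
  rw [IsIso.comp_inv_eq, Category.assoc, hκ, ← comp_whiskerRight_assoc, IsIso.inv_hom_id,
    id_whiskerRight, Category.id_comp]

lemma NatMor.restrict {F G : EnrichedFunctor V A V}
    {κ : ∀ a, F.obj a ⟶ G.obj a} (h : NatMor F G κ) (P : EnrichedFunctor V K A) :
    NatMor (P.comp V F) (P.comp V G) (fun a => κ (P.obj a)) := by
  intro a b
  have h1 := h (P.obj a) (P.obj b)
  rw [act_comp, act_comp]
  change (F.obj (P.obj a) ◁ P.map a b ≫ act F _ _) ≫ κ (P.obj b) =
    κ (P.obj a) ▷ _ ≫ G.obj (P.obj a) ◁ P.map a b ≫ act G _ _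
  rw [← whisker_exchange_assoc, ← h1, Category.assoc]

/-- `E`, with the maps `p a : E ⊗ F a ⟶ G a`, represents the natural families `Z ⊗ F a ⟶ G a`. -/
structure IsEnd (F G : EnrichedFunctor V A V) (E : V) (p : ∀ a, E ⊗ F.obj a ⟶ G.obj a) : Prop where
  nat : NatFam F G p
  existsUnique : ∀ (Z : V) (θ : ∀ a, Z ⊗ F.obj a ⟶ G.obj a), NatFam F G θ →
    ∃! t : Z ⟶ E, ∀ a, t ▷ _ ≫ p a = θ a

lemma IsEnd.hom_ext {F G : EnrichedFunctor V A V} {E : V} {p : ∀ a, E ⊗ F.obj a ⟶ G.obj a}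
    (h : IsEnd F G E p) {Z : V} {s t : Z ⟶ E} (hst : ∀ a, s ▷ _ ≫ p a = t ▷ _ ≫ p a) : s = t :=
  (h.existsUnique Z _ (h.nat.precomp t)).unique hst (fun _ => rfl)

/-- Ends are transported along natural isomorphisms. -/
lemma IsEnd.postcomp {F G H : EnrichedFunctor V A V} {E : V} {p : ∀ a, E ⊗ F.obj a ⟶ G.obj a}
    (h : IsEnd F G E p) {κ : ∀ a, G.obj a ⟶ H.obj a} (hκ : NatMor G H κ)
    (hi : ∀ a, IsIso (κ a)) : IsEnd F H E (fun a => p a ≫ κ a) where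
  nat := h.nat.postcomp hκ
  existsUnique Z θ hθ := by
    obtain ⟨t, ht, hu⟩ := h.existsUnique Z _ (hθ.postcomp (hκ.inv hi))
    refine ⟨t, fun a => ?_, fun s hs => hu s fun a => ?_⟩
    · rw [← Category.assoc, ht]; simp
    · have := hs a
      rw [← Category.assoc] at this
      simp [← this]

lemma IsEnd.isIso {F G : EnrichedFunctor V A V} {E E' : V} {p : ∀ a, E ⊗ F.obj a ⟶ G.obj a}
    {p' : ∀ a, E' ⊗ F.obj a ⟶ G.obj a} (h : IsEnd F G E p) (h' : IsEnd F G E' p')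
    {e : E' ⟶ E} (he : ∀ a, e ▷ _ ≫ p a = p' a) : IsIso e := by
  obtain ⟨f, hf, -⟩ := h'.existsUnique E p h.nat
  refine ⟨f, h'.hom_ext fun a => ?_, h.hom_ext fun a => ?_⟩
  · rw [comp_whiskerRight, Category.assoc, hf, he]; simp
  · rw [comp_whiskerRight, Category.assoc, he, hf]; simp

lemma IsEnd.of_isIso {F G : EnrichedFunctor V A V} {E E' : V} {p : ∀ a, E ⊗ F.obj a ⟶ G.obj a}
    (h : IsEnd F G E p) (e : E' ⟶ E) [IsIso e] : IsEnd F G E' (fun a => e ▷ _ ≫ p a) where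
  nat := h.nat.precomp e
  existsUnique Z θ hθ := by
    obtain ⟨t, ht, hu⟩ := h.existsUnique Z θ hθ
    refine ⟨t ≫ inv e, fun a => ?_, fun s hs => ?_⟩
    · rw [comp_whiskerRight, Category.assoc, ← comp_whiskerRight_assoc (inv e)]
      simpa using ht a
    · rw [IsIso.eq_comp_inv]
      refine hu _ fun a => ?_
      rw [comp_whiskerRight, Category.assoc, hs]

/-- If two ends are related by a natural isomorphism of their integrands, the induced comparison
is an isomorphism. -/
lemma IsEnd.isIso_of_natMor {F G G' : EnrichedFunctor V A V} {E E' : V}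
    {p : ∀ a, E ⊗ F.obj a ⟶ G.obj a} {p' : ∀ a, E' ⊗ F.obj a ⟶ G'.obj a}
    (h : IsEnd F G E p) (h' : IsEnd F G' E' p') {κ : ∀ a, G.obj a ⟶ G'.obj a} (hκ : NatMor G G' κ)
    (hi : ∀ a, IsIso (κ a)) {e : E ⟶ E'} (he : ∀ a, e ▷ _ ≫ p' a = p a ≫ κ a) : IsIso e :=
  h'.isIso (h.postcomp hκ hi) he

lemma IsEnd.of_natMor {F G G' : EnrichedFunctor V A V} {E E' : V}
    {p : ∀ a, E ⊗ F.obj a ⟶ G.obj a} {p' : ∀ a, E' ⊗ F.obj a ⟶ G'.obj a}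
    (h' : IsEnd F G' E' p') {κ : ∀ a, G.obj a ⟶ G'.obj a} (hκ : NatMor G G' κ)
    (hi : ∀ a, IsIso (κ a)) {e : E ⟶ E'} [IsIso e] (he : ∀ a, e ▷ _ ≫ p' a = p a ≫ κ a) :
    IsEnd F G E p := by
  have := (h'.of_isIso e).postcomp (hκ.inv hi) (fun a => inferInstance)
  convert this using 2 with a
  rw [he]; simp

section Swap

variable [SymmetricCategory V]

/-- The generalized element of an internal hom with prescribed transpose. -/
def swapHom {Z X Y : V} (θ : Z ⊗ X ⟶ Y) : Z ⟶ EnrichedCategory.Hom (V := V) X Y :=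
  MonoidalClosed.curry ((β_ X Z).hom ≫ θ)

/-- The transpose of a generalized element of an internal hom. -/
def unswap {Z X Y : V} (t : Z ⟶ EnrichedCategory.Hom (V := V) X Y) : Z ⊗ X ⟶ Y :=
  (β_ Z X).hom ≫ MonoidalClosed.uncurry t

@[simp] lemma unswap_swapHom {Z X Y : V} (θ : Z ⊗ X ⟶ Y) : unswap (swapHom θ) = θ := by
  rw [unswap, swapHom, MonoidalClosed.uncurry_curry, SymmetricCategory.symmetry_assoc]

@[simp] lemma swapHom_unswap {Z X Y : V} (t : Z ⟶ EnrichedCategory.Hom (V := V) X Y) :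
    swapHom (unswap t) = t := by
  rw [unswap, swapHom, SymmetricCategory.symmetry_assoc, MonoidalClosed.curry_uncurry]

lemma swapHom_injective {Z X Y : V} {θ θ' : Z ⊗ X ⟶ Y} (h : swapHom θ = swapHom θ') : θ = θ' := by
  rw [← unswap_swapHom θ, h, unswap_swapHom]

lemma unswap_injective {Z X Y : V} {θ θ' : Z ⟶ EnrichedCategory.Hom (V := V) X Y}
    (h : unswap θ = unswap θ') : θ = θ' := by
  rw [← swapHom_unswap θ, h, swapHom_unswap]

lemma unswap_precomp {Z Z' X Y : V} (s : Z' ⟶ Z) (t : Z ⟶ EnrichedCategory.Hom (V := V) X Y) :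
    unswap (s ≫ t) = s ▷ _ ≫ unswap t := by
  rw [unswap, unswap, MonoidalClosed.uncurry_natural_left,
    BraidedCategory.braiding_naturality_left_assoc]

lemma swapHom_precomp {Z Z' X Y : V} (s : Z' ⟶ Z) (θ : Z ⊗ X ⟶ Y) :
    s ≫ swapHom θ = swapHom (s ▷ _ ≫ θ) := by
  apply unswap_injective
  rw [unswap_precomp]; simp

lemma isNat_iff_natFam {Z : V} (F G : EnrichedFunctor V A V)
    (θ : ∀ a, Z ⟶ EnrichedCategory.Hom (V := V) (F.obj a) (G.obj a)) :
    IsNat F G θ ↔ NatFam F G (fun a => unswap (θ a)) := by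
  refine forall₂_congr fun a b => ?_
  change (β_ Z (a ⟶[V] b)).hom ≫ cmp (F.map a b) (θ b) = cmp (θ a) (G.map a b) ↔ _
  rw [← MonoidalClosed.uncurry_injective.eq_iff, MonoidalClosed.uncurry_natural_left, uncurry_cmp,
    uncurry_cmp, ← cancel_epi (α_ (F.obj a) Z (a ⟶[V] b)).hom,
    ← cancel_epi ((β_ Z (F.obj a)).hom ▷ (a ⟶[V] b))]
  refine iff_of_eq (congrArg₂ _ ?_ ?_)
  · dsimp only [unswap, act]
    rw [BraidedCategory.braiding_naturality_right_assoc]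
    simp [BraidedCategory.braiding_tensor_right_hom]
  · dsimp only [unswap, act]
    simp

lemma isNat_swapHom {Z : V} (F G : EnrichedFunctor V A V)
    (θ : ∀ a, Z ⊗ F.obj a ⟶ G.obj a) :
    IsNat F G (fun a => swapHom (θ a)) ↔ NatFam F G θ := by
  rw [isNat_iff_natFam]; simp

/-- The object of natural transformations between `V`-valued functors is an end. -/
lemma isNatObject_swapHom {F G : EnrichedFunctor V A V} {E : V}
    {p : ∀ a, E ⊗ F.obj a ⟶ G.obj a} :
    IsNatObject F G E (fun a => swapHom (p a)) ↔ IsEnd F G E p := by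
  constructor
  · rintro ⟨h1, h2⟩
    refine ⟨(isNat_swapHom _ _ _).1 h1, fun Z θ hθ => ?_⟩
    obtain ⟨t, ht, hu⟩ := h2 Z _ ((isNat_swapHom _ _ _).2 hθ)
    refine ⟨t, fun a => swapHom_injective ?_, fun s hs => hu s fun a => ?_⟩
    · rw [← swapHom_precomp, ht]
    · rw [swapHom_precomp, hs]
  · rintro ⟨h1, h2⟩
    refine ⟨(isNat_swapHom _ _ _).2 h1, fun Z θ hθ => ?_⟩
    obtain ⟨t, ht, hu⟩ := h2 Z _ ((isNat_iff_natFam _ _ _).1 hθ)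
    refine ⟨t, fun a => ?_, fun s hs => hu s fun a => ?_⟩
    · rw [swapHom_precomp, ht, swapHom_unswap]
    · rw [← hs a, swapHom_precomp, unswap_swapHom]

/-- Naturality of a family `Z ⊗ F a ⟶ K(X, S a)`: a cone over `S` with vertex `X`, weighted by
`Z ⊗ F`. -/
def ConeNat {Z : V} {X : K} (F : EnrichedFunctor V A V) (S : EnrichedFunctor V A K)
    (θ : ∀ a, Z ⊗ F.obj a ⟶ (X ⟶[V] S.obj a)) : Prop :=
  ∀ a b, (α_ _ _ _).hom ≫ Z ◁ act F a b ≫ θ b = cmp (θ a) (S.map a b)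

lemma natFam_coyon_iff {Z : V} {X : K} {F : EnrichedFunctor V A V} {S : EnrichedFunctor V A K}
    {θ : ∀ a, Z ⊗ F.obj a ⟶ (X ⟶[V] S.obj a)} :
    NatFam F (S.comp V (coyon X)) θ ↔ ConeNat F S θ := by
  refine forall₂_congr fun a b => Eq.congr rfl ?_
  rw [act_comp, act_coyon, cmp, MonoidalCategory.tensorHom_def, Category.assoc]
  rfl

/-- `π` is a cone over `S` weighted by `F`. -/
def IsCone (F : EnrichedFunctor V A V) (S : EnrichedFunctor V A K) (L : K)
    (π : ∀ a, F.obj a ⟶ (L ⟶[V] S.obj a)) : Prop :=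
  ∀ a b, act F a b ≫ π b = cmp (π a) (S.map a b)

lemma IsCone.coneNat {F : EnrichedFunctor V A V} {S : EnrichedFunctor V A K} {L X : K}
    {π : ∀ a, F.obj a ⟶ (L ⟶[V] S.obj a)} (h : IsCone F S L π) {Z : V} (t : Z ⟶ (X ⟶[V] L)) :
    ConeNat F S (fun a => cmp t (π a)) := by
  intro a b
  dsimp only
  rw [cmp_assoc, ← h, cmp_precomp_right]

lemma isCone_iff_coneNat {F : EnrichedFunctor V A V} {S : EnrichedFunctor V A K} {L : K}
    {π : ∀ a, F.obj a ⟶ (L ⟶[V] S.obj a)} :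
    IsCone F S L π ↔ ConeNat F S (fun a => (λ_ (F.obj a)).hom ≫ π a) := by
  refine forall₂_congr fun a b => ?_
  rw [cmp_precomp_left, leftUnitor_naturality_assoc, leftUnitor_tensor_hom]
  simp

/-- The universal property of a weighted limit, tested at a single object `X`. -/
def IsLimAt (X : K) (F : EnrichedFunctor V A V) (S : EnrichedFunctor V A K) (L : K)
    (π : ∀ a, F.obj a ⟶ (L ⟶[V] S.obj a)) : Prop :=
  ∀ (Z : V) (θ : ∀ a, Z ⊗ F.obj a ⟶ (X ⟶[V] S.obj a)), ConeNat F S θ →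
    ∃! t : Z ⟶ (X ⟶[V] L), ∀ a, cmp t (π a) = θ a

lemma cmp_eq_whisker {X L : K} {Y : K} {Z W : V} (t : Z ⟶ (X ⟶[V] L)) (p : W ⟶ (L ⟶[V] Y)) :
    t ▷ _ ≫ cmp (𝟙 _) p = cmp t p := by
  rw [← cmp_precomp_left, Category.comp_id]

/-- The universal property of a limit cone at `X`, as an end: the first condition only says that the
maps `K(X, L) ⊗ F a ⟶ K(X, S a)` induced by `π` are natural. -/
lemma isEnd_coyon_iff {X : K} {F : EnrichedFunctor V A V} {S : EnrichedFunctor V A K} {L : K}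
    {π : ∀ a, F.obj a ⟶ (L ⟶[V] S.obj a)} :
    IsEnd F (S.comp V (coyon X)) (X ⟶[V] L) (fun a => cmp (𝟙 (X ⟶[V] L)) (π a)) ↔
      ConeNat F S (fun a => cmp (𝟙 (X ⟶[V] L)) (π a)) ∧ IsLimAt X F S L π := by
  constructor
  · rintro ⟨h1, h2⟩
    refine ⟨natFam_coyon_iff.1 h1, fun Z θ hθ => ?_⟩
    obtain ⟨t, ht, hu⟩ := h2 Z θ (natFam_coyon_iff.2 hθ)
    exact ⟨t, fun a => (cmp_eq_whisker _ _).symm.trans (ht a),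
      fun s hs => hu s fun a => (cmp_eq_whisker _ _).trans (hs a)⟩
  · rintro ⟨h1, h2⟩
    refine ⟨natFam_coyon_iff.2 h1, fun Z θ hθ => ?_⟩
    obtain ⟨t, ht, hu⟩ := h2 Z θ (natFam_coyon_iff.1 hθ)
    exact ⟨t, fun a => (cmp_eq_whisker _ _).trans (ht a),
      fun s hs => hu s fun a => (cmp_eq_whisker _ _).symm.trans (hs a)⟩

lemma IsCone.of_coneNat {F : EnrichedFunctor V A V} {S : EnrichedFunctor V A K} {L : K}
    {π : ∀ a, F.obj a ⟶ (L ⟶[V] S.obj a)}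
    (h : ConeNat F S (fun a => cmp (𝟙 (L ⟶[V] L)) (π a))) : IsCone F S L π := by
  rw [isCone_iff_coneNat]
  intro a b
  have h1 := congrArg (fun t => (eId V L ▷ _) ▷ _ ≫ t) (h a b)
  have key : ∀ c, eId V L ▷ _ ≫ cmp (𝟙 (L ⟶[V] L)) (π c) = (λ_ _).hom ≫ π c := fun c => by
    rw [cmp_eq_whisker, eId_cmp]
  dsimp only at h1 ⊢
  rw [← cmp_precomp_left, key] at h1
  rw [← h1, associator_naturality_left_assoc, ← whisker_exchange_assoc, key]

/-- A weighted limit is a cone which every object sees as a limit. This replaces the definition by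
internal homs with equations between generalized elements. -/
lemma isWeightedLimit_iff {F : EnrichedFunctor V A V} {S : EnrichedFunctor V A K} {L : K}
    {π : ∀ a, F.obj a ⟶ (L ⟶[V] S.obj a)} :
    IsWeightedLimit F S L π ↔ IsCone F S L π ∧ ∀ X, IsLimAt X F S L π := by
  have key : ∀ X : K, IsNatObject F (S.comp V (coyon X)) (X ⟶[V] L) (fun a =>
      MonoidalClosed.curry ((β_ (F.obj a) (X ⟶[V] L)).hom ≫
      ((X ⟶[V] L) ◁ π a) ≫ eComp V X L (S.obj a))) ↔
      ConeNat F S (fun a => cmp (𝟙 (X ⟶[V] L)) (π a)) ∧ IsLimAt X F S L π := by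
    intro X
    refine Iff.trans ?_ (isNatObject_swapHom.trans isEnd_coyon_iff)
    have : (fun a => swapHom (cmp (𝟙 (X ⟶[V] L)) (π a))) = fun a =>
        MonoidalClosed.curry ((β_ (F.obj a) (X ⟶[V] L)).hom ≫
        ((X ⟶[V] L) ◁ π a) ≫ eComp V X L (S.obj a)) := by
      funext a
      simp [swapHom, cmp]
    exact iff_of_eq (congrArg _ this.symm)
  constructor
  · intro h
    exact ⟨IsCone.of_coneNat ((key L).1 (h L)).1, fun X => ((key X).1 (h X)).2⟩
  · rintro ⟨h1, h2⟩ X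
    exact (key X).2 ⟨h1.coneNat _, h2 X⟩

lemma IsWeightedLimit.isCone {F : EnrichedFunctor V A V} {S : EnrichedFunctor V A K} {L : K}
    {π : ∀ a, F.obj a ⟶ (L ⟶[V] S.obj a)} (h : IsWeightedLimit F S L π) : IsCone F S L π :=
  (isWeightedLimit_iff.1 h).1

lemma IsWeightedLimit.isLimAt {F : EnrichedFunctor V A V} {S : EnrichedFunctor V A K} {L : K}
    {π : ∀ a, F.obj a ⟶ (L ⟶[V] S.obj a)} (h : IsWeightedLimit F S L π) (X : K) :
    IsLimAt X F S L π :=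
  (isWeightedLimit_iff.1 h).2 X

lemma IsWeightedLimit.isEnd {F : EnrichedFunctor V A V} {S : EnrichedFunctor V A K} {L : K}
    {π : ∀ a, F.obj a ⟶ (L ⟶[V] S.obj a)} (h : IsWeightedLimit F S L π) (X : K) :
    IsEnd F (S.comp V (coyon X)) (X ⟶[V] L) (fun a => cmp (𝟙 (X ⟶[V] L)) (π a)) :=
  isEnd_coyon_iff.2 ⟨h.isCone.coneNat _, h.isLimAt X⟩

lemma IsLimAt.hom_ext {X : K} {F : EnrichedFunctor V A V} {S : EnrichedFunctor V A K} {L : K}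
    {π : ∀ a, F.obj a ⟶ (L ⟶[V] S.obj a)} (h : IsLimAt X F S L π) (hc : IsCone F S L π) {Z : V}
    {s t : Z ⟶ (X ⟶[V] L)} (hst : ∀ a, cmp s (π a) = cmp t (π a)) : s = t :=
  (h Z _ (hc.coneNat t)).unique hst (fun _ => rfl)

lemma IsWeightedLimit.hom_ext {F : EnrichedFunctor V A V} {S : EnrichedFunctor V A K} {L : K}
    {π : ∀ a, F.obj a ⟶ (L ⟶[V] S.obj a)} (h : IsWeightedLimit F S L π) {X : K} {Z : V}
    {s t : Z ⟶ (X ⟶[V] L)} (hst : ∀ a, cmp s (π a) = cmp t (π a)) : s = t :=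
  (h.isLimAt X).hom_ext h.isCone hst

/-- A weighted limit in `V` is an end. -/
lemma isWeightedLimit_self_iff {F G : EnrichedFunctor V A V} {E : V}
    {π : ∀ a, F.obj a ⟶ EnrichedCategory.Hom (V := V) E (G.obj a)} :
    IsWeightedLimit F G E π ↔ IsEnd F G E (fun a => MonoidalClosed.uncurry (π a)) := by
  have hcone : IsCone F G E π ↔ NatFam F G (fun a => MonoidalClosed.uncurry (π a)) := by
    refine forall₂_congr fun a b => ?_
    rw [← MonoidalClosed.uncurry_injective.eq_iff, MonoidalClosed.uncurry_natural_left,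
      uncurry_cmp, ← cancel_epi (α_ E (F.obj a) (a ⟶[V] b)).hom, Iso.hom_inv_id_assoc]
    rfl
  -- Transposition along `X ⊗ -` turns cones with vertex `X` into natural families.
  have htr : ∀ (X Z : V) (θ : ∀ a, Z ⊗ F.obj a ⟶ EnrichedCategory.Hom (V := V) X (G.obj a)),
      ConeNat F G θ ↔
        NatFam F G (fun a => (α_ X Z (F.obj a)).hom ≫ MonoidalClosed.uncurry (θ a)) := by
    intro X Z θ
    refine forall₂_congr fun a b => ?_
    rw [← MonoidalClosed.uncurry_injective.eq_iff, MonoidalClosed.uncurry_natural_left,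
      MonoidalClosed.uncurry_natural_left, uncurry_cmp,
      ← cancel_epi (α_ X (Z ⊗ F.obj a) (a ⟶[V] b)).hom, Iso.hom_inv_id_assoc,
      ← cancel_epi ((α_ X Z (F.obj a)).hom ▷ (a ⟶[V] b))]
    dsimp only [act]
    simp
  have hcmp : ∀ (X Z : V) (t : Z ⟶ EnrichedCategory.Hom (V := V) X E) (a : A),
      (α_ X Z (F.obj a)).hom ≫ MonoidalClosed.uncurry (cmp t (π a)) =
        MonoidalClosed.uncurry t ▷ _ ≫ MonoidalClosed.uncurry (π a) := by
    intro X Z t a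
    rw [uncurry_cmp, Iso.hom_inv_id_assoc]
  rw [isWeightedLimit_iff]
  constructor
  · rintro ⟨h1, h2⟩
    refine ⟨hcone.1 h1, fun Z θ hθ => ?_⟩
    have e : ∀ a, (α_ (𝟙_ V) Z (F.obj a)).hom ≫ MonoidalClosed.uncurry
        (MonoidalClosed.curry ((λ_ _).hom ≫ θ a)) = (λ_ Z).hom ▷ _ ≫ θ a := by
      intro a
      rw [MonoidalClosed.uncurry_curry]; simp
    obtain ⟨t, ht, hu⟩ := h2 (𝟙_ V) Z (fun a => MonoidalClosed.curry ((λ_ _).hom ≫ θ a)) (by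
      rw [htr]
      simp only [e]
      exact hθ.precomp _)
    refine ⟨(λ_ Z).inv ≫ MonoidalClosed.uncurry t, fun a => ?_, fun s hs => ?_⟩
    · rw [comp_whiskerRight, Category.assoc, ← hcmp, ht, e, ← comp_whiskerRight_assoc]
      simp
    · rw [Iso.eq_inv_comp, ← MonoidalClosed.curry_eq_iff]
      refine hu _ fun a => MonoidalClosed.uncurry_injective ?_
      rw [← cancel_epi (α_ (𝟙_ V) Z (F.obj a)).hom, hcmp, e, MonoidalClosed.uncurry_curry,
        ← hs a, comp_whiskerRight, Category.assoc]
  · intro h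
    refine ⟨hcone.2 h.nat, fun X Z θ hθ => ?_⟩
    obtain ⟨t, ht, hu⟩ := h.existsUnique _ _ ((htr X Z θ).1 hθ)
    refine ⟨MonoidalClosed.curry t, fun a => MonoidalClosed.uncurry_injective ?_, fun s hs => ?_⟩
    · rw [← cancel_epi (α_ X Z (F.obj a)).hom, hcmp, MonoidalClosed.uncurry_curry, ht]
    · rw [MonoidalClosed.eq_curry_iff]
      refine hu _ fun a => ?_
      rw [← hcmp, hs]

end Swap

end Closed

/-! ### Comparison, preservation and reflection of weighted limits -/

section General

variable [MonoidalClosed V] [SymmetricCategory V] {A : Type w₁} {K : Type w₂} {N : Type w₃}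
  [EnrichedCategory V A] [EnrichedCategory V K] [EnrichedCategory V N]

lemma uncurry_comp_map (P : EnrichedFunctor V K V) {x y : K} {Z : V} (f : Z ⟶ (x ⟶[V] y)) :
    MonoidalClosed.uncurry (f ≫ P.map x y) = P.obj x ◁ f ≫ act P x y :=
  MonoidalClosed.uncurry_natural_left _ _

lemma IsWeightedLimit.congr {F : EnrichedFunctor V A V} {S : EnrichedFunctor V A K} {L : K}
    {π π' : ∀ a, F.obj a ⟶ (L ⟶[V] S.obj a)} (h : ∀ a, π a = π' a)
    (hL : IsWeightedLimit F S L π) : IsWeightedLimit F S L π' := by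
  obtain rfl : π = π' := funext h
  exact hL

/-- Weighted limits only depend on the diagram up to propositional equality of its action on
hom-objects. It is used to pass between `(S.comp P).comp Q` and `S.comp (P.comp Q)`. -/
lemma IsWeightedLimit.congr_map {F : EnrichedFunctor V A V} {o : A → K}
    {m m' : ∀ a b : A, (a ⟶[V] b) ⟶ (o a ⟶[V] o b)} {h₁ h₂ h₁' h₂'} (h : ∀ a b, m a b = m' a b)
    {L : K} {π : ∀ a, F.obj a ⟶ (L ⟶[V] o a)} (hL : IsWeightedLimit F ⟨o, m, h₁, h₂⟩ L π) :
    IsWeightedLimit F ⟨o, m', h₁', h₂'⟩ L π := by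
  obtain rfl : m = m' := funext fun a => funext (h a)
  exact hL

lemma natMor_post (X : K) {S S' : EnrichedFunctor V A K}
    {η : ∀ a, 𝟙_ V ⟶ (S'.obj a ⟶[V] S.obj a)} (hη : IsNat₁ S' S η) :
    NatMor (S'.comp V (coyon X)) (S.comp V (coyon X)) (fun a => post X (η a)) := by
  intro a b
  have h1 : ∀ T : EnrichedFunctor V A K, act (T.comp V (coyon X)) a b =
      cmp (𝟙 (X ⟶[V] T.obj a)) (T.map a b) := by
    intro T
    rw [act_comp, act_coyon, cmp, MonoidalCategory.id_tensorHom]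
    rfl
  rw [h1, h1]
  change cmp (𝟙 (X ⟶[V] S'.obj a)) (S'.map a b) ≫ post X (η b) =
    post X (η a) ▷ _ ≫ cmp (𝟙 (X ⟶[V] S.obj a)) (S.map a b)
  rw [cmp_comp_post, hη, cmp_eq_whisker, ← cmp_post_left, Category.id_comp]

section Comparison

variable {F : EnrichedFunctor V A V} {S S' : EnrichedFunctor V A K} {L L' : K}
  {π : ∀ a, F.obj a ⟶ (L ⟶[V] S.obj a)} {π' : ∀ a, F.obj a ⟶ (L' ⟶[V] S'.obj a)}
  {η : ∀ a, 𝟙_ V ⟶ (S'.obj a ⟶[V] S.obj a)} {ε : 𝟙_ V ⟶ (L' ⟶[V] L)} {X : K}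

/-- The square comparing the cones `π` and `π'` as seen by `X`. -/
lemma post_whisker_cmp (hc : ∀ a, π' a ≫ post L' (η a) = π a ≫ pre ε (S.obj a)) (a : A) :
    post X ε ▷ _ ≫ cmp (𝟙 (X ⟶[V] L)) (π a) = cmp (𝟙 (X ⟶[V] L')) (π' a) ≫ post X (η a) := by
  rw [cmp_eq_whisker, cmp_comp_post, hc, ← cmp_post_left, Category.id_comp]

/-- If a transformation of diagrams is seen as invertible by `X`, then so is the induced arrow
between objects which are limits as seen by `X`. -/
lemma IsLimAt.isIso_post (hη : IsNat₁ S' S η) (hi : ∀ a, IsIso (post X (η a)))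
    (hπ : IsCone F S L π) (hπ' : IsCone F S' L' π')
    (hc : ∀ a, π' a ≫ post L' (η a) = π a ≫ pre ε (S.obj a))
    (h : IsLimAt X F S L π) (h' : IsLimAt X F S' L' π') : IsIso (post X ε) :=
  (isEnd_coyon_iff.2 ⟨hπ'.coneNat _, h'⟩).isIso_of_natMor (isEnd_coyon_iff.2 ⟨hπ.coneNat _, h⟩)
    (natMor_post X hη) hi (post_whisker_cmp hc)

/-- A cone is a limit as seen by `X` as soon as it is related to a limit cone by arrows which
`X` sees as invertible. -/
lemma IsLimAt.of_isIso_post (hη : IsNat₁ S' S η) (hi : ∀ a, IsIso (post X (η a)))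
    (hπ : IsCone F S L π)
    (hc : ∀ a, π' a ≫ post L' (η a) = π a ≫ pre ε (S.obj a))
    (h : IsLimAt X F S L π) (hε : IsIso (post X ε)) : IsLimAt X F S' L' π' :=
  (isEnd_coyon_iff.1 ((isEnd_coyon_iff.2 ⟨hπ.coneNat _, h⟩).of_natMor
    (natMor_post X hη) hi (post_whisker_cmp hc))).2

end Comparison

lemma IsNat₁.id (S : EnrichedFunctor V A K) : IsNat₁ S S (fun a => eId V (S.obj a)) := by
  intro a b; simp

lemma IsNat₁.restrict {P Q : EnrichedFunctor V K N} {η : ∀ x, 𝟙_ V ⟶ (P.obj x ⟶[V] Q.obj x)}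
    (h : IsNat₁ P Q η) (S : EnrichedFunctor V A K) :
    IsNat₁ (S.comp V P) (S.comp V Q) (fun a => η (S.obj a)) := by
  intro a b
  change (S.map a b ≫ P.map _ _) ≫ post (P.obj (S.obj a)) (η (S.obj b)) =
    (S.map a b ≫ Q.map _ _) ≫ pre (η (S.obj a)) (Q.obj (S.obj b))
  rw [Category.assoc, Category.assoc, h]

lemma IsNat₁.inv {S S' : EnrichedFunctor V A K} {η : ∀ x, 𝟙_ V ⟶ (S.obj x ⟶[V] S'.obj x)}
    {η' : ∀ x, 𝟙_ V ⟶ (S'.obj x ⟶[V] S.obj x)} (h : IsNat₁ S S' η)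
    (hi : ∀ x, InvPair (η x) (η' x)) : IsNat₁ S' S η' := by
  intro a b
  have h1 := congrArg (fun t => t ≫ pre (η' a) _ ≫ post _ (η' b)) (h a b)
  simp only [Category.assoc] at h1
  rw [← reassoc_of% (pre_comp (t := S'.obj b) (η' a) (η a)), (hi a).right, pre_eId,
    Category.id_comp, reassoc_of% (post_pre (η b) (η' a)), ← post_comp,
    (hi b).left, post_eId, Category.comp_id] at h1
  exact h1.symm

lemma IsCone.map {F : EnrichedFunctor V A V} {S : EnrichedFunctor V A K} {L : K}
    {π : ∀ a, F.obj a ⟶ (L ⟶[V] S.obj a)} (h : IsCone F S L π) (P : EnrichedFunctor V K N) :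
    IsCone F (S.comp V P) (P.obj L) (fun a => π a ≫ P.map L (S.obj a)) := by
  intro a b
  change act F a b ≫ π b ≫ P.map L (S.obj b) =
    cmp (π a ≫ P.map L (S.obj a)) (S.map a b ≫ P.map _ _)
  rw [← cmp_map, ← h a b, Category.assoc]

lemma IsCone.post {F : EnrichedFunctor V A V} {S S' : EnrichedFunctor V A K} {L : K}
    {π : ∀ a, F.obj a ⟶ (L ⟶[V] S.obj a)} (h : IsCone F S L π)
    {η : ∀ a, 𝟙_ V ⟶ (S.obj a ⟶[V] S'.obj a)} (hη : IsNat₁ S S' η) :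
    IsCone F S' L (fun a => π a ≫ post L (η a)) := by
  intro a b
  dsimp only
  rw [← Category.assoc, h a b, cmp_comp_post, hη, cmp_post_left]

lemma IsCone.pre {F : EnrichedFunctor V A V} {S : EnrichedFunctor V A K} {L L' : K}
    {π : ∀ a, F.obj a ⟶ (L ⟶[V] S.obj a)} (h : IsCone F S L π) (e : 𝟙_ V ⟶ (L' ⟶[V] L)) :
    IsCone F S L' (fun a => π a ≫ pre e (S.obj a)) := by
  intro a b
  dsimp only
  rw [← Category.assoc, h a b, cmp_comp_pre]

/-- The arrow into a limit induced by a cone. -/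
lemma IsWeightedLimit.exists_lift {F : EnrichedFunctor V A V} {S : EnrichedFunctor V A K} {L X : K}
    {π : ∀ a, F.obj a ⟶ (L ⟶[V] S.obj a)} (h : IsWeightedLimit F S L π)
    {ρ : ∀ a, F.obj a ⟶ (X ⟶[V] S.obj a)} (hρ : IsCone F S X ρ) :
    ∃ e : 𝟙_ V ⟶ (X ⟶[V] L), ∀ a, π a ≫ PhiTheory.pre e (S.obj a) = ρ a := by
  obtain ⟨t, ht, -⟩ := h.isLimAt X (𝟙_ V) _ (isCone_iff_coneNat.1 hρ)
  refine ⟨t, fun a => ?_⟩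
  rw [comp_pre, ht, Iso.inv_hom_id_assoc]

lemma IsWeightedLimit.of_invPair {F : EnrichedFunctor V A V} {S : EnrichedFunctor V A K} {L L' : K}
    {π : ∀ a, F.obj a ⟶ (L ⟶[V] S.obj a)} (h : IsWeightedLimit F S L π)
    {e : 𝟙_ V ⟶ (L' ⟶[V] L)} {e' : 𝟙_ V ⟶ (L ⟶[V] L')} (he : InvPair e e') :
    IsWeightedLimit F S L' (fun a => π a ≫ PhiTheory.pre e (S.obj a)) :=
  isWeightedLimit_iff.2 ⟨h.isCone.pre e, fun X => (h.isLimAt X).of_isIso_post (IsNat₁.id S)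
    (fun a => by rw [post_eId]; infer_instance) h.isCone (fun a => by simp) (he.isIso_post X)⟩

/-- Weighted limits are unique up to isomorphism. -/
lemma IsWeightedLimit.exists_invPair {F : EnrichedFunctor V A V} {S : EnrichedFunctor V A K}
    {L L' : K} {π : ∀ a, F.obj a ⟶ (L ⟶[V] S.obj a)} {π' : ∀ a, F.obj a ⟶ (L' ⟶[V] S.obj a)}
    (h : IsWeightedLimit F S L π) (h' : IsWeightedLimit F S L' π') :
    ∃ (e : 𝟙_ V ⟶ (L' ⟶[V] L)) (e' : 𝟙_ V ⟶ (L ⟶[V] L')), InvPair e e' ∧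
      ∀ a, π a ≫ PhiTheory.pre e (S.obj a) = π' a := by
  obtain ⟨e, he⟩ := h.exists_lift h'.isCone
  have hi : ∀ X, IsIso (PhiTheory.post X e) := fun X => (h.isLimAt X).isIso_post (IsNat₁.id S)
    (fun a => by rw [post_eId]; infer_instance) h.isCone h'.isCone (fun a => by simp [he])
      (h'.isLimAt X)
  obtain ⟨e', he'⟩ := InvPair.of_isIso_post (hi _) (hi _)
  exact ⟨e, e', he', he⟩

/-- A functor preserves a weighted limit as soon as it preserves one limit cone. -/
lemma PreservesWeightedLimit.of_isWeightedLimit {P : EnrichedFunctor V K N}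
    {F : EnrichedFunctor V A V} {S : EnrichedFunctor V A K} {L : K}
    {π : ∀ a, F.obj a ⟶ (L ⟶[V] S.obj a)} (h : IsWeightedLimit F S L π)
    (hP : IsWeightedLimit F (S.comp V P) (P.obj L) (fun a => π a ≫ P.map L (S.obj a))) :
    PreservesWeightedLimit P F S := by
  intro L' π' h'
  obtain ⟨e, e', he, hπ⟩ := h.exists_invPair h'
  have key : ∀ a, (π a ≫ P.map L (S.obj a)) ≫ pre (e ≫ P.map L' L) (P.obj (S.obj a)) =
      π' a ≫ P.map L' (S.obj a) := fun a => by
    rw [← hπ, Category.assoc, Category.assoc, pre_map]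
  exact (hP.of_invPair (he.map P)).congr key

section FullyFaithful

variable {J : EnrichedFunctor V K N} (hJ : ∀ x y, IsIso (J.map x y))
  {F : EnrichedFunctor V A V} {S : EnrichedFunctor V A K} {L : K}
  {π : ∀ a, F.obj a ⟶ (L ⟶[V] S.obj a)}

include hJ

lemma isCone_map_iff :
    IsCone F (S.comp V J) (J.obj L) (fun a => π a ≫ J.map L (S.obj a)) ↔ IsCone F S L π := by
  refine ⟨fun h a b => ?_, fun h => h.map J⟩
  have h1 : act F a b ≫ π b ≫ J.map L (S.obj b) =
    cmp (π a ≫ J.map L (S.obj a)) (S.map a b ≫ J.map _ _) := h a b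
  have := hJ L (S.obj b)
  rw [← cmp_map, ← Category.assoc, cancel_mono] at h1
  exact h1

/-- A fully faithful functor detects limits as seen by an object in its image. -/
lemma isLimAt_map_iff {X : K} :
    IsLimAt (J.obj X) F (S.comp V J) (J.obj L) (fun a => π a ≫ J.map L (S.obj a)) ↔
      IsLimAt X F S L π := by
  have hco : ∀ (Z : V) (θ : ∀ a, Z ⊗ F.obj a ⟶ (X ⟶[V] S.obj a)),
      ConeNat F (S.comp V J) (fun a => θ a ≫ J.map X (S.obj a)) ↔ ConeNat F S θ := by
    refine fun Z θ => forall₂_congr fun a b => ?_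
    change _ ≫ _ ≫ θ b ≫ J.map X (S.obj b) =
      cmp (θ a ≫ J.map X (S.obj a)) (S.map a b ≫ J.map _ _) ↔ _
    have := hJ X (S.obj b)
    rw [← cmp_map, ← cancel_mono (J.map X (S.obj b))]
    simp only [Category.assoc]
  have hcm : ∀ (Z : V) (t : Z ⟶ (X ⟶[V] L)) (a : A),
      cmp (t ≫ J.map X L) (π a ≫ J.map L (S.obj a)) = cmp t (π a) ≫ J.map X (S.obj a) :=
    fun Z t a => (cmp_map _ _ _).symm
  have hiX := fun a => hJ X (S.obj a)
  have hiL := hJ X L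
  constructor
  · intro h Z θ hθ
    obtain ⟨t, ht, hu⟩ : ∃! t : Z ⟶ (J.obj X ⟶[V] J.obj L), ∀ a, cmp t (π a ≫ J.map L (S.obj a)) =
      θ a ≫ J.map X (S.obj a) := h Z _ ((hco Z θ).2 hθ)
    refine ⟨t ≫ inv (J.map X L), fun a => ?_, fun s hs => ?_⟩
    · rw [← cancel_mono (J.map X (S.obj a)), ← hcm]
      simpa using ht a
    · rw [IsIso.eq_comp_inv]
      exact hu _ fun a => (hcm _ _ _).trans (by rw [hs a])
  · intro h
    suffices H : ∀ (Z : V) (θ : ∀ a, Z ⊗ F.obj a ⟶ (J.obj X ⟶[V] J.obj (S.obj a))),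
        ConeNat (X := J.obj X) F (S.comp V J) θ →
        ∃! t : Z ⟶ (J.obj X ⟶[V] J.obj L), ∀ a, cmp t (π a ≫ J.map L (S.obj a)) = θ a from H
    intro Z θ hθ
    have e : ∀ a, (θ a ≫ inv (J.map X (S.obj a))) ≫ J.map X (S.obj a) = θ a := by simp
    obtain ⟨t, ht, hu⟩ := h Z (fun a => θ a ≫ inv (J.map X (S.obj a)))
      ((hco Z _).1 (by rw [← funext e] at hθ; exact hθ))
    refine ⟨t ≫ J.map X L, fun a => ?_,
      fun s (hs : ∀ a, cmp s (π a ≫ J.map L (S.obj a)) = θ a) => ?_⟩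
    · refine (hcm Z t a).trans ?_
      rw [ht, e]
    · rw [← IsIso.comp_inv_eq]
      refine hu _ fun a => ?_
      rw [← cancel_mono (J.map X (S.obj a)), ← hcm, e, ← hs a]
      simp

/-- A fully faithful functor reflects weighted limits. -/
lemma IsWeightedLimit.of_map
    (h : IsWeightedLimit F (S.comp V J) (J.obj L) (fun a => π a ≫ J.map L (S.obj a))) :
    IsWeightedLimit F S L π :=
  isWeightedLimit_iff.2 ⟨(isCone_map_iff hJ).1 h.isCone,
    fun X => (isLimAt_map_iff hJ).1 (h.isLimAt (J.obj X))⟩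

/-- A fully faithful functor creates the weighted limits whose vertex lies in its replete image. -/
lemma IsWeightedLimit.exists_of_fullyFaithful {d : N} {ρ : ∀ a, F.obj a ⟶ (d ⟶[V] J.obj (S.obj a))}
    (h : IsWeightedLimit F (S.comp V J) d ρ) (hd : Isomorphic V (J.obj L) d) :
    ∃ π : ∀ a, F.obj a ⟶ (L ⟶[V] S.obj a), IsWeightedLimit F S L π ∧
      IsWeightedLimit F (S.comp V J) (J.obj L) (fun a => π a ≫ J.map L (S.obj a)) := by
  obtain ⟨e, e', he⟩ := isomorphic_iff.1 hd
  have key : ∀ a, ρ a ≫ PhiTheory.pre e (J.obj (S.obj a)) =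
      (ρ a ≫ PhiTheory.pre e (J.obj (S.obj a)) ≫ inv (J.map L (S.obj a))) ≫
        J.map L (S.obj a) := by
    simp
  have h1 := (h.of_invPair he).congr key
  exact ⟨_, IsWeightedLimit.of_map hJ h1, h1⟩

end FullyFaithful

/-- Representable functors preserve weighted limits. -/
lemma preservesWeightedLimit_coyon (X : K) (F : EnrichedFunctor V A V)
    (S : EnrichedFunctor V A K) : PreservesWeightedLimit (coyon X) F S := by
  intro L π h
  refine isWeightedLimit_self_iff.2 ?_
  have key : ∀ a, MonoidalClosed.uncurry (π a ≫ (coyon X).map L (S.obj a)) =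
      cmp (𝟙 (X ⟶[V] L)) (π a) := fun a => by
    rw [uncurry_comp_map, act_coyon, cmp, MonoidalCategory.id_tensorHom]
    rfl
  have := h.isEnd X
  rw [← funext key] at this
  exact this

/-- Preservation of limits is invariant under natural isomorphism. -/
lemma PreservesWeightedLimit.of_natIso {P Q : EnrichedFunctor V K N}
    {η : ∀ x, 𝟙_ V ⟶ (Q.obj x ⟶[V] P.obj x)} (hη : IsNat₁ Q P η)
    (hi : ∀ X x, IsIso (post X (η x))) {F : EnrichedFunctor V A V} {S : EnrichedFunctor V A K}
    (h : PreservesWeightedLimit P F S) : PreservesWeightedLimit Q F S := by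
  intro L π hL
  have hP := h L π hL
  refine isWeightedLimit_iff.2 ⟨hL.isCone.map Q, fun X => (hP.isLimAt X).of_isIso_post
    (hη.restrict S) (fun a => hi X _) hP.isCone (ε := η L) (fun a => ?_) (hi X L)⟩
  change (π a ≫ Q.map _ _) ≫ post _ (η (S.obj a)) = (π a ≫ P.map _ _) ≫ pre (η L) _
  rw [Category.assoc, Category.assoc, hη]

lemma PreservesWeightedLimit.comp {A' : Type w} [EnrichedCategory V A'] {P : EnrichedFunctor V K N}
    {Q : EnrichedFunctor V N A'} {F : EnrichedFunctor V A V} {S : EnrichedFunctor V A K}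
    (h : PreservesWeightedLimit P F S) (h' : PreservesWeightedLimit Q F (S.comp V P)) :
    PreservesWeightedLimit (P.comp V Q) F S := by
  intro L π hL
  have key : ∀ a, (π a ≫ P.map L (S.obj a)) ≫ Q.map (P.obj L) (P.obj (S.obj a)) =
      π a ≫ P.map L (S.obj a) ≫ Q.map (P.obj L) (P.obj (S.obj a)) := by simp
  exact ((h' _ _ (h L π hL)).congr key).congr_map fun a b => Category.assoc _ _ _

/-- A natural transformation between `V`-valued functors which both preserve a limit is invertible
at the limit as soon as it is invertible at the objects of the diagram. -/
lemma isIso_of_preserves {P Q : EnrichedFunctor V K V} {κ : ∀ x, P.obj x ⟶ Q.obj x}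
    (hκ : NatMor P Q κ) {F : EnrichedFunctor V A V} {S : EnrichedFunctor V A K} {L : K}
    {π : ∀ a, F.obj a ⟶ (L ⟶[V] S.obj a)} (hL : IsWeightedLimit F S L π)
    (hP : PreservesWeightedLimit P F S) (hQ : PreservesWeightedLimit Q F S)
    (hi : ∀ a, IsIso (κ (S.obj a))) : IsIso (κ L) := by
  have h1 := isWeightedLimit_self_iff.1 (hP L π hL)
  have h2 := isWeightedLimit_self_iff.1 (hQ L π hL)
  refine h1.isIso_of_natMor h2 (hκ.restrict S) hi fun a => ?_
  refine (congrArg (κ L ▷ _ ≫ ·) (uncurry_comp_map Q (π a))).trans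
    (Eq.trans ?_ (congrArg (· ≫ κ (S.obj a)) (uncurry_comp_map P (π a))).symm)
  rw [Category.assoc, hκ, whisker_exchange_assoc]

end General

/-! ### Pointwise universal arrows assemble into functors -/

section Assembly

variable [SymmetricCategory V] {E : Type w₁} {K : Type w₂} {N : Type w₃}
  [EnrichedCategory V E] [EnrichedCategory V K] [EnrichedCategory V N]
  {ι : Type w} (W : ι → V) (S : ι → EnrichedFunctor V E N) (Y : EnrichedFunctor V K N)
  (r : E → K) (π : ∀ i e, W i ⟶ (Y.obj (r e) ⟶[V] (S i).obj e))
  (hm : ∀ (x : K) (e : E) (Z : V) (s t : Z ⟶ (x ⟶[V] r e)),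
    (∀ i, cmp (s ≫ Y.map _ _) (π i e) = cmp (t ≫ Y.map _ _) (π i e)) → s = t)
  (hex : ∀ e e', ∃ m : (e ⟶[V] e') ⟶ (r e ⟶[V] r e'), ∀ i,
    cmp (m ≫ Y.map _ _) (π i e') = (β_ _ _).hom ≫ cmp (π i e) ((S i).map e e'))

/-- Objects `r e` equipped with jointly universal families of arrows out of `Y (r e)` into
`V`-functors of `e` assemble into a `V`-functor `r`. -/
def assemble : EnrichedFunctor V E K where
  obj := r
  map e e' := (hex e e').choose
  map_id e := by
    refine hm _ _ _ _ _ fun i => ?_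
    rw [Category.assoc, cmp_precomp_left, (hex e e).choose_spec, Y.map_id, eId_cmp,
      BraidedCategory.braiding_naturality_left_assoc, ← cmp_precomp_right, (S i).map_id, cmp_eId]
    simp
  map_comp e e' e'' := by
    refine hm _ _ _ _ _ fun i => ?_
    have h1 := (hex e e').choose_spec i
    have h2 := (hex e' e'').choose_spec i
    have h3 := (hex e e'').choose_spec i
    have l : cmp ((eComp V e e' e'' ≫ (hex e e'').choose) ≫ Y.map _ _) (π i e'') =
        (β_ _ _).hom ≫ cmp (π i e) (cmp ((S i).map e e') ((S i).map e' e'')) := by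
      rw [Category.assoc, cmp_precomp_left, h3, BraidedCategory.braiding_naturality_left_assoc,
        ← cmp_precomp_right, (S i).map_comp]
      rfl
    refine l.trans ?_
    change _ = cmp (cmp (hex e e').choose (hex e' e'').choose ≫ Y.map _ _) _
    rw [cmp_map, cmp_assoc, h2, cmp_precomp_right (β_ (e' ⟶[V] e'') (W i)).hom,
      ← Iso.inv_hom_id_assoc (α_ _ _ _) (cmp _ (cmp (π i e') _)),
      ← cmp_assoc, h1, cmp_precomp_left, cmp_assoc]
    simp [BraidedCategory.braiding_tensor_left_hom]

lemma assemble_spec (i : ι) (e e' : E) :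
    cmp ((assemble W S Y r π hm hex).map e e' ≫ Y.map _ _) (π i e') =
      (β_ _ _).hom ≫ cmp (π i e) ((S i).map e e') :=
  (hex e e').choose_spec i

end Assembly

section Coreflection

variable [SymmetricCategory V] {E : Type w₁} {K : Type w₂} {N : Type w₃}
  [EnrichedCategory V E] [EnrichedCategory V K] [EnrichedCategory V N]

variable (S : EnrichedFunctor V E N) (Y : EnrichedFunctor V K N) (r : E → K)
  (ε : ∀ e, 𝟙_ V ⟶ (Y.obj (r e) ⟶[V] S.obj e))
  (hε : ∀ x e, IsIso (Y.map x (r e) ≫ post (Y.obj x) (ε e)))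

/-- Pointwise coreflections of the values of a `V`-functor `S` along `Y` assemble into a
`V`-functor. -/
def coreflect : EnrichedFunctor V E K :=
  assemble (fun _ : Unit => 𝟙_ V) (fun _ => S) Y r (fun _ e => ε e)
    (fun x e Z s t h => by
      have h1 := h ()
      have := hε x e
      rw [cmp_eq_post, cmp_eq_post, Iso.cancel_iso_hom_left, Category.assoc, Category.assoc,
        cancel_mono] at h1
      exact h1)
    (fun e e' => by
      have := hε (r e) e'
      refine ⟨S.map e e' ≫ pre (ε e) _ ≫ inv (Y.map (r e) (r e') ≫ post (Y.obj (r e)) (ε e')),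
        fun _ => ?_⟩
      rw [cmp_eq_post, cmp_eq_pre]
      simp)

lemma coreflect_isNat₁ : IsNat₁ ((coreflect S Y r ε hε).comp V Y) S ε := by
  intro e e'
  have h : cmp ((coreflect S Y r ε hε).map e e' ≫ Y.map (r e) (r e')) (ε e') =
    (β_ _ _).hom ≫ cmp (ε e) (S.map e e') := assemble_spec _ _ _ _ _ _ _ () e e'
  rw [cmp_eq_post, cmp_eq_pre] at h
  simp only [braiding_tensorUnit_right, Category.assoc, Iso.inv_hom_id_assoc,
    Iso.cancel_iso_hom_left] at h
  exact h

end Coreflection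

/-! ### Opposite categories -/

section Opposite

variable [SymmetricCategory V] {A : Type w₁} {K : Type w₂} {N : Type w₃}
  [EnrichedCategory V A] [EnrichedCategory V K] [EnrichedCategory V N]

lemma cmp_op {x y z : K} {Z W : V} (f : Z ⟶ (y ⟶[V] x)) (g : W ⟶ (z ⟶[V] y)) :
    cmp (K := Kᵒᵖ) (x := op x) (y := op y) (z := op z) f g = (β_ Z W).hom ≫ cmp g f :=
  tensorHom_eComp_op_eq V _ _

lemma post_op {x y z : K} (e : 𝟙_ V ⟶ (z ⟶[V] y)) :
    post (K := Kᵒᵖ) (y := op y) (z := op z) (op x) e = pre e x := by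
  have h : cmp (K := Kᵒᵖ) (x := op x) (y := op y) (z := op z) (𝟙 (y ⟶[V] x)) e = _ :=
    cmp_op (𝟙 (y ⟶[V] x)) e
  refine (congrArg ((ρ_ (y ⟶[V] x)).inv ≫ ·) h).trans ?_
  simp [pre]

lemma pre_op {x y z : K} (e : 𝟙_ V ⟶ (y ⟶[V] x)) :
    pre (K := Kᵒᵖ) (x := op x) (y := op y) e (op z) = post z e := by
  have h : cmp (K := Kᵒᵖ) (x := op x) (y := op y) (z := op z) e (𝟙 (z ⟶[V] y)) = _ :=
    cmp_op e (𝟙 (z ⟶[V] y))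
  refine (congrArg ((λ_ (z ⟶[V] y)).inv ≫ ·) h).trans ?_
  simp [post]

lemma InvPair.op {x y : K} {e : 𝟙_ V ⟶ (x ⟶[V] y)} {e' : 𝟙_ V ⟶ (y ⟶[V] x)}
    (h : InvPair e e') : InvPair (K := Kᵒᵖ) (x := op y) (y := op x) e e' := by
  constructor
  · refine (congrArg (e ≫ ·) (post_op (x := y) e')).trans ?_
    rw [← one_post_eq_pre, h.right]
    rfl
  · refine (congrArg (e' ≫ ·) (post_op (x := x) e)).trans ?_
    rw [← one_post_eq_pre, h.left]
    rfl

/-- A diagram `A → Kᵒᵖ`, seen as a contravariant diagram `Aᵒᵖ → K`. -/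
def unopDiagram (S : EnrichedFunctor V A Kᵒᵖ) : EnrichedFunctor V Aᵒᵖ K where
  obj a := (S.obj a.unop).unop
  map a b := S.map b.unop a.unop
  map_id a := S.map_id a.unop
  map_comp a b c := by
    have h := S.map_comp c.unop b.unop a.unop
    rw [eComp_op_eq, Category.assoc, h]
    refine (congrArg ((β_ _ _).hom ≫ ·) (cmp_op (x := (S.obj c.unop).unop)
      (y := (S.obj b.unop).unop) (z := (S.obj a.unop).unop) (S.map c.unop b.unop)
      (S.map b.unop a.unop))).trans ?_
    exact SymmetricCategory.symmetry_assoc _ _ _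

/-- A `V`-functor between opposite categories, seen as a `V`-functor. -/
def unopFunctor (P : EnrichedFunctor V Kᵒᵖ Nᵒᵖ) : EnrichedFunctor V K N where
  obj x := (P.obj (op x)).unop
  map x y := P.map (op y) (op x)
  map_id x := P.map_id (op x)
  map_comp x y z := by
    have h := P.map_comp (op z) (op y) (op x)
    rw [eComp_op_eq, Category.assoc] at h
    have h' := congrArg (fun t => (β_ (x ⟶[V] y) (y ⟶[V] z)).hom ≫ t) h
    dsimp only at h'
    erw [SymmetricCategory.symmetry_assoc] at h'
    refine h'.trans ?_
    refine (congrArg ((β_ _ _).hom ≫ ·) (cmp_op (x := (P.obj (op z)).unop)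
      (y := (P.obj (op y)).unop) (z := (P.obj (op x)).unop) (P.map (op z) (op y))
      (P.map (op y) (op x)))).trans ?_
    exact SymmetricCategory.symmetry_assoc _ _ _

/-- The canonical isomorphism from the double opposite. -/
def unopUnop : EnrichedFunctor V Kᵒᵖᵒᵖ K where
  obj x := x.unop.unop
  map x y := 𝟙 (x.unop.unop ⟶[V] y.unop.unop)
  map_id x := Category.comp_id _
  map_comp x y z := by
    have h : eComp V x y z = eComp V x.unop.unop y.unop.unop z.unop.unop := by
      rw [eComp_op_eq, eComp_op_eq]
      exact SymmetricCategory.symmetry_assoc _ _ _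
    have h' : eComp V x.unop.unop y.unop.unop z.unop.unop =
        (𝟙 _ ⊗ₘ 𝟙 _) ≫ eComp V x.unop.unop y.unop.unop z.unop.unop := by simp
    exact (Category.comp_id _).trans (h.trans h')

lemma IsNat.cmp_eq {Z : V} {F G : EnrichedFunctor V A K}
    {θ : ∀ a, Z ⟶ (F.obj a ⟶[V] G.obj a)} (h : IsNat F G θ) (a b : A) :
    cmp (F.map a b) (θ b) = (β_ _ _).hom ≫ cmp (θ a) (G.map a b) := by
  have h1 : (β_ Z (a ⟶[V] b)).hom ≫ cmp (F.map a b) (θ b) = cmp (θ a) (G.map a b) := h a b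
  rw [← h1, SymmetricCategory.symmetry_assoc]

/-- A family of generalized elements through which natural families factor uniquely is natural:
the case of a jointly monic family. -/
lemma isNat_of_jointly_mono {X L : EnrichedFunctor V A K} {ι : Type w} {W : ι → V}
    {S : ι → EnrichedFunctor V A K} {p : ∀ i a, W i ⟶ (L.obj a ⟶[V] (S i).obj a)}
    (hp : ∀ i, IsNat L (S i) (p i)) {Z : V} {θ : ∀ i a, Z ⊗ W i ⟶ (X.obj a ⟶[V] (S i).obj a)}
    (hθ : ∀ i, IsNat X (S i) (θ i)) {t : ∀ a, Z ⟶ (X.obj a ⟶[V] L.obj a)}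
    (ht : ∀ a i, cmp (t a) (p i a) = θ i a)
    (hm : ∀ (a : A) (x : K) (U : V) (s s' : U ⟶ (x ⟶[V] L.obj a)),
      (∀ i, cmp s (p i a) = cmp s' (p i a)) → s = s') : IsNat X L t := by
  intro a a'
  refine hm _ _ _ _ _ fun i => ?_
  change cmp ((β_ _ _).hom ≫ cmp (X.map a a') (t a')) (p i a') =
    cmp (cmp (t a) (L.map a a')) (p i a')
  rw [cmp_precomp_left, cmp_assoc, cmp_assoc, (hp i).cmp_eq a a', ht, (hθ i).cmp_eq a a',
    cmp_precomp_right, ← Iso.inv_hom_id_assoc (α_ _ _ _) (cmp (t a) (cmp _ _)), ← cmp_assoc, ht]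
  rw [BraidedCategory.braiding_tensor_right_hom]
  simp only [Category.assoc, Iso.hom_inv_id_assoc]
  rw [← comp_whiskerRight_assoc, SymmetricCategory.symmetry, id_whiskerRight, Category.id_comp]

/-- A family of generalized elements through which natural families factor uniquely is natural:
the case of a jointly epic family. -/
lemma isNat_of_jointly_epi {X L : EnrichedFunctor V A K} {ι : Type w} {W : ι → V}
    {S : ι → EnrichedFunctor V A K} {p : ∀ i a, W i ⟶ ((S i).obj a ⟶[V] L.obj a)}
    (hp : ∀ i, IsNat (S i) L (p i)) {Z : V} {θ : ∀ i a, Z ⊗ W i ⟶ ((S i).obj a ⟶[V] X.obj a)}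
    (hθ : ∀ i, IsNat (S i) X (θ i)) {t : ∀ a, Z ⟶ (L.obj a ⟶[V] X.obj a)}
    (ht : ∀ a i, cmp (p i a) (t a) = (β_ _ _).hom ≫ θ i a)
    (hm : ∀ (a : A) (x : K) (U : V) (s s' : U ⟶ (L.obj a ⟶[V] x)),
      (∀ i, cmp (p i a) s = cmp (p i a) s') → s = s') : IsNat L X t := by
  intro a a'
  refine hm _ _ _ _ _ fun i => ?_
  change cmp (p i a) ((β_ _ _).hom ≫ cmp (L.map a a') (t a')) =
    cmp (p i a) (cmp (t a) (X.map a a'))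
  have h1 : cmp (p i a) (L.map a a') = (β_ _ _).hom ≫ cmp ((S i).map a a') (p i a') :=
    (hp i a a').symm
  rw [cmp_precomp_right, ← Iso.inv_hom_id_assoc (α_ _ _ _) (cmp _ (cmp (L.map a a') _)),
    ← cmp_assoc, ← Iso.inv_hom_id_assoc (α_ _ _ _) (cmp _ (cmp (t a) _)),
    ← cmp_assoc, ht, h1, cmp_precomp_left, cmp_assoc, ht, cmp_precomp_right,
    (hθ i).cmp_eq, cmp_precomp_left, BraidedCategory.braiding_naturality_right_assoc,
    BraidedCategory.braiding_tensor_right_hom]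
  simp only [Category.assoc, Iso.hom_inv_id_assoc, ← comp_whiskerRight_assoc,
    SymmetricCategory.symmetry, id_whiskerRight, Category.id_comp, Iso.inv_hom_id_assoc,
    ← MonoidalCategory.whiskerLeft_comp_assoc, MonoidalCategory.whiskerLeft_id]

end Opposite

/-! ### Transposes of composites -/

section SwapCalculus

variable [MonoidalClosed V] [SymmetricCategory V]

lemma unswap_cmp_op {X Y T Z Z' : V} (s : Z' ⟶ EnrichedCategory.Hom (V := V) X Y)
    (t : Z ⟶ EnrichedCategory.Hom (V := V) Y T) :
    unswap ((β_ Z Z').hom ≫ cmp s t) = (α_ Z Z' X).hom ≫ Z ◁ unswap s ≫ unswap t := by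
  rw [unswap, MonoidalClosed.uncurry_natural_left, uncurry_cmp, unswap, unswap,
    MonoidalCategory.whiskerLeft_comp, Category.assoc,
    BraidedCategory.braiding_naturality_right_assoc, BraidedCategory.braiding_tensor_left_hom,
    BraidedCategory.braiding_tensor_right_hom]
  simp

@[simp] lemma unswap_eId (X : V) : unswap (eId V X) = (λ_ X).hom := by
  change (β_ _ _).hom ≫ MonoidalClosed.uncurry (MonoidalClosed.curry _) = _
  rw [MonoidalClosed.uncurry_curry]; simp

end SwapCalculus

/-! ### Functor categories and pointwise limits -/

section Presheaf

variable [MonoidalClosed V] [SymmetricCategory V] [HasLimits V]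
variable {A : Type v} {B : Type w₁} {K : Type w₂} [EnrichedCategory V A] [EnrichedCategory V B]
  [EnrichedCategory V K]

lemma cmp_natProj {F G H : EnrichedFunctor V A K} {Z W : V} (s : Z ⟶ (F ⟶[V] G))
    (t : W ⟶ (G ⟶[V] H)) (a : A) :
    cmp s t ≫ natProj F H a = cmp (s ≫ natProj F G a) (t ≫ natProj G H a) :=
  cmp_map (ev a) s t

lemma eId_natProj (F : EnrichedFunctor V A K) (a : A) :
    eId V F ≫ natProj F F a = eId V (F.obj a) := (ev a).map_id F

/-- The universal `V`-natural family. -/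
lemma isNat_natProj (F G : EnrichedFunctor V A K) : IsNat F G (natProj F G) :=
  (natHom_isNatObject F G).isNat

/-- Limits in a functor category are computed pointwise. -/
lemma isWeightedLimit_of_pointwise {F : EnrichedFunctor V B V}
    {S : EnrichedFunctor V B (EnrichedFunctor V A K)} {L : EnrichedFunctor V A K}
    {π : ∀ b, F.obj b ⟶ (L ⟶[V] S.obj b)}
    (h : ∀ a, IsWeightedLimit F (S.comp V (ev a)) (L.obj a) (fun b => π b ≫ natProj _ _ a)) :
    IsWeightedLimit F S L π := by
  refine isWeightedLimit_iff.2 ⟨fun b b' => natHom_ext fun a => ?_, fun X Z θ hθ => ?_⟩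
  · have h1 : act F b b' ≫ π b' ≫ natProj _ _ a =
      cmp (π b ≫ natProj _ _ a) (S.map b b' ≫ natProj _ _ a) := (h a).isCone b b'
    rw [Category.assoc, h1]
    exact (cmp_natProj _ _ _).symm
  · have hc : ∀ a, ConeNat (X := X.obj a) F (S.comp V (ev a)) (fun b => θ b ≫ natProj _ _ a) := by
      intro a b b'
      have h1 := congrArg (· ≫ natProj _ _ a) (hθ b b')
      simp only [Category.assoc] at h1
      exact h1.trans (cmp_natProj _ _ _)
    have hex : ∀ a, ∃ t : Z ⟶ (X.obj a ⟶[V] L.obj a), ∀ b, cmp t (π b ≫ natProj _ _ a) =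
      θ b ≫ natProj _ _ a := fun a => ((h a).isLimAt (X.obj a) Z _ (hc a)).exists
    choose t ht using hex
    have hm : ∀ (a : A) (x : K) (U : V) (s s' : U ⟶ (x ⟶[V] L.obj a)),
        (∀ b, cmp s (π b ≫ natProj _ _ a) = cmp s' (π b ≫ natProj _ _ a)) → s = s' :=
      fun a x U s s' hs => (h a).hom_ext hs
    have hn : IsNat X L t := isNat_of_jointly_mono
      (fun b => (isNat_natProj L (S.obj b)).precomp (π b))
      (fun b => (isNat_natProj X (S.obj b)).precomp (θ b)) ht hm
    refine ⟨natLift t hn, fun b => natHom_ext fun a => ?_, fun s hs => natHom_ext fun a => ?_⟩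
    · refine (cmp_natProj _ _ _).trans ?_
      rw [natLift_proj, ht]
    · rw [natLift_proj]
      refine hm _ _ _ _ _ fun b => ?_
      rw [ht, ← hs b]
      exact (cmp_natProj _ _ _).symm

lemma cmp_op_natProj {X Y T : EnrichedFunctor V A K} {Z W : V} (s : Z ⟶ (Y ⟶[V] X))
    (t : W ⟶ (T ⟶[V] Y)) (a : A) :
    cmp (K := (EnrichedFunctor V A K)ᵒᵖ) (x := op X) (y := op Y) (z := op T) s t ≫
      natProj _ _ a = cmp (K := Kᵒᵖ) (x := op (X.obj a)) (y := op (Y.obj a)) (z := op (T.obj a))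
        (s ≫ natProj _ _ a) (t ≫ natProj _ _ a) :=
  cmp_map (opFunctor (ev a)) (x := op X) (y := op Y) (z := op T) s t

/-- Colimits in a functor category are computed pointwise. -/
lemma isWeightedColimit_of_pointwise {F : EnrichedFunctor V B V}
    {S : EnrichedFunctor V B (EnrichedFunctor V A K)ᵒᵖ} {L : EnrichedFunctor V A K}
    {π : ∀ b, F.obj b ⟶ ((S.obj b).unop ⟶[V] L)}
    (h : ∀ a, IsWeightedLimit F (S.comp V (opFunctor (ev a))) (op (L.obj a))
      (fun b => π b ≫ natProj _ _ a)) :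
    IsWeightedLimit F S (op L) π := by
  refine isWeightedLimit_iff.2 ⟨fun b b' => natHom_ext fun a => ?_, fun X Z θ hθ => ?_⟩
  · have h1 : act F b b' ≫ π b' ≫ natProj _ _ a =
      cmp (K := Kᵒᵖ) (x := op (L.obj a)) (y := op ((S.obj b).unop.obj a))
        (z := op ((S.obj b').unop.obj a))
        (π b ≫ natProj _ _ a) (S.map b b' ≫ natProj _ _ a) := (h a).isCone b b'
    rw [Category.assoc, h1]
    exact (cmp_op_natProj (T := (S.obj b').unop) _ _ _).symm
  · have hc : ∀ a, ConeNat (X := op (X.unop.obj a)) F (S.comp V (opFunctor (ev a)))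
        (fun b => θ b ≫ natProj _ _ a) := by
      intro a b b'
      have h1 := congrArg (· ≫ natProj _ _ a) (hθ b b')
      simp only [Category.assoc] at h1
      exact h1.trans (cmp_op_natProj (X := X.unop) (T := (S.obj b').unop) _ _ _)
    have hex : ∀ a, ∃ t : Z ⟶ (L.obj a ⟶[V] X.unop.obj a), ∀ b,
      cmp (π b ≫ natProj (S.obj b).unop L a) t =
        (β_ _ _).hom ≫ θ b ≫ natProj (S.obj b).unop X.unop a := fun a => by
        obtain ⟨t, ht⟩ := ((h a).isLimAt (op (X.unop.obj a)) Z _ (hc a)).exists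
        refine ⟨t, fun b => ?_⟩
        have h1 : (β_ _ _).hom ≫ cmp (π b ≫ natProj (S.obj b).unop L a) t =
          θ b ≫ natProj (S.obj b).unop X.unop a :=
            (cmp_op (x := X.unop.obj a) (y := L.obj a) (z := (S.obj b).unop.obj a) t
            (π b ≫ natProj (S.obj b).unop L a)).symm.trans (ht b)
        rw [← h1, SymmetricCategory.symmetry_assoc]
    choose t ht using hex
    have hm : ∀ (a : A) (x : K) (U : V) (s s' : U ⟶ (L.obj a ⟶[V] x)),
        (∀ b, cmp (π b ≫ natProj (S.obj b).unop L a) s =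
          cmp (π b ≫ natProj (S.obj b).unop L a) s') → s = s' :=
      fun a x U s s' hs => (h a).hom_ext (X := op x) fun b =>
        (cmp_op s _).trans ((congrArg ((β_ _ _).hom ≫ ·) (hs b)).trans (cmp_op s' _).symm)
    have hn : IsNat L X.unop t := isNat_of_jointly_epi
      (fun b => (isNat_natProj (S.obj b).unop L).precomp (π b))
      (fun b => (isNat_natProj (S.obj b).unop X.unop).precomp (θ b)) ht hm
    refine ⟨natLift t hn, fun b => natHom_ext fun a => ?_, fun s hs => natHom_ext fun a => ?_⟩
    · refine (cmp_op_natProj (natLift t hn) (π b) a).trans ?_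
      rw [natLift_proj]
      refine (cmp_op (x := X.unop.obj a) (y := L.obj a) (z := (S.obj b).unop.obj a) (t a)
        (π b ≫ natProj (S.obj b).unop L a)).trans ?_
      rw [ht, SymmetricCategory.symmetry_assoc]
    · rw [natLift_proj]
      refine hm _ _ _ _ _ fun b => ?_
      rw [ht, ← hs b]
      have h1 : cmp (K := (EnrichedFunctor V A K)ᵒᵖ) (x := X) (y := op L) (z := S.obj b)
        s (π b) ≫ natProj _ _ a = _ := cmp_op_natProj s (π b) a
      refine Eq.trans ?_ (congrArg ((β_ _ _).hom ≫ ·) (h1.trans (cmp_op (x := X.unop.obj a)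
        (y := L.obj a) (z := (S.obj b).unop.obj a) (s ≫ natProj L X.unop a)
        (π b ≫ natProj (S.obj b).unop L a))).symm)
      rw [SymmetricCategory.symmetry_assoc]

section Flip

variable {B : Type v} [EnrichedCategory V B] (S : EnrichedFunctor V B (EnrichedFunctor V A K))

lemma isNat_flip (a a' : A) : IsNat (S.comp V (ev a)) (S.comp V (ev a'))
    (fun b => (S.obj b).map a a') := by
  intro b b'
  have h := ((isNat_natProj (S.obj b) (S.obj b')).precomp (S.map b b')).cmp_eq a a'
  change (β_ _ _).hom ≫ cmp (S.map b b' ≫ natProj _ _ a) ((S.obj b').map a a') =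
    cmp ((S.obj b).map a a') (S.map b b' ≫ natProj _ _ a')
  exact h.symm

/-- A `V`-functor `B → [A, K]` with `B` and `A` small, seen as a `V`-functor `A → [B, K]`. -/
def flip : EnrichedFunctor V A (EnrichedFunctor V B K) where
  obj a := S.comp V (ev a)
  map a a' := natLift _ (isNat_flip S a a')
  map_id a := natHom_ext fun b => by
    rw [Category.assoc]
    exact (congrArg (eId V a ≫ ·) (natLift_proj _ (isNat_flip S a a) b)).trans
      (((S.obj b).map_id a).trans (eId_natProj (S.comp V (ev a)) b).symm)
  map_comp a a' a'' := natHom_ext fun b => by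
    have h := (S.obj b).map_comp a a' a''
    rw [Category.assoc]
    refine (congrArg (eComp V a a' a'' ≫ ·) (natLift_proj _ (isNat_flip S a a'') b)).trans
      (h.trans ?_)
    have h1 := cmp_natProj (natLift _ (isNat_flip S a a')) (natLift _ (isNat_flip S a' a'')) b
    refine Eq.trans ?_ h1.symm
    exact congrArg₂ (fun s t => cmp s t) (natLift_proj _ (isNat_flip S a a') b).symm
      (natLift_proj _ (isNat_flip S a' a'') b).symm

lemma flip_map_natProj (a a' : A) (b : B) :
    (flip S).map a a' ≫ natProj _ _ b = (S.obj b).map a a' := natLift_proj _ (isNat_flip S a a') b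

end Flip

end Presheaf

/-! ### The Yoneda lemma and restricted Yoneda functors -/

section Yoneda

variable [MonoidalClosed V] [SymmetricCategory V]

section

variable {B : Type w₁} {K : Type w₂} [EnrichedCategory V B] [EnrichedCategory V K]

lemma act_comp_coyon (Q : EnrichedFunctor V B K) (x : K) (a b : B) :
    act (Q.comp V (coyon x)) a b = cmp (𝟙 (x ⟶[V] Q.obj a)) (Q.map a b) := by
  rw [act_comp, act_coyon, cmp, MonoidalCategory.id_tensorHom]
  rfl

/-- Precomposition `K(y, x) ⊗ K(x, Q b) ⟶ K(y, Q b)` is natural in `b`. -/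
lemma natFam_resYon (Q : EnrichedFunctor V B K) (x y : K) :
    NatFam (Q.comp V (coyon x)) (Q.comp V (coyon y))
      (fun b => cmp (𝟙 (y ⟶[V] x)) (𝟙 (x ⟶[V] Q.obj b))) := by
  rw [natFam_coyon_iff]
  intro a b
  refine (congrArg (fun t => (α_ _ _ _).hom ≫ (y ⟶[V] x) ◁ t ≫ cmp (𝟙 (y ⟶[V] x))
    (𝟙 (x ⟶[V] Q.obj b))) (act_comp_coyon Q x a b)).trans ?_
  suffices H : (α_ _ _ _).hom ≫ (y ⟶[V] x) ◁ (cmp (𝟙 (x ⟶[V] Q.obj a)) (Q.map a b)) ≫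
      cmp (𝟙 (y ⟶[V] x)) (𝟙 (x ⟶[V] Q.obj b)) =
      cmp (cmp (𝟙 (y ⟶[V] x)) (𝟙 (x ⟶[V] Q.obj a))) (Q.map a b) from H
  rw [cmp_assoc, ← cmp_precomp_right, Category.comp_id]

lemma unswap_cmp {X Y T Z W : V} (s : Z ⟶ EnrichedCategory.Hom (V := V) X Y)
    (t : W ⟶ EnrichedCategory.Hom (V := V) Y T) :
    unswap (cmp s t) = (α_ Z W X).hom ≫ Z ◁ (β_ W X).hom ≫ (α_ Z X W).inv ≫
      unswap s ▷ W ≫ MonoidalClosed.uncurry t := by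
  rw [unswap, uncurry_cmp, unswap, BraidedCategory.braiding_tensor_left_hom]
  simp

end

variable [HasLimits V] {B : Type v} {K : Type w₂} [EnrichedCategory V B] [EnrichedCategory V K]

/-- The restricted Yoneda functor `K → [B, V]ᵒᵖ` of a functor `Q : B → K`, which sends `k` to
`K(k, Q -)`. -/
def resYon (Q : EnrichedFunctor V B K) : EnrichedFunctor V K (EnrichedFunctor V B V)ᵒᵖ where
  obj k := op (Q.comp V (coyon k))
  map x y := natLift (F := Q.comp V (coyon y)) (G := Q.comp V (coyon x)) _
    ((isNat_swapHom _ _ _).2 (natFam_resYon Q y x))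
  map_id x := natHom_ext fun b => by
    rw [Category.assoc, natLift_proj]
    refine Eq.trans ?_ (eId_natProj (Q.comp V (coyon x)) b).symm
    suffices H : eId V x ≫ swapHom (cmp (𝟙 (x ⟶[V] x)) (𝟙 (x ⟶[V] Q.obj b))) =
      eId V (EnrichedCategory.Hom (V := V) x (Q.obj b)) from H
    apply unswap_injective
    rw [unswap_precomp, unswap_swapHom, ← cmp_precomp_left, Category.comp_id, eId_cmp, unswap_eId,
      Category.comp_id]
  map_comp x y z := natHom_ext fun b => by
    rw [Category.assoc, natLift_proj]
    refine Eq.trans ?_ (cmp_op_natProj (X := Q.comp V (coyon x)) (Y := Q.comp V (coyon y))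
      (T := Q.comp V (coyon z)) _ _ b).symm
    refine Eq.trans ?_ (cmp_op (x := x ⟶[V] Q.obj b) (y := y ⟶[V] Q.obj b)
      (z := z ⟶[V] Q.obj b) _ _).symm
    rw [natLift_proj, natLift_proj]
    suffices H : eComp V x y z ≫ swapHom (cmp (𝟙 (x ⟶[V] z)) (𝟙 (z ⟶[V] Q.obj b))) =
      (β_ _ _).hom ≫ cmp (swapHom (cmp (𝟙 (y ⟶[V] z)) (𝟙 (z ⟶[V] Q.obj b))))
        (swapHom (cmp (𝟙 (x ⟶[V] y)) (𝟙 (y ⟶[V] Q.obj b)))) from H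
    apply unswap_injective
    rw [unswap_precomp, unswap_swapHom, unswap_cmp_op, unswap_swapHom, unswap_swapHom,
      ← cmp_precomp_right, ← cmp_precomp_left, Category.comp_id, Category.comp_id, ← cmp_assoc]
    simp [cmp]

lemma resYon_map_natProj (Q : EnrichedFunctor V B K) (x y : K) (b : B) :
    (resYon Q).map x y ≫ natProj (Q.comp V (coyon y)) (Q.comp V (coyon x)) b =
      swapHom (cmp (𝟙 (x ⟶[V] y)) (𝟙 (y ⟶[V] Q.obj b))) :=
  natLift_proj (F := Q.comp V (coyon y)) (G := Q.comp V (coyon x)) _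
    ((isNat_swapHom _ _ _).2 (natFam_resYon Q y x)) b

/-- The object of natural transformations between `V`-valued functors, as an end. -/
lemma isEnd_natHom (F G : EnrichedFunctor V B V) :
    IsEnd F G (natHom F G) (fun b => unswap (natProj F G b)) := by
  rw [← isNatObject_swapHom]
  simp only [swapHom_unswap]
  exact natHom_isNatObject F G

section

variable (J : EnrichedFunctor V B K) (i : B) (X : EnrichedFunctor V B V)

/-- The evaluation `[B, V](K(x, J -), X) ⊗ K(x, J a) ⟶ X a`. -/
def natEval (x : K) (a : B) :
    natHom (J.comp V (coyon x)) X ⊗ (x ⟶[V] J.obj a) ⟶ X.obj a :=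
  unswap (natProj (J.comp V (coyon x)) X a)

lemma unswap_comp_natProj (x : K) (a : B) {Z : V} (t : Z ⟶ natHom (J.comp V (coyon x)) X) :
    unswap (t ≫ natProj (J.comp V (coyon x)) X a) = t ▷ (x ⟶[V] J.obj a) ≫ natEval J X x a :=
  unswap_precomp _ _

/-- The Yoneda map `[B, V](K(J i, J -), X) ⟶ X i`. -/
def yonedaMap : natHom (J.comp V (coyon (J.obj i))) X ⟶ X.obj i :=
  (ρ_ _).inv ≫ _ ◁ eId V (J.obj i) ≫ natEval J X (J.obj i) i

lemma comp_yonedaMap {Z : V} (t : Z ⟶ natHom (J.comp V (coyon (J.obj i))) X) :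
    t ≫ yonedaMap J i X = (ρ_ _).inv ≫ _ ◁ eId V (J.obj i) ≫
      t ▷ _ ≫ natEval J X (J.obj i) i := by
  rw [whisker_exchange_assoc, yonedaMap, rightUnitor_inv_naturality_assoc]

lemma yoneda_unit [IsIso (J.map i i)] : (ρ_ _).inv ≫ _ ◁ eId V (J.obj i) ≫
    X.obj i ◁ inv (J.map i i) ≫ act X i i = 𝟙 _ := by
  have h1 : eId V (J.obj i) ≫ inv (J.map i i) = eId V i := by
    rw [IsIso.comp_inv_eq, J.map_id]
  rw [← MonoidalCategory.whiskerLeft_comp_assoc, h1, act_eId, Iso.inv_hom_id]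

/-- The generalized transformation `X i ⟶ [B, V](K(J i, J -), X)` inverse to the Yoneda map. -/
def yonedaElt [hJ : ∀ a b, IsIso (J.map a b)] (a : B) :
    X.obj i ⊗ (J.obj i ⟶[V] J.obj a) ⟶ X.obj a :=
  X.obj i ◁ inv (J.map i a) ≫ act X i a

/-- The Yoneda lemma, for the functor `K(J i, J -)` where `J` is fully faithful. -/
lemma isEnd_yoneda [hJ : ∀ a b, IsIso (J.map a b)] :
    IsEnd (J.comp V (coyon (J.obj i))) X (X.obj i) (yonedaElt J i X) := by
  constructor
  · intro a b
    refine (congrArg (fun t => (α_ _ _ _).hom ≫ X.obj i ◁ t ≫ yonedaElt J i X b)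
      (act_comp_coyon J (J.obj i) a b)).trans ?_
    suffices H : (α_ _ _ _).hom ≫ X.obj i ◁ cmp (𝟙 (J.obj i ⟶[V] J.obj a)) (J.map a b) ≫
        X.obj i ◁ inv (J.map i b) ≫ act X i b =
        (X.obj i ◁ inv (J.map i a) ≫ act X i a) ▷ _ ≫ act X a b from H
    have h : cmp (𝟙 (J.obj i ⟶[V] J.obj a)) (J.map a b) ≫ inv (J.map i b) =
        inv (J.map i a) ▷ _ ≫ eComp V i a b := by
      rw [IsIso.comp_inv_eq, Category.assoc, J.map_comp, ← cmp, ← cmp_precomp_left,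
        IsIso.inv_hom_id]
    rw [← MonoidalCategory.whiskerLeft_comp_assoc, h, comp_whiskerRight, Category.assoc, act_act]
    simp
  · intro Z θ
    suffices H : ∀ θ : ∀ a, Z ⊗ (J.obj i ⟶[V] J.obj a) ⟶ X.obj a,
        NatFam (J.comp V (coyon (J.obj i))) X θ → ∃! t : Z ⟶ X.obj i, ∀ a,
        t ▷ (J.obj i ⟶[V] J.obj a) ≫ X.obj i ◁ inv (J.map i a) ≫ act X i a = θ a from H θ
    intro θ hθ
    refine ⟨(ρ_ _).inv ≫ _ ◁ eId V (J.obj i) ≫ θ i, fun a => ?_, fun s hs => ?_⟩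
    · have h1 := hθ i a
      have h2 : (α_ _ _ _).hom ≫ Z ◁ cmp (𝟙 (J.obj i ⟶[V] J.obj i)) (J.map i a) ≫ θ a =
        θ i ▷ _ ≫ act X i a := (congrArg (fun t => (α_ _ _ _).hom ≫ Z ◁ t ≫ θ a)
          (act_comp_coyon J (J.obj i) i a)).symm.trans h1
      rw [← whisker_exchange_assoc, comp_whiskerRight, comp_whiskerRight, Category.assoc,
        Category.assoc, ← h2, associator_naturality_middle_assoc,
        ← MonoidalCategory.whiskerLeft_comp_assoc Z (eId V (J.obj i) ▷ _), cmp_eq_whisker, eId_cmp]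
      simp
    · rw [← hs i, whisker_exchange_assoc, ← rightUnitor_inv_naturality_assoc, yoneda_unit,
        Category.comp_id]

lemma isIso_yonedaMap [hJ : ∀ a b, IsIso (J.map a b)] : IsIso (yonedaMap J i X) := by
  obtain ⟨e, he, -⟩ := (isEnd_natHom (J.comp V (coyon (J.obj i))) X).existsUnique _ _
    (isEnd_yoneda J i X).nat
  have hi : IsIso e := (isEnd_natHom (J.comp V (coyon (J.obj i))) X).isIso
    (isEnd_yoneda J i X) he
  have h : e ≫ yonedaMap J i X = 𝟙 _ := by
    rw [comp_yonedaMap]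
    exact (congrArg (fun t => (ρ_ _).inv ≫ _ ◁ eId V (J.obj i) ≫ t) (he i)).trans
      (yoneda_unit J i X)
  have : yonedaMap J i X = inv e := by rw [← cancel_epi e, h, IsIso.hom_inv_id]
  rw [this]; infer_instance

/-- The Yoneda map is natural in the functor. -/
lemma yonedaMap_natMor :
    NatMor (coyon (J.comp V (coyon (J.obj i)))) (ev i) (fun X => yonedaMap J i X) := by
  intro X Y
  rw [act_coyon]
  suffices H : eComp V (J.comp V (coyon (J.obj i))) X Y ≫ yonedaMap J i Y =
    yonedaMap J i X ▷ natHom X Y ≫ MonoidalClosed.uncurry (natProj X Y i) from H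
  refine (comp_yonedaMap J i Y _).trans ?_
  have h : eComp V (J.comp V (coyon (J.obj i))) X Y ≫ natProj _ Y i =
    cmp (natProj (J.comp V (coyon (J.obj i))) X i) (natProj X Y i) :=
      (ev i).map_comp (J.comp V (coyon (J.obj i))) X Y
  have h' := (unswap_comp_natProj J Y (J.obj i) i
    (eComp V (J.comp V (coyon (J.obj i))) X Y)).symm.trans
    ((congrArg unswap h).trans (unswap_cmp _ _))
  refine (congrArg (fun t => (ρ_ _).inv ≫ _ ◁ eId V (J.obj i) ≫ t) h').trans ?_
  suffices H : (ρ_ _).inv ≫ (natHom (J.comp V (coyon (J.obj i))) X ⊗ natHom X Y) ◁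
      eId V (J.obj i) ≫ (α_ _ _ _).hom ≫ _ ◁ (β_ (natHom X Y) _).hom ≫ (α_ _ _ _).inv ≫
      natEval J X (J.obj i) i ▷ (natHom X Y) ≫ MonoidalClosed.uncurry (natProj X Y i) =
    yonedaMap J i X ▷ natHom X Y ≫ MonoidalClosed.uncurry (natProj X Y i) from H
  rw [yonedaMap]
  simp only [comp_whiskerRight, Category.assoc, tensor_whiskerLeft,
    Iso.inv_hom_id_assoc]
  rw [← MonoidalCategory.whiskerLeft_comp_assoc _ (natHom X Y ◁ _),
    BraidedCategory.braiding_naturality_right]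
  simp

lemma resYon_map_natEval (x : K) (a : B) : (resYon J).map x (J.obj i) ▷ _ ≫
    natEval J (J.comp V (coyon x)) (J.obj i) a =
      cmp (𝟙 (x ⟶[V] J.obj i)) (𝟙 (J.obj i ⟶[V] J.obj a)) := by
  refine (unswap_comp_natProj J (J.comp V (coyon x)) (J.obj i) a
    ((resYon J).map x (J.obj i))).symm.trans ?_
  refine (congrArg unswap (resYon_map_natProj J x (J.obj i) a)).trans ?_
  exact unswap_swapHom _

/-- The restricted Yoneda functor is inverse to the Yoneda map on arrows into `J i`. -/
lemma resYon_map_yonedaMap (x : K) :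
    (resYon J).map x (J.obj i) ≫ yonedaMap J i (J.comp V (coyon x)) = 𝟙 (x ⟶[V] J.obj i) := by
  refine (comp_yonedaMap J i _ _).trans ?_
  refine (congrArg (fun t => (ρ_ _).inv ≫ _ ◁ eId V (J.obj i) ≫ t)
    (resYon_map_natEval J i x i)).trans ?_
  suffices H : (ρ_ _).inv ≫ (x ⟶[V] J.obj i) ◁ eId V (J.obj i) ≫
    cmp (𝟙 (x ⟶[V] J.obj i)) (𝟙 (J.obj i ⟶[V] J.obj i)) = 𝟙 _ from H
  rw [← cmp_precomp_right, Category.comp_id, cmp_eId]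
  simp

lemma isIso_resYon_map [hJ : ∀ a b, IsIso (J.map a b)] (x : K) :
    IsIso ((resYon J).map x (J.obj i)) := by
  have h1 := isIso_yonedaMap J i (J.comp V (coyon x))
  suffices H : ∀ {E C : V} (f : C ⟶ E) (g : E ⟶ C), IsIso g → f ≫ g = 𝟙 C → IsIso f from
    H _ _ h1 (resYon_map_yonedaMap J i x)
  intro E C f g hg hfg
  exact IsIso.of_isIso_fac_right hfg

end

end Yoneda

/-! ### Density of representables -/

section Density

variable [MonoidalClosed V] [SymmetricCategory V]

section

variable {A : Type w₁} {E : Type w₂} {N : Type w₃} [EnrichedCategory V A] [EnrichedCategory V E]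
  [EnrichedCategory V N]

lemma ConeNat.of_natMor {F F' : EnrichedFunctor V A V} {κ : ∀ a, F'.obj a ⟶ F.obj a}
    (hκ : NatMor F' F κ) {S : EnrichedFunctor V A N} {X : N} {Z : V}
    {θ : ∀ a, Z ⊗ F.obj a ⟶ (X ⟶[V] S.obj a)} (h : ConeNat F S θ) :
    ConeNat F' S (fun a => Z ◁ κ a ≫ θ a) := by
  intro a b
  dsimp only
  rw [cmp_precomp_left, ← h a b, ← MonoidalCategory.whiskerLeft_comp_assoc, hκ a b]
  simp

/-- Limits weighted by isomorphic weights coincide. -/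
lemma IsWeightedLimit.of_weight {F F' : EnrichedFunctor V A V} {κ : ∀ a, F'.obj a ⟶ F.obj a}
    (hκ : NatMor F' F κ) (hi : ∀ a, IsIso (κ a)) {S : EnrichedFunctor V A N} {L : N}
    {π : ∀ a, F.obj a ⟶ (L ⟶[V] S.obj a)} (h : IsWeightedLimit F S L π) :
    IsWeightedLimit F' S L (fun a => κ a ≫ π a) := by
  refine isWeightedLimit_iff.2 ⟨fun a b => ?_, fun X Z θ hθ => ?_⟩
  · dsimp only
    rw [cmp_precomp_left, ← h.isCone a b, ← Category.assoc, hκ a b, Category.assoc]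
  · obtain ⟨t, ht, hu⟩ := h.isLimAt X Z _ (hθ.of_natMor (hκ.inv hi))
    refine ⟨t, fun a => ?_, fun s hs => hu s fun a => ?_⟩
    · dsimp only at ht ⊢
      rw [cmp_precomp_right, ht, ← MonoidalCategory.whiskerLeft_comp_assoc, IsIso.hom_inv_id,
        MonoidalCategory.whiskerLeft_id, Category.id_comp]
    · have := hs a
      dsimp only at this ⊢
      rw [← this, ← cmp_precomp_right, IsIso.inv_hom_id_assoc]

/-- `S` is (co)dense: every object is canonically a limit of the values of `S`. -/
def IsDense (S : EnrichedFunctor V A N) : Prop :=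
  ∀ n : N, IsWeightedLimit (S.comp V (coyon n)) S n (fun a => 𝟙 (n ⟶[V] S.obj a))

/-- A full subcategory through which a dense functor factors is dense. -/
lemma IsDense.of_comp {j : EnrichedFunctor V E N} (hj : ∀ x y, IsIso (j.map x y))
    {k : EnrichedFunctor V A E} (h : IsDense (k.comp V j)) : IsDense j := by
  intro n
  refine isWeightedLimit_iff.2 ⟨fun d d' => ?_, fun X Z => ?_⟩
  · exact (Category.comp_id _).trans (act_comp_coyon j n d d')
  · suffices H : ∀ θ : ∀ d, Z ⊗ (n ⟶[V] j.obj d) ⟶ (X ⟶[V] j.obj d),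
        (∀ d d', (α_ _ _ _).hom ≫ Z ◁ cmp (𝟙 (n ⟶[V] j.obj d)) (j.map d d') ≫ θ d' =
          cmp (θ d) (j.map d d')) → ∃! t : Z ⟶ (X ⟶[V] n), ∀ d, cmp t (𝟙 (n ⟶[V] j.obj d)) = θ d by
      intro θ hθ
      refine H θ fun d d' => ?_
      exact (congrArg (fun t => (α_ _ _ _).hom ≫ Z ◁ t ≫ θ d')
        (act_comp_coyon j n d d').symm).trans (hθ d d')
    intro θ hθ
    have hc : ConeNat (Z := Z) (X := X) ((k.comp V j).comp V (coyon n)) (k.comp V j)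
        (fun a => θ (k.obj a)) := by
      intro a b
      refine (congrArg (fun t => (α_ _ _ _).hom ≫ Z ◁ t ≫ θ (k.obj b))
        (act_comp_coyon (k.comp V j) n a b)).trans ?_
      suffices H : (α_ _ _ _).hom ≫ Z ◁ cmp (𝟙 (n ⟶[V] j.obj (k.obj a)))
          (k.map a b ≫ j.map (k.obj a) (k.obj b)) ≫ θ (k.obj b) =
          cmp (θ (k.obj a)) (k.map a b ≫ j.map (k.obj a) (k.obj b)) from H
      rw [cmp_precomp_right, cmp_precomp_right, ← hθ]
      simp
    obtain ⟨t, ht, hu⟩ : ∃! t : Z ⟶ (X ⟶[V] n), ∀ a, cmp t (𝟙 (n ⟶[V] j.obj (k.obj a))) =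
      θ (k.obj a) := (h n).isLimAt X Z _ hc
    refine ⟨t, fun d => ?_, fun s hs => hu s fun a => hs _⟩
    refine (h (j.obj d)).hom_ext fun a => ?_
    suffices H : cmp (cmp t (𝟙 (n ⟶[V] j.obj d))) (𝟙 (j.obj d ⟶[V] j.obj (k.obj a))) =
      cmp (θ d) (𝟙 (j.obj d ⟶[V] j.obj (k.obj a))) from H
    have := hj d (k.obj a)
    rw [← cancel_epi (_ ◁ j.map d (k.obj a)), ← cmp_precomp_right, ← cmp_precomp_right,
      Category.comp_id, ← hθ, ← ht, cmp_assoc, ← cmp_precomp_right, Category.comp_id]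

end

variable [HasLimits V] {B : Type v} {K : Type w₂} [EnrichedCategory V B] [EnrichedCategory V K]
  (J : EnrichedFunctor V B K) (X Y : EnrichedFunctor V B V)

lemma natEval_act (x : K) (a b : B) : natEval J X x a ▷ (a ⟶[V] b) ≫ act X a b =
    (α_ _ _ _).hom ≫ _ ◁ cmp (𝟙 (x ⟶[V] J.obj a)) (J.map a b) ≫ natEval J X x b :=
  ((isEnd_natHom (J.comp V (coyon x)) X).nat a b).symm.trans
    (congrArg (fun t => (α_ _ _ _).hom ≫ natHom (J.comp V (coyon x)) X ◁ t ≫ natEval J X x b)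
      (act_comp_coyon J x a b))

/-- The Yoneda map `[B, V](K(J b, J -), X) ⟶ X b` is natural in `b`. -/
lemma yonedaMap_natMor_obj : NatMor ((J.comp V (resYon J)).comp V (coyon (op X))) X
    (fun b => yonedaMap J b X) := by
  intro b c
  let m : (b ⟶[V] c) ⟶ natHom (J.comp V (coyon (J.obj c))) (J.comp V (coyon (J.obj b))) :=
    J.map b c ≫ (resYon J).map (J.obj b) (J.obj c)
  have h1 : act ((J.comp V (resYon J)).comp V (coyon (op X))) b c =
    (β_ _ _).hom ≫ cmp (x := J.comp V (coyon (J.obj c))) (y := J.comp V (coyon (J.obj b))) (z := X)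
      m (𝟙 (natHom (J.comp V (coyon (J.obj b))) X)) :=
    (act_comp_coyon (J.comp V (resYon J)) (op X) b c).trans
      (cmp_op (x := X) (y := J.comp V (coyon (J.obj b))) (z := J.comp V (coyon (J.obj c)))
        (𝟙 (natHom (J.comp V (coyon (J.obj b))) X)) m)
  have h2 : ((β_ _ _).hom ≫ cmp (x := J.comp V (coyon (J.obj c)))
      (y := J.comp V (coyon (J.obj b))) (z := X) m
      (𝟙 (natHom (J.comp V (coyon (J.obj b))) X))) ▷ _ ≫ natEval J X (J.obj c) c =
      (α_ _ _ _).hom ≫ _ ◁ cmp (J.map b c) (𝟙 (J.obj c ⟶[V] J.obj c)) ≫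
        natEval J X (J.obj b) c := by
    have e := cmp_natProj (F := J.comp V (coyon (J.obj c))) (G := J.comp V (coyon (J.obj b)))
      (H := X) m
      (𝟙 (natHom (J.comp V (coyon (J.obj b))) X)) c
    have e' : m ≫
        natProj (J.comp V (coyon (J.obj c))) (J.comp V (coyon (J.obj b))) c =
        swapHom (cmp (J.map b c) (𝟙 (J.obj c ⟶[V] J.obj c))) := by
      refine (Category.assoc _ _ _).trans ?_
      refine (congrArg (J.map b c ≫ ·) (resYon_map_natProj J (J.obj b) (J.obj c) c)).trans ?_
      refine (swapHom_precomp _ _).trans (congrArg swapHom ?_)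
      exact cmp_eq_whisker _ _
    refine (unswap_comp_natProj J X (J.obj c) c _).symm.trans ?_
    rw [Category.assoc]
    refine (congrArg (fun t => unswap ((β_ _ _).hom ≫ t)) e).trans ?_
    refine (congrArg₂ (fun s t => unswap ((β_ _ _).hom ≫ cmp s t)) e'
      (Category.id_comp _)).trans ?_
    refine (unswap_cmp_op _ _).trans ?_
    exact congrArg (fun t => (α_ _ _ _).hom ≫ natHom (J.comp V (coyon (J.obj b))) X ◁ t ≫
      natEval J X (J.obj b) c) (unswap_swapHom _)
  refine (congrArg (· ≫ yonedaMap J c X) h1).trans ?_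
  refine (comp_yonedaMap J c X _).trans ?_
  refine (congrArg (fun t => (ρ_ _).inv ≫ _ ◁ eId V (J.obj c) ≫ t) h2).trans ?_
  suffices H : (ρ_ _).inv ≫ (natHom (J.comp V (coyon (J.obj b))) X ⊗ (b ⟶[V] c)) ◁
      eId V (J.obj c) ≫ (α_ _ _ _).hom ≫ _ ◁ cmp (J.map b c) (𝟙 (J.obj c ⟶[V] J.obj c)) ≫
        natEval J X (J.obj b) c = yonedaMap J b X ▷ _ ≫ act X b c from H
  rw [yonedaMap, comp_whiskerRight, comp_whiskerRight, Category.assoc, Category.assoc, natEval_act,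
    associator_naturality_right_assoc, associator_naturality_middle_assoc,
    ← MonoidalCategory.whiskerLeft_comp_assoc, ← MonoidalCategory.whiskerLeft_comp_assoc,
    ← cmp_precomp_right, Category.comp_id, cmp_eId, cmp_eq_whisker, eId_cmp]
  simp

variable [hJ : ∀ a b, IsIso (J.map a b)]

/-- The inverse of the Yoneda map. -/
def yonedaInv (b : B) : X.obj b ⟶ natHom (J.comp V (coyon (J.obj b))) X :=
  haveI := isIso_yonedaMap J b X
  inv (yonedaMap J b X)

lemma yonedaInv_yonedaMap (b : B) : yonedaInv J X b ≫ yonedaMap J b X = 𝟙 _ :=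
  haveI := isIso_yonedaMap J b X
  IsIso.inv_hom_id _

lemma yonedaMap_yonedaInv (b : B) : yonedaMap J b X ≫ yonedaInv J X b = 𝟙 _ :=
  haveI := isIso_yonedaMap J b X
  IsIso.hom_inv_id _

/-- Every presheaf is the colimit of representables weighted by itself. -/
lemma isWeightedLimit_yoneda :
    IsWeightedLimit X (J.comp V (resYon J)) (op X) (fun b => yonedaInv J X b) := by
  have hn : ∀ Y, NatMor Y ((J.comp V (resYon J)).comp V (coyon (op Y)))
    (fun b => yonedaInv J Y b) := fun Y =>
      (yonedaMap_natMor_obj J Y).inv fun b => isIso_yonedaMap J b Y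
  refine isWeightedLimit_iff.2 ⟨fun b c => ?_, fun Y' => ?_⟩
  · refine (hn X b c).trans ?_
    refine (congrArg (yonedaInv J X b ▷ _ ≫ ·)
      (act_comp_coyon (J.comp V (resYon J)) (op X) b c)).trans ?_
    exact cmp_eq_whisker (K := (EnrichedFunctor V B V)ᵒᵖ) (X := op X)
      (L := (J.comp V (resYon J)).obj b) (Y := (J.comp V (resYon J)).obj c) (yonedaInv J X b)
      ((J.comp V (resYon J)).map b c)
  · obtain ⟨Y⟩ := Y'
    refine (isEnd_coyon_iff.1 ?_).2
    have h := (isEnd_natHom X Y).postcomp (hn Y)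
      (fun b => ⟨yonedaMap J b Y, yonedaInv_yonedaMap J Y b, yonedaMap_yonedaInv J Y b⟩)
    have key : ∀ b, unswap (natProj X Y b) ≫ yonedaInv J Y b =
        cmp (K := (EnrichedFunctor V B V)ᵒᵖ) (x := op Y) (y := op X)
          (z := op (J.comp V (coyon (J.obj b)))) (𝟙 (natHom X Y)) (yonedaInv J X b) := by
      intro b
      refine Eq.trans ?_ (cmp_op (x := Y) (y := X) (z := J.comp V (coyon (J.obj b)))
        (𝟙 (natHom X Y)) (yonedaInv J X b)).symm
      have h1 := isIso_yonedaMap J b Y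
      rw [← cancel_mono (yonedaMap J b Y), Category.assoc, yonedaInv_yonedaMap, Category.comp_id,
        Category.assoc]
      have h2 : cmp (x := J.comp V (coyon (J.obj b))) (y := X) (z := Y) (yonedaInv J X b)
          (𝟙 (natHom X Y)) ≫ yonedaMap J b Y =
          MonoidalClosed.uncurry (natProj X Y b) := by
        have h3 : eComp V (J.comp V (coyon (J.obj b))) X Y ≫ yonedaMap J b Y =
            yonedaMap J b X ▷ natHom X Y ≫ MonoidalClosed.uncurry (natProj X Y b) :=
          (congrArg (· ≫ _) (act_coyon _ _ _)).symm.trans (yonedaMap_natMor J b X Y)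
        have h4 : cmp (x := J.comp V (coyon (J.obj b))) (y := X) (z := Y) (yonedaInv J X b)
          (𝟙 (natHom X Y)) = yonedaInv J X b ▷ natHom X Y ≫
          eComp V (J.comp V (coyon (J.obj b))) X Y := by
          simp [cmp]
        rw [h4, Category.assoc]
        refine (congrArg (_ ≫ ·) h3).trans ?_
        rw [← comp_whiskerRight_assoc, yonedaInv_yonedaMap, id_whiskerRight, Category.id_comp]
      exact (congrArg ((β_ _ _).hom ≫ ·) h2).symm
    have key' := funext key
    exact key' ▸ h

lemma isDense_resYon : IsDense (J.comp V (resYon J)) := fun X =>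
  ((isWeightedLimit_yoneda J X.unop).of_weight (yonedaMap_natMor_obj J X.unop)
    (fun b => isIso_yonedaMap J b X.unop)).congr fun b => yonedaMap_yonedaInv J X.unop b

end Density

/-! ### Weighted colimits in the base -/

section WeightedColimits

variable [MonoidalClosed V] [SymmetricCategory V]

section

variable {A : Type w₁} [EnrichedCategory V A]

/-- The contravariant action of a diagram `S : A → Vᵒᵖ`. -/
def opAct (S : EnrichedFunctor V A Vᵒᵖ) (a b : A) :
    (a ⟶[V] b) ⊗ (S.obj b).unop ⟶ (S.obj a).unop :=
  unswap (X := (S.obj b).unop) (Y := (S.obj a).unop) (S.map a b)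

/-- Dinaturality of a family `F a ⊗ S a ⟶ Y`: a cocone under the coend of `F` and `S`. -/
def IsCowedge (F : EnrichedFunctor V A V) (S : EnrichedFunctor V A Vᵒᵖ) {Y : V}
    (q : ∀ a, F.obj a ⊗ (S.obj a).unop ⟶ Y) : Prop :=
  ∀ a b, act F a b ▷ (S.obj b).unop ≫ q b = (α_ _ _ _).hom ≫ F.obj a ◁ opAct S a b ≫ q a

lemma unswap_cmp_opAct {S : EnrichedFunctor V A Vᵒᵖ} {Y Z : V} (a b : A)
    (t : Z ⟶ EnrichedCategory.Hom (V := V) (S.obj a).unop Y) :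
    unswap (X := (S.obj b).unop) (Y := Y)
      (cmp (K := Vᵒᵖ) (x := op Y) (y := S.obj a) (z := S.obj b) t (S.map a b)) =
        (α_ _ _ _).hom ≫ Z ◁ opAct S a b ≫ unswap t :=
  (congrArg (unswap (X := (S.obj b).unop) (Y := Y)) (cmp_op (x := Y) (y := (S.obj a).unop)
    (z := (S.obj b).unop) t (S.map a b))).trans (unswap_cmp_op _ _)

lemma isCone_iff_isCowedge {F : EnrichedFunctor V A V} {S : EnrichedFunctor V A Vᵒᵖ} {L : V}
    {π : ∀ a, F.obj a ⟶ EnrichedCategory.Hom (V := V) (S.obj a).unop L} :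
    IsCone F S (op L) π ↔ IsCowedge F S (fun a => unswap (π a)) := by
  refine forall₂_congr fun a b => ?_
  rw [← unswap_cmp_opAct, ← unswap_precomp]
  exact ⟨fun h => congrArg _ h, fun h => unswap_injective h⟩

lemma coneNat_iff_isCowedge {F : EnrichedFunctor V A V} {S : EnrichedFunctor V A Vᵒᵖ} {Y Z : V}
    {θ : ∀ a, Z ⊗ F.obj a ⟶ EnrichedCategory.Hom (V := V) (S.obj a).unop Y} :
    ConeNat (X := op Y) F S θ ↔
      IsCowedge F S (fun a => MonoidalClosed.curry ((α_ _ _ _).inv ≫ unswap (θ a))) := by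
  refine forall₂_congr fun a b => ?_
  rw [← MonoidalClosed.curry_natural_left, ← MonoidalClosed.curry_natural_left,
    ← MonoidalClosed.curry_natural_left, MonoidalClosed.curry_injective.eq_iff]
  have h := unswap_cmp_opAct (S := S) (Y := Y) a b (θ a)
  trans (unswap ((α_ _ _ _).hom ≫ Z ◁ act F a b ≫ θ b) = unswap (X := (S.obj b).unop) (Y := Y)
      (cmp (K := Vᵒᵖ) (x := op Y) (y := S.obj a) (z := S.obj b) (θ a) (S.map a b)))
  · exact ⟨fun h => congrArg _ h, fun h => unswap_injective h⟩
  · rw [h, unswap_precomp, unswap_precomp,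
      ← cancel_epi ((α_ Z (F.obj a) (a ⟶[V] b)).hom ▷ (S.obj b).unop ≫
        (α_ Z (F.obj a ⊗ (a ⟶[V] b)) (S.obj b).unop).hom)]
    refine iff_of_eq (congrArg₂ _ ?_ ?_) <;> simp

/-- A universal cowedge exhibits a weighted colimit in `V`. -/
lemma isWeightedLimit_op_of_isCowedge {F : EnrichedFunctor V A V} {S : EnrichedFunctor V A Vᵒᵖ}
    {L : V} {p : ∀ a, F.obj a ⊗ (S.obj a).unop ⟶ L} (hp : IsCowedge F S p)
    (hu : ∀ (Y : V) (q : ∀ a, F.obj a ⊗ (S.obj a).unop ⟶ Y), IsCowedge F S q →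
      ∃! t : L ⟶ Y, ∀ a, p a ≫ t = q a) :
    IsWeightedLimit F S (op L) (fun a => swapHom (p a)) := by
  refine isWeightedLimit_iff.2 ⟨isCone_iff_isCowedge.2 (by simpa using hp), fun Y' Z => ?_⟩
  obtain ⟨Y⟩ := Y'
  suffices H : ∀ θ : ∀ a, Z ⊗ F.obj a ⟶ EnrichedCategory.Hom (V := V) (S.obj a).unop Y,
      ConeNat (X := op Y) F S θ → ∃! t : Z ⟶ EnrichedCategory.Hom (V := V) L Y, ∀ a,
        (β_ _ _).hom ≫ cmp (swapHom (p a)) t = θ a by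
    intro θ hθ
    obtain ⟨t, ht, htu⟩ := H θ hθ
    have e : ∀ (t : Z ⟶ EnrichedCategory.Hom (V := V) L Y) (a : A),
      cmp (K := Vᵒᵖ) (x := op Y) (y := op L) (z := S.obj a) t (swapHom (p a)) =
      (β_ _ _).hom ≫ cmp (swapHom (p a)) t := fun t a =>
        cmp_op (x := Y) (y := L) (z := (S.obj a).unop) t (swapHom (p a))
    exact ⟨t, fun a => (e t a).trans (ht a), fun s hs => htu s fun a => (e s a).symm.trans (hs a)⟩
  intro θ hθ
  have key : ∀ (t : Z ⟶ EnrichedCategory.Hom (V := V) L Y) (a : A),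
      (β_ _ _).hom ≫ cmp (swapHom (p a)) t = θ a ↔
        p a ≫ MonoidalClosed.curry (unswap t) =
          MonoidalClosed.curry ((α_ _ _ _).inv ≫ unswap (θ a)) := by
    intro t a
    rw [← MonoidalClosed.curry_natural_left, MonoidalClosed.curry_injective.eq_iff,
      Iso.eq_inv_comp]
    refine Iff.trans ⟨fun h => congrArg unswap h, fun h => unswap_injective h⟩ ?_
    rw [unswap_cmp_op, unswap_swapHom]
  obtain ⟨t, ht, htu⟩ := hu _ _ (coneNat_iff_isCowedge.1 hθ)
  refine ⟨swapHom (MonoidalClosed.uncurry t), fun a => (key _ a).2 ?_, fun s hs => ?_⟩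
  · rw [unswap_swapHom, MonoidalClosed.curry_uncurry, ht]
  · apply unswap_injective
    rw [unswap_swapHom, ← MonoidalClosed.curry_eq_iff]
    exact htu _ fun a => (key s a).1 (hs a)

/-- Composing a cone with a generalized transformation of diagrams. -/
lemma IsCone.cmp_isNat {K : Type w₂} [EnrichedCategory V K] {F : EnrichedFunctor V A V}
    {S S' : EnrichedFunctor V A K} {L : K} {π : ∀ a, F.obj a ⟶ (L ⟶[V] S.obj a)}
    (h : IsCone F S L π) {Z : V} {P : ∀ a, Z ⟶ (S.obj a ⟶[V] S'.obj a)} (hP : IsNat S S' P) :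
    ConeNat F S' (fun a => (β_ _ _).hom ≫ cmp (π a) (P a)) := by
  intro a b
  dsimp only
  rw [BraidedCategory.braiding_naturality_right_assoc, ← cmp_precomp_left, h a b, cmp_assoc,
    hP.cmp_eq, cmp_precomp_right, cmp_precomp_left, cmp_assoc,
    BraidedCategory.braiding_tensor_right_hom]
  simp only [Category.assoc, Iso.hom_inv_id_assoc, Iso.inv_hom_id_assoc,
    ← MonoidalCategory.whiskerLeft_comp_assoc, SymmetricCategory.symmetry,
    MonoidalCategory.whiskerLeft_id, Category.id_comp]

end

variable {A : Type v} [EnrichedCategory V A]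

/-- Weighted colimits over small domains exist in `V`: they are coends, hence coequalizers of
coproducts. -/
lemma exists_weightedColimit [HasColimits V] (F : EnrichedFunctor V A V)
    (S : EnrichedFunctor V A Vᵒᵖ) :
    ∃ (L : V) (π : ∀ a, F.obj a ⟶ EnrichedCategory.Hom (V := V) (S.obj a).unop L),
      IsWeightedLimit F S (op L) π := by
  let D : A → V := fun a => F.obj a ⊗ (S.obj a).unop
  let W : A × A → V := fun p => (F.obj p.1 ⊗ (p.1 ⟶[V] p.2)) ⊗ (S.obj p.2).unop
  let f : ∐ W ⟶ ∐ D := Sigma.desc fun p =>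
    act F p.1 p.2 ▷ (S.obj p.2).unop ≫ Sigma.ι D p.2
  let g : ∐ W ⟶ ∐ D := Sigma.desc fun p =>
    (α_ _ _ _).hom ≫ F.obj p.1 ◁ opAct S p.1 p.2 ≫ Sigma.ι D p.1
  refine ⟨coequalizer f g, _, isWeightedLimit_op_of_isCowedge
    (p := fun a => Sigma.ι D a ≫ coequalizer.π f g) (fun a b => ?_) fun Y q hq => ?_⟩
  · have h := congrArg (Sigma.ι W (a, b) ≫ ·) (coequalizer.condition f g)
    simpa [f, g] using h
  · have h : f ≫ Sigma.desc q = g ≫ Sigma.desc q := by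
      refine Sigma.hom_ext _ _ fun p => ?_
      simpa [f, g] using hq p.1 p.2
    refine ⟨coequalizer.desc _ h, fun a => by simp, fun s hs => ?_⟩
    refine coequalizer.hom_ext (Sigma.hom_ext _ _ fun a => ?_)
    rw [coequalizer.π_desc, Sigma.ι_desc, ← Category.assoc, hs]

variable [HasLimits V]

/-- `C : [Aᵒᵖ, V] → V`, with the cocones `η`, is the functor `F * -` sending a presheaf to its
colimit weighted by `F`. -/
structure IsColimitFunctor (F : EnrichedFunctor V A V)
    (C : EnrichedFunctor V (EnrichedFunctor V Aᵒᵖ V) V)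
    (η : ∀ (R : EnrichedFunctor V Aᵒᵖ V) (a : A),
      F.obj a ⟶ EnrichedCategory.Hom (V := V) (R.obj (op a)) (C.obj R)) : Prop where
  isWeightedColimit : ∀ R, IsWeightedColimit F R (C.obj R) (η R)
  isNat : ∀ a, IsNat (ev (op a)) C fun R => η R a

/-- The universal natural transformation `R' ⟶ R`, seen as a transformation of diagrams in the
opposite category. -/
lemma isNat_opDiagram {K : Type w₂} [EnrichedCategory V K] (R R' : EnrichedFunctor V Aᵒᵖ K) :
    IsNat (opDiagram R) (opDiagram R') (fun a => natProj R' R (op a)) := by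
  intro a b
  have h : (β_ _ _).hom ≫ cmp (R'.map (op b) (op a)) (natProj R' R (op a)) =
    cmp (natProj R' R (op b)) (R.map (op b) (op a)) := isNat_natProj R' R (op b) (op a)
  have h1 := cmp_op (x := R.obj (op a)) (y := R.obj (op b)) (z := R'.obj (op b))
    (R.map (op b) (op a)) (natProj R' R (op b))
  have h2 := cmp_op (x := R.obj (op a)) (y := R'.obj (op a)) (z := R'.obj (op b))
    (natProj R' R (op a)) (R'.map (op b) (op a))
  refine (congrArg ((β_ _ _).hom ≫ ·) h1).trans (Eq.trans ?_ h2.symm)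
  rw [← h]
  exact SymmetricCategory.symmetry_assoc _ _ _

lemma cmp_comp_id_map {K : Type w₂} [EnrichedCategory V K] {x y z : K} {Z W : V}
    (s : Z ⟶ (x ⟶[V] y)) (p : W ⟶ (y ⟶[V] z)) :
    cmp (x := x) (y := y) (s ≫ (EnrichedFunctor.id V K).map x y) p = cmp s p :=
  congrArg (fun s => cmp s p) (Category.comp_id s)

/-- A chosen colimit of every presheaf makes `F * -` a `V`-functor. -/
lemma exists_isColimitFunctor [HasColimits V] (F : EnrichedFunctor V A V) :
    ∃ C η, IsColimitFunctor F C η := by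
  choose L π hL using fun R : EnrichedFunctor V Aᵒᵖ V => exists_weightedColimit F (opDiagram R)
  have hm : ∀ (x : Vᵒᵖ) (e : (EnrichedFunctor V Aᵒᵖ V)ᵒᵖ) (Z : V)
      (s t : Z ⟶ (x ⟶[V] op (L e.unop))),
      (∀ a, cmp (z := op (e.unop.obj (op a))) (s ≫ (EnrichedFunctor.id V Vᵒᵖ).map _ _)
        (π e.unop a) = cmp (z := op (e.unop.obj (op a)))
          (t ≫ (EnrichedFunctor.id V Vᵒᵖ).map _ _) (π e.unop a)) → s = t := by
    intro x e Z s t h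
    refine (hL e.unop).hom_ext fun a => ?_
    have e1 : ∀ s : Z ⟶ (x ⟶[V] op (L e.unop)), _ := fun s =>
      cmp_comp_id_map (z := op (e.unop.obj (op a))) s (π e.unop a)
    exact (e1 s).symm.trans ((h a).trans (e1 t))
  have hex : ∀ e e' : (EnrichedFunctor V Aᵒᵖ V)ᵒᵖ,
      ∃ m : (e ⟶[V] e') ⟶ (op (L e.unop) ⟶[V] op (L e'.unop)), ∀ a,
        cmp (z := op (e'.unop.obj (op a))) (m ≫ (EnrichedFunctor.id V Vᵒᵖ).map _ _) (π e'.unop a) =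
          (β_ _ _).hom ≫ cmp (K := Vᵒᵖ) (x := op (L e.unop)) (π e.unop a)
            ((opFunctor (ev (op a))).map e e') := by
    intro e e'
    obtain ⟨m, hm, -⟩ := (hL e'.unop).isLimAt (op (L e.unop)) _ _
      ((hL e.unop).isCone.cmp_isNat (isNat_opDiagram e.unop e'.unop))
    exact ⟨m, fun a => (cmp_comp_id_map (x := op (L e.unop)) (y := op (L e'.unop))
      (z := op (e'.unop.obj (op a))) m (π e'.unop a)).trans (hm a)⟩
  refine ⟨unopFunctor (assemble (E := (EnrichedFunctor V Aᵒᵖ V)ᵒᵖ) F.obj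
    (fun a => opFunctor (ev (op a))) (EnrichedFunctor.id V Vᵒᵖ) (fun e => op (L e.unop))
    (fun a e => π e.unop a) hm hex), π, hL, fun a R R' => ?_⟩
  have h := assemble_spec (E := (EnrichedFunctor V Aᵒᵖ V)ᵒᵖ) F.obj
    (fun a => opFunctor (ev (op a))) (EnrichedFunctor.id V Vᵒᵖ) (fun e => op (L e.unop))
    (fun a e => π e.unop a) hm hex a (op R') (op R)
  set m := (assemble (E := (EnrichedFunctor V Aᵒᵖ V)ᵒᵖ) F.obj
    (fun a => opFunctor (ev (op a))) (EnrichedFunctor.id V Vᵒᵖ) (fun e => op (L e.unop))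
    (fun a e => π e.unop a) hm hex).map (op R') (op R)
  have h1 := (cmp_comp_id_map (x := op (L R')) (y := op (L R)) (z := op (R.obj (op a))) m
    (π R a)).symm.trans h
  have h2 := cmp_op (x := L R') (y := L R) (z := R.obj (op a)) m (π R a)
  have h3 := cmp_op (x := L R') (y := R'.obj (op a)) (z := R.obj (op a)) (π R' a)
    (natProj R R' (op a))
  have h4 := h2.symm.trans (h1.trans (congrArg ((β_ _ _).hom ≫ ·) h3))
  have h5 : (β_ (natHom R R') (F.obj a)).hom ≫ cmp (π R a) m =
      cmp (natProj R R' (op a)) (π R' a) :=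
    h4.trans (SymmetricCategory.symmetry_assoc _ _ _)
  have h6 := congrArg ((β_ _ _).hom ≫ ·) h5
  exact h6.symm.trans (SymmetricCategory.symmetry_assoc _ _ _)

end WeightedColimits

/-! ### Pointwise colimits of presheaves -/

section Pointwise

variable [MonoidalClosed V] [SymmetricCategory V]

/-- A `V`-natural family parametrized by the unit of `V` is natural in the sense of `IsNat₁`. -/
lemma IsNat.isNat₁ {A : Type w₁} {K : Type w₂} [EnrichedCategory V A] [EnrichedCategory V K]
    {F G : EnrichedFunctor V A K} {θ : ∀ a, 𝟙_ V ⟶ (F.obj a ⟶[V] G.obj a)} (h : IsNat F G θ) :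
    IsNat₁ F G θ := by
  intro a b
  have h1 := h.cmp_eq a b
  rw [cmp_eq_post, cmp_eq_pre] at h1
  simpa using h1

/-- A commuting square of generalized elements may be pulled back along an arrow of `V`. -/
lemma braiding_cmp_precomp {K : Type w} [EnrichedCategory V K] {x x' y y' : K} {E W Z : V}
    {p : E ⟶ (x ⟶[V] x')} {c : E ⟶ (y ⟶[V] y')} {u : W ⟶ (x ⟶[V] y)} {u' : W ⟶ (x' ⟶[V] y')}
    (h : (β_ _ _).hom ≫ cmp p u' = cmp u c) {f : Z ⟶ (x ⟶[V] x')} {m : Z ⟶ E} (hm : m ≫ p = f) :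
    (β_ _ _).hom ≫ cmp f u' = cmp u (m ≫ c) := by
  rw [← hm, cmp_precomp_left, cmp_precomp_right, ← h,
    BraidedCategory.braiding_naturality_right_assoc]

variable [HasLimits V] {A : Type v} {T : Type v} [EnrichedCategory V A] [EnrichedCategory V T]

section

variable {F : EnrichedFunctor V A V} {C : EnrichedFunctor V (EnrichedFunctor V Aᵒᵖ V) V}
  {η : ∀ (R : EnrichedFunctor V Aᵒᵖ V) (a : A),
    F.obj a ⟶ EnrichedCategory.Hom (V := V) (R.obj (op a)) (C.obj R)}

/-- The pointwise colimit `t ↦ F * (Ψ - t)` of a diagram `Ψ` of presheaves, where `C` is the functor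
`F * -`. -/
def pointwiseColimit (C : EnrichedFunctor V (EnrichedFunctor V Aᵒᵖ V) V)
    (Ψ : EnrichedFunctor V A (EnrichedFunctor V T V)ᵒᵖ) : EnrichedFunctor V T V :=
  (flip (unopDiagram Ψ)).comp V C

/-- Colimits in a functor category exist pointwise. -/
lemma IsColimitFunctor.exists_pointwiseColimit (hC : IsColimitFunctor F C η)
    (Ψ : EnrichedFunctor V A (EnrichedFunctor V T V)ᵒᵖ) :
    ∃ π : ∀ a, F.obj a ⟶ natHom (Ψ.obj a).unop (pointwiseColimit C Ψ),
      IsWeightedLimit F Ψ (op (pointwiseColimit C Ψ)) π ∧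
      ∀ t, PreservesWeightedLimit (opFunctor (ev t)) F Ψ := by
  have hn : ∀ a, IsNat (Ψ.obj a).unop (pointwiseColimit C Ψ)
      (fun t => η ((unopDiagram Ψ).comp V (ev t)) a) := by
    intro a t t'
    have h : (β_ _ _).hom ≫ cmp (natProj _ _ (op a)) (η ((unopDiagram Ψ).comp V (ev t')) a) =
        cmp (η ((unopDiagram Ψ).comp V (ev t)) a) (C.map ((unopDiagram Ψ).comp V (ev t))
          ((unopDiagram Ψ).comp V (ev t'))) :=
      hC.isNat a ((unopDiagram Ψ).comp V (ev t)) ((unopDiagram Ψ).comp V (ev t'))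
    exact braiding_cmp_precomp h (flip_map_natProj (unopDiagram Ψ) t t' (op a))
  have hp : ∀ t, IsWeightedLimit F (Ψ.comp V (opFunctor (ev t))) (op ((pointwiseColimit C Ψ).obj t))
      (fun a => natLift _ (hn a) ≫ natProj _ _ t) := fun t =>
    IsWeightedLimit.congr (fun a => (natLift_proj _ (hn a) t).symm)
      (hC.isWeightedColimit ((unopDiagram Ψ).comp V (ev t)))
  have hl := isWeightedColimit_of_pointwise hp
  exact ⟨_, hl, fun t => PreservesWeightedLimit.of_isWeightedLimit hl (hp t)⟩

/-- If all the functors `Ψ a` preserve a limit, then so does the functor `t ↦ (a ↦ Ψ a t)`. -/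
lemma preservesWeightedLimit_flip {D : Type w} [EnrichedCategory V D]
    {Ψ : EnrichedFunctor V A (EnrichedFunctor V T V)} {W : EnrichedFunctor V D V}
    {S : EnrichedFunctor V D T} (h : ∀ a, PreservesWeightedLimit (Ψ.obj a) W S) :
    PreservesWeightedLimit (flip Ψ) W S := by
  intro L π hL
  refine isWeightedLimit_of_pointwise fun a => ?_
  have h1 := h a L π hL
  have e : ∀ t t', (flip Ψ).map t t' ≫ natProj _ _ a = (Ψ.obj a).map t t' :=
    fun t t' => flip_map_natProj Ψ t t' a
  refine IsWeightedLimit.congr (fun d => ?_) (h1.congr_map fun d d' => ?_)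
  · exact (congrArg (π d ≫ ·) (e L (S.obj d))).symm.trans (Category.assoc _ _ _).symm
  · exact (congrArg (S.map d d' ≫ ·) (e (S.obj d) (S.obj d'))).symm.trans
      (Category.assoc _ _ _).symm

end

end Pointwise

/-! ### Continuous functors and flat weights -/

section Phi

variable [SymmetricCategory V] [MonoidalClosed V] {Φ : Set (Weight.{d} V)}

lemma PhiContinuous.comp {K : Type w₁} {N : Type w₂} {N' : Type w₃} [EnrichedCategory V K]
    [EnrichedCategory V N] [EnrichedCategory V N'] {P : EnrichedFunctor V K N}
    {Q : EnrichedFunctor V N N'} (hP : PhiContinuous Φ P) (hQ : PhiContinuous Φ Q) :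
    PhiContinuous Φ (P.comp V Q) :=
  fun φ hφ S => (hP φ hφ S).comp (hQ φ hφ (S.comp V P))

lemma phiContinuous_coyon {K : Type w} [EnrichedCategory V K] (x : K) :
    PhiContinuous Φ (coyon x) := fun φ _ S => preservesWeightedLimit_coyon x φ.functor S

variable [HasLimits V] {A : Type v} {T : Type v} [EnrichedCategory V A] [EnrichedCategory V T]

/-- Flatness, in terms of functors `F * -` as encoded by `IsColimitFunctor`. -/
lemma isFlat_iff {F : EnrichedFunctor V A V} :
    IsFlat Φ F ↔ ∃ C η, IsColimitFunctor F C η ∧ PhiContinuous Φ C :=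
  ⟨fun ⟨C, η, h1, h2, h3⟩ => ⟨C, η, ⟨h1, h2⟩, h3⟩, fun ⟨C, η, h1, h3⟩ => ⟨C, η, h1.1, h1.2, h3⟩⟩

/-- `Φ`-continuous functors are closed under `Φ`-flat colimits in `[T, V]`, and these colimits are
pointwise. -/
lemma IsFlat.exists_pointwiseColimit {F : EnrichedFunctor V A V} (hF : IsFlat Φ F)
    (Ψ : EnrichedFunctor V A (EnrichedFunctor V T V)ᵒᵖ)
    (hΨ : ∀ a, PhiContinuous Φ (Ψ.obj a).unop) :
    ∃ (G : EnrichedFunctor V T V) (π : ∀ a, F.obj a ⟶ natHom (Ψ.obj a).unop G),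
      IsWeightedLimit F Ψ (op G) π ∧ (∀ t, PreservesWeightedLimit (opFunctor (ev t)) F Ψ) ∧
        PhiContinuous Φ G := by
  obtain ⟨C, η, hC, hc⟩ := isFlat_iff.1 hF
  obtain ⟨π, h1, h2⟩ := hC.exists_pointwiseColimit Ψ
  refine ⟨_, π, h1, h2, PhiContinuous.comp (fun φ hφ S => ?_) hc⟩
  exact preservesWeightedLimit_flip (Ψ := unopDiagram Ψ) fun a => hΨ a.unop φ hφ S

end Phi

/-! ### Full subcategories on families of objects -/

section Induced

variable {I : Type w₁} {K : Type w₂} [EnrichedCategory V K]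

/-- The `V`-category structure on a type `I` for which `f : I → K` is fully faithful. -/
abbrev inducedEnriched (f : I → K) : EnrichedCategory V I where
  Hom x y := (f x ⟶[V] f y)
  id x := eId V (f x)
  comp x y z := eComp V (f x) (f y) (f z)
  id_comp x y := e_id_comp V (f x) (f y)
  comp_id x y := e_comp_id V (f x) (f y)
  assoc x y z t := e_assoc V (f x) (f y) (f z) (f t)

/-- The fully faithful `V`-functor given by `f : I → K`. -/
def inducedFunctor (f : I → K) : letI := inducedEnriched (V := V) f; EnrichedFunctor V I K :=
  letI := inducedEnriched (V := V) f
  { obj := f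
    map := fun x y => 𝟙 (f x ⟶[V] f y)
    map_id := fun x => Category.comp_id _
    map_comp := fun x y z => by
      change eComp V (f x) (f y) (f z) ≫ 𝟙 _ = (𝟙 _ ⊗ₘ 𝟙 _) ≫ eComp V (f x) (f y) (f z)
      rw [Category.comp_id, id_tensorHom_id, Category.id_comp] }

end Induced

/-! ### Reduction of small weights to small domains -/

section SmallWeights

variable [MonoidalClosed V] [SymmetricCategory V]
  {A : Type w₁} {K : Type w₂} [EnrichedCategory V A] [EnrichedCategory V K]

/-- Weighted limits may be computed after reindexing along a bijection on objects. -/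
lemma IsWeightedLimit.of_equiv {B : Type w} (e : B ≃ A) {F : EnrichedFunctor V A V}
    {S : EnrichedFunctor V A K} {L : K}
    (h : letI := inducedEnriched (V := V) e
      ∃ π, IsWeightedLimit ((inducedFunctor (V := V) e).comp V F)
        ((inducedFunctor (V := V) e).comp V S) L π) : ∃ π, IsWeightedLimit F S L π := by
  let _ := inducedEnriched (V := V) e
  obtain ⟨π₀, h⟩ := h
  let π : ∀ b, F.obj (e b) ⟶ (L ⟶[V] S.obj (e b)) := π₀
  have hact : ∀ b b', act ((inducedFunctor (V := V) e).comp V F) b b' = act F (e b) (e b') := by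
    intro b b'
    refine (act_comp _ _ _ _).trans ?_
    suffices H : F.obj (e b) ◁ 𝟙 (e b ⟶[V] e b') ≫ act F (e b) (e b') = act F (e b) (e b') from H
    simp
  have hmap : ∀ b b', ((inducedFunctor (V := V) e).comp V S).map b b' = S.map (e b) (e b') :=
    fun b b' => Category.id_comp _
  let π' := Equiv.piCongrLeft (fun a => F.obj a ⟶ (L ⟶[V] S.obj a)) e π
  have hπ : ∀ b, π' (e b) = π b := fun b =>
    Equiv.piCongrLeft_apply_apply (fun a => F.obj a ⟶ (L ⟶[V] S.obj a)) e π b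
  refine ⟨π', isWeightedLimit_iff.2 ⟨fun a a' => ?_, fun X Z θ hθ => ?_⟩⟩
  · obtain ⟨b, rfl⟩ := e.surjective a
    obtain ⟨b', rfl⟩ := e.surjective a'
    rw [hπ, hπ, ← hact, ← hmap]
    exact h.isCone b b'
  · have hθ' : ConeNat (X := X) ((inducedFunctor (V := V) e).comp V F)
        ((inducedFunctor (V := V) e).comp V S) (fun b => θ (e b)) := by
      intro b b'
      rw [hact, hmap]
      exact hθ (e b) (e b')
    obtain ⟨t, ht, hu⟩ : ∃! t : Z ⟶ (X ⟶[V] L), ∀ b, cmp t (π b) = θ (e b) :=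
      h.isLimAt X Z _ hθ'
    refine ⟨t, fun a => ?_, fun s hs => hu s fun b => ?_⟩
    · obtain ⟨b, rfl⟩ := e.surjective a
      rw [hπ, ht]
    · rw [← hπ, hs]

/-- Composition in the underlying category of `V` is composition of transposes. -/
lemma unswap_comp_post {W X Y T : V} (f : W ⟶ EnrichedCategory.Hom (V := V) X Y)
    (e : 𝟙_ V ⟶ EnrichedCategory.Hom (V := V) Y T) :
    unswap (f ≫ post X e) = unswap f ≫ (λ_ Y).inv ≫ unswap e := by
  have h : unswap f ▷ 𝟙_ V = (ρ_ _).hom ≫ unswap f ≫ (ρ_ _).inv := by simp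
  have h2 : (ρ_ W).inv ▷ X ≫ (α_ _ _ _).hom ≫ W ◁ (β_ (𝟙_ V) X).hom ≫ (α_ _ _ _).inv ≫
      (ρ_ _).hom = 𝟙 _ := by simp
  have h3 : unswap e = (β_ (𝟙_ V) Y).hom ≫ MonoidalClosed.uncurry e := rfl
  have h4 : (λ_ Y).inv ≫ (β_ (𝟙_ V) Y).hom = (ρ_ Y).inv := by simp
  rw [comp_post, unswap_precomp, unswap_cmp, h, h3, reassoc_of% h4]
  simp only [Category.assoc]
  rw [reassoc_of% h2]

section

variable {F : EnrichedFunctor V A V} {P : Set A} {a : A}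
  (h : IsWeightedColimit ((incl (V := V) (fun x : A => x ∈ P)).comp V F)
      ((opFunctor (incl (V := V) (fun x : A => x ∈ P))).comp V (coyon (op a))) (F.obj a)
      fun p => MonoidalClosed.curry
        ((β_ (p.1 ⟶[V] a) (F.obj p.1)).hom ≫ MonoidalClosed.uncurry (F.map p.1 a)))

include h

/-- A small weight is the left Kan extension of its restriction to `P`: maps out of `Z ⊗ F a` are
detected on `P`. -/
lemma smallWeight_hom_ext {Z Y : V} {s t : Z ⊗ F.obj a ⟶ Y}
    (hst : ∀ p ∈ P, Z ◁ act F p a ≫ s = Z ◁ act F p a ≫ t) : s = t := by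
  apply swapHom_injective
  refine IsWeightedLimit.hom_ext (K := Vᵒᵖ) h (X := op Y) fun p => ?_
  have e : ∀ s : Z ⊗ F.obj a ⟶ Y, cmp (K := Vᵒᵖ) (x := op Y) (y := op (F.obj a))
      (z := op (p.1 ⟶[V] a)) (swapHom (Y := Y) s) (swapHom (Y := F.obj a) (act F p.1 a)) =
      swapHom ((α_ _ _ _).hom ≫ Z ◁ act F p.1 a ≫ s) := by
    intro s
    refine (cmp_op (x := Y) (y := F.obj a) (z := p.1 ⟶[V] a) (swapHom (Y := Y) s)
      (swapHom (Y := F.obj a) (act F p.1 a))).trans ?_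
    apply unswap_injective
    rw [unswap_cmp_op, unswap_swapHom, unswap_swapHom, unswap_swapHom]
  refine (e s).trans (Eq.trans ?_ (e t).symm)
  rw [hst p.1 p.2]

/-- A small weight is the left Kan extension of its restriction to `P`: maps out of `F a` are
constructed on `P`. -/
lemma smallWeight_exists_desc {Y : V} (q : ∀ p : {x // x ∈ P}, F.obj p.1 ⊗ (p.1 ⟶[V] a) ⟶ Y)
    (hq : ∀ p p' : {x // x ∈ P}, act F p.1 p'.1 ▷ (p'.1 ⟶[V] a) ≫ q p' =
      (α_ _ _ _).hom ≫ F.obj p.1 ◁ eComp V p.1 p'.1 a ≫ q p) :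
    ∃ t : F.obj a ⟶ Y, ∀ p : {x // x ∈ P}, act F p.1 a ≫ t = q p := by
  let F' := (incl (V := V) (fun x : A => x ∈ P)).comp V F
  let S' := opDiagram ((opFunctor (incl (V := V) (fun x : A => x ∈ P))).comp V (coyon (op a)))
  have hS : ∀ p p', opAct S' p p' = eComp V p.1 p'.1 a := by
    intro p p'
    have h1 : S'.map p p' = MonoidalClosed.curry (eComp V (op a) (op p'.1) (op p.1)) :=
      Category.id_comp _
    refine (congrArg (unswap (X := p'.1 ⟶[V] a) (Y := p.1 ⟶[V] a)) h1).trans ?_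
    rw [unswap, MonoidalClosed.uncurry_curry, eComp_op_eq]
    exact SymmetricCategory.symmetry_assoc _ _ _
  have hF : ∀ p p', act F' p p' = act F p.1 p'.1 := by
    intro p p'
    refine (act_comp _ _ _ _).trans ?_
    suffices H : F.obj p.1 ◁ 𝟙 (p.1 ⟶[V] p'.1) ≫ act F p.1 p'.1 = act F p.1 p'.1 from H
    simp
  have hc : IsCone F' S' (op Y) (fun p => swapHom (Y := Y) (q p)) := by
    rw [isCone_iff_isCowedge]
    intro p p'
    rw [hS, hF]
    suffices H : act F p.1 p'.1 ▷ (p'.1 ⟶[V] a) ≫ unswap (swapHom (q p')) =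
      (α_ _ _ _).hom ≫ F.obj p.1 ◁ eComp V p.1 p'.1 a ≫ unswap (swapHom (q p)) from H
    rw [unswap_swapHom, unswap_swapHom, hq]
  obtain ⟨e, he⟩ := IsWeightedLimit.exists_lift (K := Vᵒᵖ) h hc
  refine ⟨(λ_ _).inv ≫ unswap (X := F.obj a) (Y := Y) e, fun p => ?_⟩
  have h2 : swapHom (act F p.1 a) ≫ post (p.1 ⟶[V] a) e = swapHom (q p) :=
    (congrArg (swapHom (act F p.1 a) ≫ ·)
      (pre_op (z := p.1 ⟶[V] a) (x := Y) (y := F.obj a) e)).symm.trans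
      (he p)
  have h3 := congrArg unswap h2
  rw [unswap_comp_post, unswap_swapHom, unswap_swapHom] at h3
  exact h3

end

/-- Limits with small weights reduce to limits with weights on small `V`-categories. -/
lemma hasWeightedLimit_of_isSmallWeight {F : EnrichedFunctor V A V} (hF : IsSmallWeight F)
    (hK : ∀ (B : Type v) [EnrichedCategory V B] (W : EnrichedFunctor V B V)
      (S : EnrichedFunctor V B K), HasWeightedLimit W S) (S : EnrichedFunctor V A K) :
    HasWeightedLimit F S := by
  obtain ⟨P, hP, h⟩ := hF
  let i := incl (V := V) (fun x : A => x ∈ P)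
  obtain ⟨L, π₀, hL⟩ : HasWeightedLimit (i.comp V F) (i.comp V S) := by
    let e : Shrink.{v} P ≃ {x // x ∈ P} := (equivShrink P).symm
    let _ := inducedEnriched (V := V) e
    obtain ⟨L, π, hL⟩ := hK (Shrink.{v} P) ((inducedFunctor (V := V) e).comp V (i.comp V F))
      ((inducedFunctor (V := V) e).comp V (i.comp V S))
    exact ⟨L, IsWeightedLimit.of_equiv e ⟨π, hL⟩⟩
  let π : ∀ p : {x // x ∈ P}, F.obj p.1 ⟶ (L ⟶[V] S.obj p.1) := π₀
  have hi : ∀ p p' : {x // x ∈ P}, act (i.comp V F) p p' = act F p.1 p'.1 := by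
    intro p p'
    refine (act_comp _ _ _ _).trans ?_
    suffices H : F.obj p.1 ◁ 𝟙 (p.1 ⟶[V] p'.1) ≫ act F p.1 p'.1 = act F p.1 p'.1 from H
    simp
  have hiS : ∀ p p' : {x // x ∈ P}, (i.comp V S).map p p' = S.map p.1 p'.1 :=
    fun p p' => Category.id_comp _
  have hπ : ∀ p p', act F p.1 p'.1 ≫ π p' = cmp (π p) (S.map p.1 p'.1) := by
    intro p p'
    rw [← hi p p', ← hiS p p']
    exact hL.isCone p p'
  have hex : ∀ a, ∃ t : F.obj a ⟶ (L ⟶[V] S.obj a), ∀ p : {x // x ∈ P},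
      act F p.1 a ≫ t = cmp (π p) (S.map p.1 a) := by
    refine fun a => smallWeight_exists_desc (h a) _ fun p p' => ?_
    rw [← cmp_precomp_left, hπ, cmp_assoc, ← cmp_precomp_right, S.map_comp]
    rfl
  choose π' hπ' using hex
  have hππ : ∀ p, π' p.1 = π p := by
    intro p
    have h1 := congrArg (fun t => F.obj p.1 ◁ eId V p.1 ≫ t)
      ((hπ' p.1 p).trans (hπ p p).symm)
    rw [← Category.assoc, ← Category.assoc, act_eId, cancel_epi] at h1
    exact h1
  refine ⟨L, π', isWeightedLimit_iff.2 ⟨fun a b => ?_, fun X Z θ hθ => ?_⟩⟩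
  · rw [← cancel_epi (β_ (a ⟶[V] b) (F.obj a)).hom]
    refine smallWeight_hom_ext (h a) fun p hp => ?_
    rw [BraidedCategory.braiding_naturality_right_assoc,
      BraidedCategory.braiding_naturality_right_assoc, ← Category.assoc (act F p a ▷ _),
      act_act, Category.assoc, Category.assoc, hπ' b ⟨p, hp⟩, ← cmp_precomp_left,
      hπ' a ⟨p, hp⟩, cmp_assoc, ← cmp_precomp_right, S.map_comp]
    rfl
  · have hθ' : ConeNat (X := X) (i.comp V F) (i.comp V S) (fun p => θ p.1) := by
      intro p p'
      rw [hi, hiS]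
      exact hθ p.1 p'.1
    obtain ⟨t, ht, hu⟩ : ∃! t : Z ⟶ (X ⟶[V] L), ∀ p : {x // x ∈ P}, cmp t (π p) = θ p.1 :=
      hL.isLimAt X Z _ hθ'
    refine ⟨t, fun a => smallWeight_hom_ext (h a) fun p hp => ?_, fun s hs => hu s fun p => ?_⟩
    · rw [← cmp_precomp_right, hπ' a ⟨p, hp⟩, ← cancel_epi (α_ _ _ _).hom, ← cmp_assoc,
        ht ⟨p, hp⟩, hθ]
    · rw [← hππ, hs]

end SmallWeights

/-! ### Natural transformations and isomorphisms -/

section NaturalFamilies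

variable [MonoidalClosed V] [SymmetricCategory V] {A : Type w₁} {K : Type w₂} {N : Type w₃}
  [EnrichedCategory V A] [EnrichedCategory V K] [EnrichedCategory V N]

lemma IsNat.restrict {Z : V} {F G : EnrichedFunctor V K N} {θ : ∀ a, Z ⟶ (F.obj a ⟶[V] G.obj a)}
    (h : IsNat F G θ) (P : EnrichedFunctor V A K) :
    IsNat (P.comp V F) (P.comp V G) (fun a => θ (P.obj a)) := fun a b =>
  braiding_cmp_precomp (h (P.obj a) (P.obj b)) rfl

lemma IsNat.natMor {F G : EnrichedFunctor V A V}
    {t : ∀ a, 𝟙_ V ⟶ EnrichedCategory.Hom (V := V) (F.obj a) (G.obj a)} (h : IsNat F G t) :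
    NatMor F G (fun a => (λ_ _).inv ≫ unswap (t a)) := by
  intro a b
  have h1 := (isNat_iff_natFam F G t).1 h a b
  dsimp only
  rw [comp_whiskerRight, Category.assoc, ← h1, leftUnitor_inv_naturality_assoc]
  simp

/-- A functor acts naturally on hom-objects. -/
lemma natMor_map (P : EnrichedFunctor V K N) (x : K) :
    NatMor (coyon x) (P.comp V (coyon (P.obj x))) (fun y => P.map x y) := by
  intro y z
  have h1 : act (P.comp V (coyon (P.obj x))) y z = cmp (𝟙 (P.obj x ⟶[V] P.obj y)) (P.map y z) :=
    act_comp_coyon P (P.obj x) y z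
  rw [act_coyon]
  refine (P.map_comp x y z).trans (Eq.trans ?_ (congrArg (P.map x y ▷ _ ≫ ·) h1).symm)
  exact (cmp_eq_whisker (P.map x y) (P.map y z)).symm

/-- Naturality of precomposition with a generalized element. -/
lemma natFam_precomp {x y : K} {Z : V} (u : Z ⟶ (y ⟶[V] x)) :
    NatFam (coyon x) (coyon y) (fun b => cmp u (𝟙 (x ⟶[V] b))) := by
  intro a b
  rw [act_coyon, act_coyon]
  suffices H : (α_ _ _ _).hom ≫ Z ◁ eComp V x a b ≫ cmp u (𝟙 (x ⟶[V] b)) =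
    cmp u (𝟙 (x ⟶[V] a)) ▷ _ ≫ eComp V y a b from H
  have h1 : cmp (𝟙 (x ⟶[V] a)) (𝟙 (a ⟶[V] b)) = eComp V x a b := by simp [cmp]
  have h2 := cmp_assoc u (𝟙 (x ⟶[V] a)) (𝟙 (a ⟶[V] b))
  rw [h1] at h2
  rw [← cmp_precomp_right, Category.comp_id, ← h2]
  simp [cmp]

lemma InvPair.unop {x y : K} {e : 𝟙_ V ⟶ (x ⟶[V] y)} {e' : 𝟙_ V ⟶ (y ⟶[V] x)}
    (h : InvPair (K := Kᵒᵖ) (x := Opposite.op y) (y := Opposite.op x) e e') : InvPair e e' := by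
  have h1 := h.op.map unopUnop
  have e1 : ∀ {Z X : V} (f : Z ⟶ X), f ≫ 𝟙 X = f := fun f => Category.comp_id f
  suffices H : InvPair (e ≫ 𝟙 (x ⟶[V] y)) (e' ≫ 𝟙 (y ⟶[V] x)) by rwa [e1, e1] at H
  exact h1

lemma Isomorphic.op {x y : K} (h : Isomorphic V x y) :
    Isomorphic V (K := Kᵒᵖ) (op x) (op y) := by
  obtain ⟨e, e', he⟩ := isomorphic_iff.1 h
  exact isomorphic_iff.2 ⟨e', e, he.op.symm⟩

lemma Isomorphic.unop {x y : Kᵒᵖ} (h : Isomorphic V x y) : Isomorphic V x.unop y.unop := by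
  obtain ⟨e, e', he⟩ := isomorphic_iff.1 h
  exact isomorphic_iff.2 ⟨e', e, (InvPair.unop he).symm⟩

lemma Isomorphic.symm {x y : K} (h : Isomorphic V x y) : Isomorphic V y x := h.map Iso.symm

lemma Isomorphic.trans {x y z : K} (h : Isomorphic V x y) (h' : Isomorphic V y z) :
    Isomorphic V x z := Nonempty.map2 Iso.trans h h'

/-- Fully faithful functors reflect isomorphism of objects. -/
lemma Isomorphic.of_map {J : EnrichedFunctor V K N} (hJ : ∀ x y, IsIso (J.map x y)) {x y : K}
    (h : Isomorphic V (J.obj x) (J.obj y)) : Isomorphic V x y := by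
  obtain ⟨e, e', he⟩ := isomorphic_iff.1 h
  refine isomorphic_iff.2 ⟨e ≫ inv (J.map x y), e' ≫ inv (J.map y x), ⟨?_, ?_⟩⟩
  · rw [← cancel_mono (J.map x x), Category.assoc, post_map, J.map_id]
    simpa using he.left
  · rw [← cancel_mono (J.map y y), Category.assoc, post_map, J.map_id]
    simpa using he.right

end NaturalFamilies

/-! ### Closure under colimits -/

section Closure

variable [SymmetricCategory V] [MonoidalClosed V] {Φ : Set (Weight.{d} V)}

/-- An essentially small collection is exhausted up to isomorphism by a small family of its
members. Only the members of the given set which are isomorphic to one in the collection matter. -/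
lemma IsEssentiallySmall.exists_family {N : Type w} [EnrichedCategory V N] {p : N → Prop}
    (h : IsEssentiallySmall V p) : ∃ (S : Type v) (s : S → N), (∀ x, p (s x)) ∧
      ∀ x, p x → ∃ i, Isomorphic V x (s i) := by
  obtain ⟨S, hS, h⟩ := h
  let S' := {y : S // ∃ x, p x ∧ Isomorphic V x y.1}
  choose s hs hs' using fun y : S' => y.2
  refine ⟨Shrink.{v} S', fun i => s ((equivShrink S').symm i), fun i => hs _, fun x hx => ?_⟩
  obtain ⟨y, hy, hxy⟩ := h x hx
  refine ⟨equivShrink S' ⟨⟨y, hy⟩, x, hx, hxy⟩, hxy.trans ?_⟩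
  change Isomorphic V y (s ((equivShrink S').symm (equivShrink S' _)))
  rw [Equiv.symm_apply_apply]
  exact (hs' ⟨⟨y, hy⟩, x, hx, hxy⟩).symm

/-- A full subcategory of `Kᵒᵖ` on objects representing the closure of `G` under `Φ`-colimits is
`Φ`-complete, and its inclusion is `Φ`-continuous. -/
lemma phiComplete_of_closure {K : Type w} [EnrichedCategory V K]
    (hK : ∀ φ ∈ Φ, ∀ S : EnrichedFunctor V φ.dom Kᵒᵖ, HasWeightedLimit φ.functor S)
    {G : Set K} {I : Type w₁} (f : I → K) (hf : ∀ i, PhiClosure Φ G (f i))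
    (hf' : ∀ x, PhiClosure Φ G x → ∃ i, Isomorphic V x (f i)) :
    letI := inducedEnriched (V := V) (fun i => op (f i))
    PhiComplete Φ I ∧ PhiContinuous Φ (inducedFunctor (V := V) (fun i => op (f i))) := by
  let _ := inducedEnriched (V := V) (fun i => op (f i))
  let J := inducedFunctor (V := V) (fun i => op (f i))
  have hJ : ∀ x y, IsIso (J.map x y) := fun x y => inferInstanceAs (IsIso (𝟙 _))
  have key : ∀ φ ∈ Φ, ∀ S : EnrichedFunctor V φ.dom I, ∃ (L : I) (π : _),
      IsWeightedLimit φ.functor S L π ∧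
      IsWeightedLimit φ.functor (S.comp V J) (J.obj L) (fun a => π a ≫ J.map L (S.obj a)) := by
    intro φ hφ S
    obtain ⟨d, ρ, hd⟩ := hK φ hφ (S.comp V J)
    obtain ⟨i, hi⟩ := hf' d.unop (PhiClosure.colim φ hφ (unopDiagram (S.comp V J)) d.unop ρ
      (fun a => hf _) hd)
    obtain ⟨π, h⟩ := hd.exists_of_fullyFaithful hJ (L := i) hi.symm.op
    exact ⟨i, π, h⟩
  refine ⟨fun φ hφ S => ?_, fun φ hφ S => ?_⟩
  · obtain ⟨L, π, h, -⟩ := key φ hφ S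
    exact ⟨L, π, h⟩
  · obtain ⟨L, π, h, h'⟩ := key φ hφ S
    exact PreservesWeightedLimit.of_isWeightedLimit h h'

end Closure

/-! ### Presentable objects -/

section Presentable

variable [MonoidalClosed V] [SymmetricCategory V]

lemma exists_invPair_of_isIso {X Y : V} {e : 𝟙_ V ⟶ EnrichedCategory.Hom (V := V) X Y}
    (h : IsIso ((λ_ X).inv ≫ unswap e)) : ∃ e', InvPair e e' := by
  refine ⟨swapHom ((λ_ Y).hom ≫ inv ((λ_ X).inv ≫ unswap e)), ?_, ?_⟩
  · apply unswap_injective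
    rw [unswap_comp_post, unswap_swapHom, unswap_eId]
    simp
  · apply unswap_injective
    rw [unswap_comp_post, unswap_swapHom, unswap_eId]
    simp

lemma InvPair.isIso_unswap {X Y : V} {e : 𝟙_ V ⟶ EnrichedCategory.Hom (V := V) X Y}
    {e' : 𝟙_ V ⟶ EnrichedCategory.Hom (V := V) Y X} (h : InvPair e e') :
    IsIso ((λ_ X).inv ≫ unswap e) := by
  have h1 := congrArg (fun t => (λ_ _).inv ≫ unswap t) h.left
  have h2 := congrArg (fun t => (λ_ _).inv ≫ unswap t) h.right
  simp only [unswap_comp_post, unswap_eId, Iso.inv_hom_id] at h1 h2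
  exact ⟨(λ_ Y).inv ≫ unswap e', by simpa using h1, by simpa using h2⟩

section

variable {K : Type w₂} [EnrichedCategory V K]

/-- Evaluation of a representable functor on a generalized element. -/
lemma curry_cmp_eq_coyon_map {x y z : K} {Z : V} (p : Z ⟶ (y ⟶[V] z)) :
    p ≫ (coyon x).map y z = MonoidalClosed.curry (cmp (𝟙 (x ⟶[V] y)) p) := by
  have h : cmp (𝟙 (x ⟶[V] y)) p = (x ⟶[V] y) ◁ p ≫ eComp V x y z := by simp [cmp]
  rw [h]
  exact (MonoidalClosed.curry_natural_left _ _).symm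

lemma coyon_map_op (x y z : K) :
    (coyon (op z : Kᵒᵖ)).map (op y) (op x) = swapHom (cmp (𝟙 (x ⟶[V] y)) (𝟙 (y ⟶[V] z))) := by
  refine congrArg MonoidalClosed.curry ((eComp_op_eq V (op x) (op y) (op z)).trans ?_)
  simp [cmp]

lemma comp_coyon_map_eq_swapHom {x y z : K} {Z : V} (p : Z ⟶ (y ⟶[V] z)) :
    p ≫ (coyon x).map y z =
      swapHom (cmp (K := Kᵒᵖ) (x := op z) (y := op y) (z := op x) p (𝟙 (x ⟶[V] y))) := by
  rw [curry_cmp_eq_coyon_map]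
  have h := cmp_op (x := z) (y := y) (z := x) p (𝟙 (x ⟶[V] y))
  refine Eq.trans ?_ (congrArg swapHom h).symm
  rw [swapHom, SymmetricCategory.symmetry_assoc]

end

variable [HasLimits V]

section

variable {B : Type v} {K : Type w₂} [EnrichedCategory V B] [EnrichedCategory V K]

lemma resYon_map_natProj_eq (Q : EnrichedFunctor V B K) (x y : K) (b : B) :
    (resYon Q).map x y ≫ natProj (Q.comp V (coyon y)) (Q.comp V (coyon x)) b =
      (coyon (op (Q.obj b))).map (op y) (op x) :=
  (resYon_map_natProj Q x y b).trans (coyon_map_op x y (Q.obj b)).symm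

/-- The functor `x ↦ K(x, Q -)` preserves all limits. -/
lemma preservesWeightedLimit_unopDiagram_resYon {D : Type w} [EnrichedCategory V D]
    (Q : EnrichedFunctor V B K) (W : EnrichedFunctor V D V) (S : EnrichedFunctor V D Kᵒᵖ) :
    PreservesWeightedLimit (unopDiagram (resYon Q)) W S := by
  intro L π hL
  refine isWeightedLimit_of_pointwise fun b => ?_
  have h1 := preservesWeightedLimit_coyon (op (Q.obj b)) W S L π hL
  have e : ∀ x y : Kᵒᵖ, (unopDiagram (resYon Q)).map x y ≫ natProj _ _ b =
    (coyon (op (Q.obj b))).map x y := fun x y => resYon_map_natProj_eq Q y.unop x.unop b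
  refine IsWeightedLimit.congr (fun d => ?_) (h1.congr_map fun d d' => ?_)
  · exact (congrArg (π d ≫ ·) (e L (S.obj d))).symm.trans (Category.assoc _ _ _).symm
  · exact (congrArg (S.map d d' ≫ ·) (e (S.obj d) (S.obj d'))).symm.trans
      (Category.assoc _ _ _).symm

end

section

variable {A : Type v} [EnrichedCategory V A] {M : Type w₁} [EnrichedCategory V M]
  {F : EnrichedFunctor V A V} {C : EnrichedFunctor V (EnrichedFunctor V Aᵒᵖ V) V}
  {η : ∀ (R : EnrichedFunctor V Aᵒᵖ V) (a : A),
    F.obj a ⟶ EnrichedCategory.Hom (V := V) (R.obj (op a)) (C.obj R)}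

/-- Maps out of a colimit in `V` are determined by their composites with the cocone. -/
lemma IsWeightedColimit.hom_ext_post {R : EnrichedFunctor V Aᵒᵖ V} {L Y : V}
    {p : ∀ a, F.obj a ⟶ EnrichedCategory.Hom (V := V) (R.obj (op a)) L}
    (h : IsWeightedColimit F R L p) {t t' : 𝟙_ V ⟶ EnrichedCategory.Hom (V := V) L Y}
    (htt' : ∀ a, p a ≫ post (R.obj (op a)) t = p a ≫ post (R.obj (op a)) t') : t = t' := by
  refine IsWeightedLimit.hom_ext (K := Vᵒᵖ) h (X := op Y) fun a => ?_
  have e : ∀ t : 𝟙_ V ⟶ EnrichedCategory.Hom (V := V) L Y,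
      cmp (K := Vᵒᵖ) (x := op Y) (y := op L) (z := op (R.obj (op a))) t (p a) =
        (λ_ _).hom ≫ p a ≫ post (R.obj (op a)) t := fun t =>
    (cmp_eq_pre (K := Vᵒᵖ) (x := op Y) (y := op L) (z := op (R.obj (op a))) t (p a)).trans
      (congrArg (fun s => (λ_ _).hom ≫ p a ≫ s) (pre_op (x := Y) (y := L) (z := R.obj (op a)) t))
  exact (e t).trans ((congrArg _ (htt' a)).trans (e t').symm)

/-- The comparison `F * M(x, Q -) ⟶ M(x, m)` for a cocone under `Q` with vertex `m`, as a natural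
transformation in `x`. -/
lemma IsColimitFunctor.exists_comparison (hC : IsColimitFunctor F C η)
    {Q : EnrichedFunctor V Aᵒᵖ M} {m : M} {π : ∀ a, F.obj a ⟶ (Q.obj (op a) ⟶[V] m)}
    (hπ : IsCone (K := Mᵒᵖ) F (opDiagram Q) (op m) π) :
    ∃ t : ∀ x : Mᵒᵖ, 𝟙_ V ⟶ EnrichedCategory.Hom (V := V) (C.obj (Q.comp V (coyon x.unop)))
        (x.unop ⟶[V] m),
      IsNat ((unopDiagram (resYon Q)).comp V C) (coyon (op m)) t ∧
      ∀ x a, η (Q.comp V (coyon x.unop)) a ≫ post _ (t x) =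
        π a ≫ (coyon x.unop).map (Q.obj (op a)) m := by
  have hex : ∀ x : Mᵒᵖ, ∃ t : 𝟙_ V ⟶ EnrichedCategory.Hom (V := V)
      (C.obj (Q.comp V (coyon x.unop))) (x.unop ⟶[V] m),
      ∀ a, η (Q.comp V (coyon x.unop)) a ≫ post (x.unop ⟶[V] Q.obj (op a)) t =
        π a ≫ (coyon x.unop).map (Q.obj (op a)) m := by
    intro x
    obtain ⟨t, ht⟩ := IsWeightedLimit.exists_lift (K := Vᵒᵖ)
      (hC.isWeightedColimit (Q.comp V (coyon x.unop))) (hπ.map (opFunctor (coyon x.unop)))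
    refine ⟨t, fun a => ?_⟩
    exact (congrArg (η (Q.comp V (coyon x.unop)) a ≫ ·) (pre_op (x := x.unop ⟶[V] m)
      (y := C.obj (Q.comp V (coyon x.unop))) (z := x.unop ⟶[V] Q.obj (op a)) t)).symm.trans (ht a)
  choose t ht using hex
  refine ⟨t, ?_, ht⟩
  have h1 : ∀ a, IsNat ((unopDiagram (resYon Q)).comp V (ev (op a)))
      ((unopDiagram (resYon Q)).comp V C) (fun x => η (Q.comp V (coyon x.unop)) a) := fun a =>
    (hC.isNat a).restrict (unopDiagram (resYon Q))
  have h2 : ∀ a, IsNat ((unopDiagram (resYon Q)).comp V (ev (op a))) (coyon (op m))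
      (fun x => π a ≫ (coyon x.unop).map (Q.obj (op a)) m) := by
    intro a
    have h3 := (isNat_swapHom _ _ _).2
      (natFam_precomp (K := Mᵒᵖ) (x := op (Q.obj (op a))) (y := op m) (π a))
    have e : ∀ x : Mᵒᵖ, π a ≫ (coyon x.unop).map (Q.obj (op a)) m =
        swapHom (cmp (K := Mᵒᵖ) (x := op m) (y := op (Q.obj (op a))) (π a)
          (𝟙 (op (Q.obj (op a)) ⟶[V] x))) := fun x => comp_coyon_map_eq_swapHom (π a)
    intro x y
    have e2 := resYon_map_natProj_eq Q y.unop x.unop (op a)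
    exact (congrArg₂ (fun s u => (β_ _ _).hom ≫ cmp s u) e2 (e y)).trans ((h3 x y).trans
      (congrArg (fun u => cmp u ((coyon (op m)).map x y)) (e x)).symm)
  refine isNat_of_jointly_epi h1 (fun a => (h2 a).precomp (λ_ (F.obj a)).hom) (fun x a => ?_)
    fun x y U s s' h => ?_
  · have h3 : ∀ {Y : V} (u : F.obj a ⟶ Y), (ρ_ _).hom ≫ u = (β_ _ _).hom ≫ (λ_ _).hom ≫ u := by
      simp
    exact (cmp_eq_post (η (Q.comp V (coyon x.unop)) a) (t x)).trans
      ((congrArg ((ρ_ _).hom ≫ ·) (ht x a)).trans (h3 _))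
  · refine IsWeightedLimit.hom_ext (K := Vᵒᵖ) (hC.isWeightedColimit (Q.comp V (coyon x.unop)))
      (X := op y) fun a => ?_
    have h3 : ∀ s : U ⟶ EnrichedCategory.Hom (V := V) (C.obj (Q.comp V (coyon x.unop))) y, _ :=
      fun s => cmp_op (x := y) (y := C.obj (Q.comp V (coyon x.unop)))
        (z := x.unop ⟶[V] Q.obj (op a)) s (η (Q.comp V (coyon x.unop)) a)
    exact (h3 s).trans ((congrArg ((β_ _ _).hom ≫ ·) (h a)).trans (h3 s').symm)

/-- A cocone under `Q` with vertex `m` is sent to a colimit by `M(x, -)` if and only if the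
comparison `F * M(x, Q -) ⟶ M(x, m)` is invertible. -/
lemma IsColimitFunctor.isWeightedColimit_iff (hC : IsColimitFunctor F C η)
    {R : EnrichedFunctor V Aᵒᵖ V} {L : V}
    {p : ∀ a, F.obj a ⟶ EnrichedCategory.Hom (V := V) (R.obj (op a)) L}
    {t : 𝟙_ V ⟶ EnrichedCategory.Hom (V := V) (C.obj R) L}
    (ht : ∀ a, η R a ≫ post (R.obj (op a)) t = p a) :
    IsWeightedColimit F R L p ↔ IsIso ((λ_ _).inv ≫ unswap t) := by
  constructor
  · intro h
    obtain ⟨e, e', he, hp⟩ := IsWeightedLimit.exists_invPair (K := Vᵒᵖ) (hC.isWeightedColimit R) h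
    have h1 : e = t := (hC.isWeightedColimit R).hom_ext_post fun a => ((congrArg (η R a ≫ ·)
      (pre_op (x := L) (y := C.obj R) (z := R.obj (op a)) e)).symm.trans (hp a)).trans (ht a).symm
    subst h1
    exact (InvPair.unop he).isIso_unswap
  · intro h
    obtain ⟨t', htt'⟩ := exists_invPair_of_isIso h
    refine IsWeightedLimit.congr (K := Vᵒᵖ) (fun a => ?_)
      (IsWeightedLimit.of_invPair (K := Vᵒᵖ) (hC.isWeightedColimit R) htt'.op)
    exact (congrArg (η R a ≫ ·)
      (pre_op (x := L) (y := C.obj R) (z := R.obj (op a)) t)).trans (ht a)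

end

variable {Φ : Set (Weight.{d} V)}

/-- `Φ`-presentable objects are closed under `Φ`-colimits. -/
lemma PhiPresentable.closure {M : Type w} [EnrichedCategory V M] {G : Set M}
    (hG : ∀ g ∈ G, PhiPresentable Φ g) {x : M} (hx : PhiClosure Φ G x) : PhiPresentable Φ x := by
  intro A _ F hF Q m π hm
  obtain ⟨C, η, hC, hc⟩ := isFlat_iff.1 hF
  obtain ⟨t, hn, ht⟩ := hC.exists_comparison (IsWeightedLimit.isCone (K := Mᵒᵖ) hm)
  refine (hC.isWeightedColimit_iff (ht (op x))).2 ?_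
  induction hx with
  | base x hx =>
    exact (hC.isWeightedColimit_iff (ht (op x))).1 (hG x hx A F hF Q m π hm)
  | colim φ hφ R L ρ hR hL ih =>
    refine isIso_of_preserves hn.natMor (L := op L) hL ?_
      (preservesWeightedLimit_coyon (op m) _ _) fun a => ih (op a)
    exact (preservesWeightedLimit_unopDiagram_resYon Q _ _).comp (hc φ hφ _)

end Presentable

/-! ### Locally presentable categories as categories of continuous functors -/

section Forward

variable [MonoidalClosed V] [SymmetricCategory V] {Φ : Set (Weight.{d} V)}

lemma Cocomplete.hasWeightedLimit {K : Type w} [EnrichedCategory V K] (hK : Cocomplete V K)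
    {A : Type w₁} [EnrichedCategory V A] {F : EnrichedFunctor V A V} (hF : IsSmallWeight F)
    (S : EnrichedFunctor V A Kᵒᵖ) : HasWeightedLimit F S :=
  hasWeightedLimit_of_isSmallWeight hF (fun B _ W S => by
    obtain ⟨L, π, h⟩ := hK B W (unopDiagram S)
    exact ⟨op L, π, h⟩) S

/-- The functor into a full subcategory induced by a functor with values in it. -/
def corestrict {K : Type w₁} {N : Type w₂} [EnrichedCategory V K] [EnrichedCategory V N]
    {p : N → Prop} (P : EnrichedFunctor V K N) (hP : ∀ k, p (P.obj k)) :
    EnrichedFunctor V K (Subtype p) where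
  obj k := ⟨P.obj k, hP k⟩
  map := P.map
  map_id := P.map_id
  map_comp := P.map_comp

lemma isomorphic_subtype {N : Type w₂} [EnrichedCategory V N] {p : N → Prop} {x y : Subtype p}
    (h : Isomorphic V x.1 y.1) : Isomorphic V x y :=
  Isomorphic.of_map (J := incl p) (fun _ _ => inferInstanceAs (IsIso (𝟙 _))) h

variable [HasLimits V]

section

variable {T : Type v} [EnrichedCategory V T] {M : Type w} [EnrichedCategory V M]

/-- The restricted Yoneda functor on a small category of `Φ`-presentable objects preserves
`Φ`-flat colimits. -/
lemma preservesWeightedLimit_resYon (J : EnrichedFunctor V T Mᵒᵖ)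
    (hJ : ∀ t, PhiPresentable Φ (J.obj t).unop) {A : Type v} [EnrichedCategory V A]
    {F : EnrichedFunctor V A V} (hF : IsFlat Φ F) (R : EnrichedFunctor V A Mᵒᵖ) :
    PreservesWeightedLimit (resYon J) F R := by
  intro m π hm
  refine isWeightedColimit_of_pointwise fun t => ?_
  have h1 := hJ t A F hF (unopDiagram R) m.unop π hm
  have e : ∀ x y : Mᵒᵖ, (resYon J).map x y ≫ natProj (J.comp V (coyon y)) (J.comp V (coyon x)) t =
      (coyon (J.obj t).unop).map y.unop x.unop := by
    intro x y
    refine (resYon_map_natProj_eq J x y t).trans ?_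
    refine congrArg MonoidalClosed.curry
      ((eComp_op_eq V (op x) (op y) (op (J.obj t))).trans ?_)
    refine (congrArg ((β_ _ _).hom ≫ ·) (eComp_op_eq V (J.obj t) y x)).trans ?_
    exact SymmetricCategory.symmetry_assoc _ _ _
  refine IsWeightedLimit.congr (fun a => ?_) (h1.congr_map fun a b => ?_)
  · exact (congrArg (π a ≫ ·) (e m (R.obj a))).symm.trans (Category.assoc _ _ _).symm
  · exact (congrArg (R.map a b ≫ ·) (e (R.obj a) (R.obj b))).symm.trans
      (Category.assoc _ _ _).symm

/-- If every object is a `Φ`-flat colimit of objects in the image of `J`, and these are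
`Φ`-presentable, then the restricted Yoneda functor of `J` is fully faithful. -/
lemma isIso_resYon_map_of_flat (J : EnrichedFunctor V T Mᵒᵖ) [hJ : ∀ s t, IsIso (J.map s t)]
    (hp : ∀ t, PhiPresentable Φ (J.obj t).unop)
    (hm : ∀ m : M, ∃ (A : Type v) (_ : EnrichedCategory V A) (F : EnrichedFunctor V A V)
      (R : EnrichedFunctor V Aᵒᵖ M) (π : ∀ a, F.obj a ⟶ (R.obj (op a) ⟶[V] m)),
      IsFlat Φ F ∧ (∀ a, ∃ t, (J.obj t).unop = R.obj a) ∧ IsWeightedColimit F R m π)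
    (x y : Mᵒᵖ) : IsIso ((resYon J).map x y) := by
  obtain ⟨A, _, F, R, π, hF, hR, hL⟩ := hm y.unop
  refine isIso_of_preserves (natMor_map (resYon J) x) hL
    (preservesWeightedLimit_coyon x _ _)
    ((preservesWeightedLimit_resYon J hp hF _).comp (preservesWeightedLimit_coyon _ _ _))
    fun a => ?_
  obtain ⟨t, ht⟩ := hR (op a)
  have h1 : (opDiagram R).obj a = J.obj t := (congrArg op ht).symm
  rw [h1]
  exact isIso_resYon_map J t x

/-- A presheaf which is a weight of an existing colimit of `J` lies in the image of the restricted
Yoneda functor, provided that the latter preserves this colimit. -/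
lemma exists_isomorphic_resYon (J : EnrichedFunctor V T Mᵒᵖ) [hJ : ∀ s t, IsIso (J.map s t)]
    {X : EnrichedFunctor V T V} (h : HasWeightedLimit X J)
    (hp : PreservesWeightedLimit (resYon J) X J) :
    ∃ m : Mᵒᵖ, Isomorphic V ((resYon J).obj m).unop X := by
  obtain ⟨m, π, hm⟩ := h
  obtain ⟨e, e', he, -⟩ := (hp m π hm).exists_invPair (isWeightedLimit_yoneda J X)
  exact ⟨m, Isomorphic.unop (isomorphic_iff.2 ⟨e', e, he.symm⟩)⟩

end

/-- A locally `Φ`-presentable category is equivalent to the category of `Φ`-continuous functors on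
the opposite of a small full subcategory of `Φ`-presentable objects closed under `Φ`-colimits. -/
lemma LocallyPhiPresentable.exists_equivalent (hΦ : PhiLocallySmall.{d, w} Φ) (hA : AxiomA Φ)
    {M : Type w} [EnrichedCategory V M] (hM : LocallyPhiPresentable Φ M) :
    ∃ (T : Type v) (_ : EnrichedCategory V T), PhiComplete Φ T ∧ Equivalent V M (Cts Φ T) := by
  obtain ⟨hcoc, G, hG, hGp, hflat⟩ := hM
  obtain ⟨S, s, hs, hs'⟩ := (hΦ.2 M hcoc G hG).exists_family
  -- The generators are added to the family, so that the given flat colimits are diagrams in it.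
  let f : Shrink.{v} G ⊕ S → M := Sum.elim (fun g => ((equivShrink G).symm g).1) s
  have hf : ∀ i, PhiClosure Φ G (f i) := by
    rintro (g | i)
    · exact PhiClosure.base _ ((equivShrink G).symm g).2
    · exact hs i
  have hf' : ∀ x, PhiClosure Φ G x → ∃ i, Isomorphic V x (f i) := fun x hx =>
    let ⟨i, hi⟩ := hs' x hx
    ⟨Sum.inr i, hi⟩
  have hfG : ∀ g ∈ G, ∃ i, f i = g := fun g hg =>
    ⟨Sum.inl (equivShrink G ⟨g, hg⟩), by simp [f]⟩
  let _ := inducedEnriched (V := V) (fun i => op (f i))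
  obtain ⟨hT, hJc⟩ := phiComplete_of_closure (Φ := Φ)
    (fun φ _ S => hcoc.hasWeightedLimit φ.isSmall S) f hf hf'
  let J := inducedFunctor (V := V) (fun i => op (f i))
  have hJ : ∀ x y, IsIso (J.map x y) := fun x y => inferInstanceAs (IsIso (𝟙 _))
  have hp : ∀ i, PhiPresentable Φ (J.obj i).unop := fun i => PhiPresentable.closure hGp (hf i)
  have hff := isIso_resYon_map_of_flat J hp fun m => by
    obtain ⟨A, i, F, R, π, hF, hR, hL⟩ := hflat m
    exact ⟨A, i, F, R, π, hF, fun a => hfG _ (hR a), hL⟩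
  refine ⟨_, _, hT, corestrict (unopFunctor (resYon J)) fun m => ?_, fun x y => ?_, fun X => ?_⟩
  · exact PhiContinuous.comp hJc (phiContinuous_coyon _)
  · exact hff (op y) (op x)
  · obtain ⟨L, π, hL⟩ := hcoc _ X.1 (unopDiagram J)
    obtain ⟨m, hm⟩ := exists_isomorphic_resYon J ⟨op L, π, hL⟩
      (preservesWeightedLimit_resYon J hp (hA _ hT X.1 X.2) J)
    exact ⟨m.unop, isomorphic_subtype hm⟩

end Forward

/-! ### Local smallness for covariant presheaves -/

section DoubleOpposite

variable [SymmetricCategory V] [MonoidalClosed V]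

/-- The canonical isomorphism onto the double opposite. -/
def opOp {K : Type w} [EnrichedCategory V K] : EnrichedFunctor V K Kᵒᵖᵒᵖ where
  obj x := op (op x)
  map x y := 𝟙 (x ⟶[V] y)
  map_id x := Category.comp_id _
  map_comp x y z := by
    have h : eComp V x y z = eComp V (op (op x)) (op (op y)) (op (op z)) := by
      rw [eComp_op_eq, eComp_op_eq]
      exact (SymmetricCategory.symmetry_assoc _ _ _).symm
    have h' : eComp V (op (op x)) (op (op y)) (op (op z)) =
        (𝟙 _ ⊗ₘ 𝟙 _) ≫ eComp V (op (op x)) (op (op y)) (op (op z)) := by simp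
    exact (Category.comp_id _).trans (h.trans h')

/-- Equality of `V`-functors with definitionally equal actions on objects. -/
lemma enrichedFunctor_mk_congr {A : Type w₁} {K : Type w₂} [EnrichedCategory V A]
    [EnrichedCategory V K] {o : A → K} {m m' : ∀ a b : A, (a ⟶[V] b) ⟶ (o a ⟶[V] o b)}
    {h₁ h₂ h₁' h₂'} (h : ∀ a b, m a b = m' a b) :
    (⟨o, m, h₁, h₂⟩ : EnrichedFunctor V A K) = ⟨o, m', h₁', h₂'⟩ := by
  obtain rfl : m = m' := funext fun a => funext (h a)
  rfl

/-- A fully faithful functor which is surjective on objects preserves all weighted limits. -/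
lemma preservesWeightedLimit_of_surjective {A : Type w₁} {K : Type w₂} {N : Type w₃}
    [EnrichedCategory V A] [EnrichedCategory V K] [EnrichedCategory V N]
    {J : EnrichedFunctor V K N} (hJ : ∀ x y, IsIso (J.map x y)) (hs : ∀ n, ∃ k, J.obj k = n)
    (F : EnrichedFunctor V A V) (S : EnrichedFunctor V A K) : PreservesWeightedLimit J F S := by
  refine fun L π h => isWeightedLimit_iff.2 ⟨h.isCone.map J, fun n => ?_⟩
  obtain ⟨k, rfl⟩ := hs n
  exact (isLimAt_map_iff hJ).2 (h.isLimAt k)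

variable [HasLimits V] {T : Type v} [EnrichedCategory V T]

/-- Restriction of presheaves along the canonical isomorphism from the double opposite. -/
def restrictUnopUnop :
    EnrichedFunctor V (EnrichedFunctor V T V) (EnrichedFunctor V Tᵒᵖᵒᵖ V) where
  obj X := unopUnop.comp V X
  map X Y := natLift (F := unopUnop.comp V X) (G := unopUnop.comp V Y) _
    ((isNat_natProj X Y).restrict unopUnop)
  map_id X := natHom_ext fun b => by
    rw [Category.assoc]
    refine (congrArg (eId V X ≫ ·) (natLift_proj (F := unopUnop.comp V X)
      (G := unopUnop.comp V X) _ ((isNat_natProj X X).restrict unopUnop) b)).trans ?_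
    exact (eId_natProj X b.unop.unop).trans (eId_natProj (unopUnop.comp V X) b).symm
  map_comp X Y Z := natHom_ext fun b => by
    have h : ∀ X Y : EnrichedFunctor V T V, _ := fun X Y =>
      natLift_proj (F := unopUnop.comp V X) (G := unopUnop.comp V Y) _
        ((isNat_natProj X Y).restrict unopUnop) b
    rw [Category.assoc]
    refine (congrArg (eComp V X Y Z ≫ ·) (h X Z)).trans ?_
    refine ((ev b.unop.unop).map_comp X Y Z).trans ?_
    refine Eq.trans ?_ (cmp_natProj (F := unopUnop.comp V X) (G := unopUnop.comp V Y)
      (H := unopUnop.comp V Z) _ _ b).symm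
    exact (congrArg₂ (fun s t => cmp (x := X.obj b.unop.unop) (y := Y.obj b.unop.unop)
      (z := Z.obj b.unop.unop) s t) (h X Y) (h Y Z)).symm

lemma restrictUnopUnop_map_natProj (X Y : EnrichedFunctor V T V) (b : Tᵒᵖᵒᵖ) :
    restrictUnopUnop.map X Y ≫ natProj (unopUnop.comp V X) (unopUnop.comp V Y) b =
      natProj X Y b.unop.unop :=
  natLift_proj (F := unopUnop.comp V X) (G := unopUnop.comp V Y) _
    ((isNat_natProj X Y).restrict unopUnop) b

lemma isIso_restrictUnopUnop_map (X Y : EnrichedFunctor V T V) :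
    IsIso (restrictUnopUnop.map X Y) := by
  have hn : IsNat X Y (fun t => natProj (unopUnop.comp V X) (unopUnop.comp V Y) (op (op t))) := by
    intro s t
    have h := isNat_natProj (unopUnop.comp V X) (unopUnop.comp V Y) (op (op s)) (op (op t))
    have e : ∀ Z : EnrichedFunctor V T V,
      (unopUnop.comp V Z).map (op (op s)) (op (op t)) = Z.map s t := fun Z => Category.id_comp _
    exact (congrArg (fun u => (β_ _ _).hom ≫ cmp u (natProj (unopUnop.comp V X)
      (unopUnop.comp V Y) (op (op t)))) (e X)).symm.trans
      (h.trans (congrArg (fun u => cmp (natProj (unopUnop.comp V X) (unopUnop.comp V Y)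
        (op (op s))) u) (e Y)))
  refine ⟨natLift _ hn, natHom_ext fun t => ?_, natHom_ext fun b => ?_⟩
  · refine (Category.assoc _ _ _).trans ?_
    refine (congrArg (restrictUnopUnop.map X Y ≫ ·) (natLift_proj _ hn t)).trans ?_
    exact (restrictUnopUnop_map_natProj X Y (op (op t))).trans (Category.id_comp _).symm
  · refine (Category.assoc _ _ _).trans ?_
    refine (congrArg (natLift _ hn ≫ ·) (restrictUnopUnop_map_natProj X Y b)).trans ?_
    exact (natLift_proj _ hn b.unop.unop).trans (Category.id_comp _).symm

lemma restrictUnopUnop_surjective (W : EnrichedFunctor V Tᵒᵖᵒᵖ V) :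
    ∃ X, restrictUnopUnop.obj X = W :=
  ⟨opOp.comp V W, enrichedFunctor_mk_congr fun _ _ =>
    (Category.id_comp _).trans (Category.id_comp _)⟩

lemma restrictUnopUnop_coyon (t : T) :
    restrictUnopUnop.obj ((EnrichedFunctor.id V T).comp V (coyon t)) = coyon (op (op t)) := by
  refine enrichedFunctor_mk_congr fun a b => (Category.id_comp _).trans
    ((Category.id_comp _).trans ?_)
  refine congrArg MonoidalClosed.curry ?_
  rw [eComp_op_eq, eComp_op_eq]
  exact (SymmetricCategory.symmetry_assoc _ _ _).symm

variable {Φ : Set (Weight.{d} V)}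

/-- Local smallness for the covariant representables in `[T, V]`. The hypothesis on presheaf
categories concerns `[Tᵒᵖᵒᵖ, V]`, which is isomorphic to `[T, V]` but not definitionally equal to
it. -/
lemma PhiLocallySmall.isEssentiallySmall_closure (hΦ : PhiLocallySmall.{d, w} Φ) (T : Type v)
    [EnrichedCategory V T] : IsEssentiallySmall V (PhiClosure Φ (Set.range fun t : T =>
      (EnrichedFunctor.id V T).comp V (coyon t))) := by
  obtain ⟨S, hS, h⟩ := hΦ.1 Tᵒᵖ
  have key : ∀ X, PhiClosure Φ (Set.range fun t : T => (EnrichedFunctor.id V T).comp V (coyon t)) X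
      → PhiClosure Φ (Set.range fun a : Tᵒᵖ => (coyon (op a) : EnrichedFunctor V Tᵒᵖᵒᵖ V))
        (restrictUnopUnop.obj X) := by
    intro X hX
    induction hX with
    | base X hX =>
      obtain ⟨t, rfl⟩ := hX
      exact PhiClosure.base _ ⟨op t, (restrictUnopUnop_coyon t).symm⟩
    | colim φ hφ R L π hR hL ih =>
      exact PhiClosure.colim φ hφ (R.comp V restrictUnopUnop) _ _ ih
        (preservesWeightedLimit_of_surjective (J := opFunctor restrictUnopUnop)
          (fun X Y => isIso_restrictUnopUnop_map Y.unop X.unop)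
          (fun W => let ⟨X, hX⟩ := restrictUnopUnop_surjective W.unop; ⟨op X, congrArg op hX⟩)
          φ.functor (opDiagram R) (op L) π hL)
  classical
  let p : S → Prop := fun y => ∃ X, PhiClosure Φ
    (Set.range fun t : T => (EnrichedFunctor.id V T).comp V (coyon t)) X ∧
      Isomorphic V (restrictUnopUnop.obj X) y.1
  choose g _ hg using fun y : {y : S // p y} => y.2
  refine ⟨Set.range g, inferInstance, fun X hX => ?_⟩
  obtain ⟨y, hy, hXy⟩ := h _ (key X hX)
  exact ⟨_, ⟨⟨⟨y, hy⟩, X, hX, hXy⟩, rfl⟩,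
    Isomorphic.of_map isIso_restrictUnopUnop_map (hXy.trans (hg ⟨⟨y, hy⟩, X, hX, hXy⟩).symm)⟩

end DoubleOpposite

/-! ### Invariance under natural isomorphism -/

section NaturalIsomorphisms

variable [MonoidalClosed V] [SymmetricCategory V] {A : Type w₁} {K : Type w₂} {N : Type w₃}
  [EnrichedCategory V A] [EnrichedCategory V K] [EnrichedCategory V N]

lemma NatMor.comp {F G H : EnrichedFunctor V A V} {κ : ∀ a, F.obj a ⟶ G.obj a}
    {μ : ∀ a, G.obj a ⟶ H.obj a} (hκ : NatMor F G κ) (hμ : NatMor G H μ) :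
    NatMor F H (fun a => κ a ≫ μ a) := by
  intro a b
  dsimp only
  rw [comp_whiskerRight, Category.assoc, ← hμ, ← Category.assoc, hκ, Category.assoc]

lemma natMor_pre {x y : K} (e : 𝟙_ V ⟶ (x ⟶[V] y)) :
    NatMor (coyon y) (coyon x) (fun z => pre e z) := by
  intro a b
  rw [act_coyon, act_coyon]
  suffices H : eComp V y a b ≫ pre e b = pre e a ▷ (a ⟶[V] b) ≫ eComp V x a b from H
  have h := cmp_comp_pre e (𝟙 (y ⟶[V] a)) (𝟙 (a ⟶[V] b))
  simpa [cmp] using h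

lemma NatMor.isNat₁ {F G : EnrichedFunctor V A V} {κ : ∀ a, F.obj a ⟶ G.obj a}
    (hκ : NatMor F G κ) : IsNat₁ F G (fun a => swapHom ((λ_ (F.obj a)).hom ≫ κ a)) :=
  ((isNat_swapHom F G _).2 ((NatFam.id F).postcomp hκ)).isNat₁

lemma exists_invPair_swapHom {X Y : V} (f : X ⟶ Y) [hf : IsIso f] :
    ∃ e', InvPair (swapHom ((λ_ X).hom ≫ f)) e' :=
  exists_invPair_of_isIso (by rwa [unswap_swapHom, Iso.inv_hom_id_assoc])

lemma IsNat₁.op {P Q : EnrichedFunctor V K N} {η : ∀ x, 𝟙_ V ⟶ (P.obj x ⟶[V] Q.obj x)}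
    (h : IsNat₁ P Q η) : IsNat₁ (opFunctor Q) (opFunctor P) (fun x => η x.unop) := by
  intro x y
  exact (congrArg (Q.map y.unop x.unop ≫ ·) (post_op (x := Q.obj x.unop) (y := Q.obj y.unop)
    (z := P.obj y.unop) (η y.unop))).trans ((h y.unop x.unop).symm.trans
      (congrArg (P.map y.unop x.unop ≫ ·) (pre_op (x := Q.obj x.unop) (y := P.obj x.unop)
        (z := P.obj y.unop) (η x.unop)).symm))

lemma PreservesWeightedLimit.of_natMor {P Q : EnrichedFunctor V K V}
    {κ : ∀ x, Q.obj x ⟶ P.obj x} (hκ : NatMor Q P κ) (hi : ∀ x, IsIso (κ x))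
    {F : EnrichedFunctor V A V} {S : EnrichedFunctor V A K} (h : PreservesWeightedLimit P F S) :
    PreservesWeightedLimit Q F S :=
  h.of_natIso hκ.isNat₁ fun X x => (exists_invPair_swapHom (κ x)).choose_spec.isIso_post X

lemma PreservesWeightedLimit.op_of_natMor {P Q : EnrichedFunctor V K V}
    {κ : ∀ x, P.obj x ⟶ Q.obj x} (hκ : NatMor P Q κ) (hi : ∀ x, IsIso (κ x))
    {F : EnrichedFunctor V A V} {S : EnrichedFunctor V A Kᵒᵖ}
    (h : PreservesWeightedLimit (opFunctor P) F S) : PreservesWeightedLimit (opFunctor Q) F S :=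
  h.of_natIso hκ.isNat₁.op fun X x =>
    (exists_invPair_swapHom (κ x.unop)).choose_spec.op.isIso_post X

/-- Limits of isomorphic diagrams coincide. -/
lemma IsWeightedLimit.of_diagram {F : EnrichedFunctor V A V} {S S' : EnrichedFunctor V A K} {L : K}
    {π : ∀ a, F.obj a ⟶ (L ⟶[V] S.obj a)} (h : IsWeightedLimit F S L π)
    {η : ∀ a, 𝟙_ V ⟶ (S.obj a ⟶[V] S'.obj a)} {η' : ∀ a, 𝟙_ V ⟶ (S'.obj a ⟶[V] S.obj a)}
    (hη : IsNat₁ S S' η) (hi : ∀ a, InvPair (η a) (η' a)) :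
    IsWeightedLimit F S' L (fun a => π a ≫ PhiTheory.post L (η a)) := by
  refine isWeightedLimit_iff.2 ⟨h.isCone.post hη, fun X => (h.isLimAt X).of_isIso_post
    (hη.inv hi) (fun a => (hi a).symm.isIso_post X) h.isCone (ε := eId V L) (fun a => ?_)
    (by rw [post_eId]; infer_instance)⟩
  rw [pre_eId, Category.assoc, ← post_comp, (hi a).left, post_eId]

/-- Limits as seen by `X` are those sent to limits by the functor represented by `X`. -/
lemma IsLimAt.of_coyon {X : K} {F : EnrichedFunctor V A V} {S : EnrichedFunctor V A K} {L : K}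
    {π : ∀ a, F.obj a ⟶ (L ⟶[V] S.obj a)}
    (h : IsWeightedLimit F (S.comp V (coyon X)) (X ⟶[V] L)
      (fun a => π a ≫ (coyon X).map L (S.obj a))) : IsLimAt X F S L π := by
  have key : ∀ a, MonoidalClosed.uncurry (π a ≫ (coyon X).map L (S.obj a)) =
      cmp (𝟙 (X ⟶[V] L)) (π a) := fun a => by
    rw [uncurry_comp_map, act_coyon, cmp, MonoidalCategory.id_tensorHom]
    rfl
  have h1 := isWeightedLimit_self_iff.1 h
  have h2 : IsEnd F (S.comp V (coyon X)) (X ⟶[V] L) (fun a => cmp (𝟙 (X ⟶[V] L)) (π a)) := by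
    rw [← funext key]
    exact h1
  exact (isEnd_coyon_iff.1 h2).2

lemma Isomorphic.map {x y : K} (h : Isomorphic V x y) (P : EnrichedFunctor V K N) :
    Isomorphic V (P.obj x) (P.obj y) := by
  obtain ⟨e, e', he⟩ := isomorphic_iff.1 h
  exact isomorphic_iff.2 ⟨_, _, he.map P⟩

end NaturalIsomorphisms

/-! ### Reflectivity of continuous functors -/

section Reflection

variable [MonoidalClosed V] [SymmetricCategory V] [HasLimits V]
variable {T : Type v} [EnrichedCategory V T]

/-- The Yoneda embedding, as a covariant functor to the opposite of `[T, V]`. -/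
abbrev yon (T : Type v) [EnrichedCategory V T] :
    EnrichedFunctor V T (EnrichedFunctor V T V)ᵒᵖ :=
  (EnrichedFunctor.id V T).comp V (resYon (EnrichedFunctor.id V T))

instance isIso_id_map (a b : T) : IsIso ((EnrichedFunctor.id V T).map a b) :=
  inferInstanceAs (IsIso (𝟙 _))

instance isIso_yon_map (a b : T) : IsIso ((yon (V := V) T).map a b) :=
  IsIso.comp_isIso' (isIso_id_map a b) (isIso_resYon_map (EnrichedFunctor.id V T) b a)

/-- Functor categories are cocomplete, with pointwise colimits. -/
lemma cocomplete_functorCategory [HasColimits V] : Cocomplete V (EnrichedFunctor V T V) := by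
  intro A _ F R
  obtain ⟨C, η, hC⟩ := exists_isColimitFunctor F
  obtain ⟨π, hπ, -⟩ := hC.exists_pointwiseColimit (opDiagram R)
  exact ⟨_, π, hπ⟩

variable {Φ : Set (Weight.{d} V)}

lemma phiContinuous_yon (t : T) : PhiContinuous Φ ((yon (V := V) T).obj t).unop :=
  PhiContinuous.comp (P := EnrichedFunctor.id V T) (fun _ _ _ =>
    preservesWeightedLimit_of_surjective (fun _ _ => inferInstance) (fun n => ⟨n, rfl⟩) _ _)
    (phiContinuous_coyon t)

variable (Φ) in
/-- An arrow of `[T, V]ᵒᵖ` is orthogonal if the `Φ`-continuous functors see it as invertible. -/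
def IsOrthogonal {x y : (EnrichedFunctor V T V)ᵒᵖ} (e : 𝟙_ V ⟶ (x ⟶[V] y)) : Prop :=
  ∀ H : EnrichedFunctor V T V, PhiContinuous Φ H → IsIso (post (op H) e)

section

variable {E : Type w} [EnrichedCategory V E] (S : EnrichedFunctor V E (EnrichedFunctor V T V)ᵒᵖ)
  (t : E → T) (ε : ∀ e, 𝟙_ V ⟶ ((yon (V := V) T).obj (t e) ⟶[V] S.obj e))
  (hε : ∀ e, IsOrthogonal Φ (ε e))

/-- The functor representing a diagram whose objects are seen by the `Φ`-continuous functors as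
representables. -/
def represent : EnrichedFunctor V E T :=
  coreflect S (yon T) t ε fun x e =>
    IsIso.comp_isIso' (isIso_yon_map x (t e)) (hε e _ (phiContinuous_yon x))

lemma represent_isNat₁ : IsNat₁ ((represent S t ε hε).comp V (yon T)) S ε :=
  coreflect_isNat₁ S (yon T) t ε _

end

/-- The Yoneda embedding sends `Φ`-limits to limits as seen by a `Φ`-continuous functor. -/
lemma isLimAt_yon {H : EnrichedFunctor V T V} (hH : PhiContinuous Φ H) {φ : Weight.{d} V}
    (hφ : φ ∈ Φ) {S : EnrichedFunctor V φ.dom T} {L : T}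
    {π : ∀ a, φ.functor.obj a ⟶ (L ⟶[V] S.obj a)} (hL : IsWeightedLimit φ.functor S L π) :
    IsLimAt (op H) φ.functor (S.comp V (yon T)) ((yon T).obj L)
      (fun a => π a ≫ (yon T).map L (S.obj a)) := by
  have h1 := (hH φ hφ S).of_natMor (yonedaMap_natMor_obj (EnrichedFunctor.id V T) H)
    (fun t => isIso_yonedaMap (EnrichedFunctor.id V T) t H)
  refine IsLimAt.of_coyon ((IsWeightedLimit.congr (fun a => ?_) (h1 L π hL)).congr_map
    fun a b => (Category.assoc _ _ _).symm)
  exact (Category.assoc _ _ _).symm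

/-- Every object of the closure of the representables under `Φ`-colimits is seen by the
`Φ`-continuous functors as a representable. -/
lemma PhiClosure.exists_isOrthogonal (hT : PhiComplete Φ T) {X : EnrichedFunctor V T V}
    (hX : PhiClosure Φ (Set.range fun t : T => (EnrichedFunctor.id V T).comp V (coyon t)) X) :
    ∃ (t : T) (e : 𝟙_ V ⟶ ((yon T).obj t ⟶[V] op X)), IsOrthogonal Φ e := by
  induction hX with
  | base X hX =>
    obtain ⟨t, rfl⟩ := hX
    refine ⟨t, eId V ((yon T).obj t), fun H _ => ?_⟩
    suffices h : IsIso (post (op H) (eId V ((yon T).obj t))) from h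
    rw [post_eId]
    exact IsIso.id _
  | colim φ hφ R L π hR hL ih =>
    choose t ε hε using ih
    have hQ := represent_isNat₁ (opDiagram R) (fun a => t (op a)) (fun a => ε (op a))
      (fun a => hε (op a))
    obtain ⟨L', π', hL'⟩ := hT φ hφ (represent (opDiagram R) (fun a => t (op a))
      (fun a => ε (op a)) (fun a => hε (op a)))
    obtain ⟨e, he⟩ := IsWeightedLimit.exists_lift (K := (EnrichedFunctor V T V)ᵒᵖ) hL
      ((hL'.isCone.map (yon T)).post hQ)
    refine ⟨L', e, fun H hH => ?_⟩
    exact IsLimAt.isIso_post hQ (fun a => hε (op a) H hH) (IsWeightedLimit.isCone hL)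
      (hL'.isCone.map (yon T)) (fun a => (he a).symm) (IsWeightedLimit.isLimAt hL (op H))
      (isLimAt_yon hH hφ hL')

/-- The `Φ`-continuous functors are reflective in `[T, V]`. Let `D` be the closure of the
representables under `Φ`-colimits. Every `W` is the colimit of `D` weighted by `[T, V](-, W)`, which is a
flat weight, and continuous functors do not distinguish this colimit from the one in which every
object of `D` is replaced by the representable that they see it as. The latter is a flat colimit of
representables, hence continuous. -/
lemma PhiComplete.exists_reflection [HasColimits V] (hΦ : PhiLocallySmall.{d, w} Φ)
    (hA : AxiomA Φ) (hT : PhiComplete Φ T) (W : EnrichedFunctor V T V) :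
    ∃ (G : EnrichedFunctor V T V) (e : 𝟙_ V ⟶ (op G ⟶[V] op W)),
      PhiContinuous Φ G ∧ IsOrthogonal Φ e := by
  obtain ⟨S, s, hs, hs'⟩ := (hΦ.isEssentiallySmall_closure T).exists_family
  -- The representables are added to the family, so that the Yoneda embedding factors strictly.
  let f : T ⊕ S → EnrichedFunctor V T V := Sum.elim (fun t => ((yon T).obj t).unop) s
  have hf : ∀ i, PhiClosure Φ
      (Set.range fun t : T => (EnrichedFunctor.id V T).comp V (coyon t)) (f i) := by
    rintro (t | i)
    · exact PhiClosure.base _ ⟨t, rfl⟩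
    · exact hs i
  let _ := inducedEnriched (V := V) (fun i => op (f i))
  obtain ⟨hD, hjc⟩ := phiComplete_of_closure (Φ := Φ)
    (fun φ _ S => cocomplete_functorCategory.hasWeightedLimit φ.isSmall S) f hf
    (fun x hx => (hs' x hx).imp' Sum.inr fun _ h => h)
  let j := inducedFunctor (V := V) (fun i => op (f i))
  let k : EnrichedFunctor V T (T ⊕ S) :=
    ⟨Sum.inl, (yon T).map, (yon T).map_id, (yon T).map_comp⟩
  have hk : k.comp V j = yon T := enrichedFunctor_mk_congr fun _ _ => Category.comp_id _
  have hj : IsDense j := IsDense.of_comp (k := k) (fun _ _ => inferInstanceAs (IsIso (𝟙 _)))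
    (hk ▸ isDense_resYon (EnrichedFunctor.id V T))
  choose t ε hε using fun i => (hf i).exists_isOrthogonal hT
  have hr := represent_isNat₁ j t ε hε
  obtain ⟨G, π, hG, -, hGc⟩ := (hA _ hD (j.comp V (coyon (op W)))
    (PhiContinuous.comp hjc (phiContinuous_coyon _))).exists_pointwiseColimit
      ((represent j t ε hε).comp V (yon T)) (fun i => phiContinuous_yon (t i))
  obtain ⟨e, he⟩ := (hj (op W)).exists_lift (hG.isCone.post hr)
  exact ⟨G, e, hGc, fun H hH => IsLimAt.isIso_post hr (fun i => hε i H hH) (hj (op W)).isCone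
    hG.isCone (fun i => (he i).symm) ((hj (op W)).isLimAt _) (hG.isLimAt _)⟩

end Reflection

/-! ### Categories of continuous functors are locally presentable -/

section Backward

variable [MonoidalClosed V] [SymmetricCategory V] [HasLimits V]
variable {T : Type v} [EnrichedCategory V T] {M : Type w} [EnrichedCategory V M]
  {Φ : Set (Weight.{d} V)}

lemma exists_comp_eq {X Y Z : V} {f : X ⟶ Y} (hf : IsIso f) (g : Z ⟶ Y) : ∃ q, q ≫ f = g :=
  ⟨g ≫ inv f, by simp⟩

section

variable {P : EnrichedFunctor V M (EnrichedFunctor V T V)} (hP : ∀ x y, IsIso (P.map x y))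
  (hPc : ∀ m, PhiContinuous Φ (P.obj m))

include hP hPc

/-- A full subcategory of `[T, V]` consisting of `Φ`-continuous functors is cocomplete as soon as
every object of `[T, V]` has a reflection in it. -/
lemma cocomplete_of_reflection [HasColimits V]
    (h : ∀ W, ∃ (m : M) (e : 𝟙_ V ⟶ (op (P.obj m) ⟶[V] op W)), IsOrthogonal Φ e) :
    Cocomplete V M := by
  intro A _ F R
  let P' := opFunctor P
  have hP' : ∀ x y, IsIso (P'.map x y) := fun x y => hP y.unop x.unop
  obtain ⟨W, π, hW⟩ := cocomplete_functorCategory (V := V) (T := T) A F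
    (unopDiagram ((opDiagram R).comp V P'))
  replace hW : IsWeightedLimit F ((opDiagram R).comp V P') (op W) π := hW
  obtain ⟨m, e, he⟩ := h W
  have hex : ∀ a, ∃ q : F.obj a ⟶ (op m ⟶[V] (opDiagram R).obj a),
      q ≫ P'.map (op m) ((opDiagram R).obj a) = π a ≫ pre e (P'.obj ((opDiagram R).obj a)) :=
    fun a => exists_comp_eq (hP' (op m) ((opDiagram R).obj a)) _
  choose q key using hex
  refine ⟨m, q, isWeightedLimit_iff.2
    ⟨(isCone_map_iff hP').1 ?_, fun X => (isLimAt_map_iff hP').1 ?_⟩⟩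
  · have h1 := hW.isCone.pre e
    exact (congrArg (fun ρ => IsCone F ((opDiagram R).comp V P') (P'.obj (op m)) ρ)
      (funext key)).mpr h1
  · have h1 := IsLimAt.of_isIso_post (X := P'.obj X) (ε := e)
      (π' := fun a => π a ≫ pre e (P'.obj ((opDiagram R).obj a))) (IsNat₁.id _)
      (fun a => by rw [post_eId]; infer_instance) hW.isCone
      (fun a => by rw [post_eId, Category.comp_id]; rfl) (hW.isLimAt (P'.obj X))
      (he _ (hPc X.unop))
    exact (congrArg (fun ρ => IsLimAt (P'.obj X) F ((opDiagram R).comp V P') (P'.obj (op m)) ρ)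
      (funext key)).mpr h1

variable (hPs : ∀ G, PhiContinuous Φ G → ∃ m, Isomorphic V (P.obj m) G)

include hPs

/-- The inclusion of the `Φ`-continuous functors in `[T, V]` preserves `Φ`-flat colimits, which are
therefore pointwise. -/
lemma preservesWeightedLimit_ev_of_isFlat {A : Type v} [EnrichedCategory V A]
    {F : EnrichedFunctor V A V} (hF : IsFlat Φ F) (S : EnrichedFunctor V A Mᵒᵖ) (t : T) :
    PreservesWeightedLimit (opFunctor (P.comp V (ev t))) F S := by
  let P' := opFunctor P
  have hP' : ∀ x y, IsIso (P'.map x y) := fun x y => hP y.unop x.unop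
  obtain ⟨G, π, hG, ht, hGc⟩ := hF.exists_pointwiseColimit (S.comp V P')
    fun a => hPc (S.obj a).unop
  obtain ⟨m, hm⟩ := hPs G hGc
  obtain ⟨ρ, hρ, hρ'⟩ := hG.exists_of_fullyFaithful hP' (L := op m) hm.symm.op.symm
  exact (PreservesWeightedLimit.of_isWeightedLimit hρ hρ').comp (ht t)

/-- The objects corresponding to the representables are `Φ`-presentable. -/
lemma phiPresentable_of_isomorphic {m : M} {t : T}
    (hm : Isomorphic V (P.obj m) ((yon T).obj t).unop) : PhiPresentable Φ m := by
  obtain ⟨e, e', he⟩ := isomorphic_iff.1 hm.symm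
  have h1 : NatMor (coyon m) (P.comp V (ev t)) (fun x => P.map m x ≫ pre e (P.obj x) ≫
      yonedaMap (EnrichedFunctor.id V T) t (P.obj x)) :=
    (natMor_map P m).comp (((natMor_pre e).restrict P).comp
      ((yonedaMap_natMor (EnrichedFunctor.id V T) t).restrict P))
  have hi : ∀ x, IsIso (P.map m x ≫ pre e (P.obj x) ≫
      yonedaMap (EnrichedFunctor.id V T) t (P.obj x)) := fun x =>
    IsIso.comp_isIso' (hP m x) (IsIso.comp_isIso' (he.isIso_pre _) (isIso_yonedaMap _ _ _))
  intro A _ F hF R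
  have h2 := (preservesWeightedLimit_ev_of_isFlat hP hPc hPs hF (opDiagram R) t).op_of_natMor
    (h1.inv hi) (fun x => @IsIso.inv_isIso _ _ _ _ _ (hi x))
  exact fun L π hL => h2 (op L) π hL

/-- Every object is a `Φ`-flat colimit of the objects corresponding to the representables: a
`Φ`-continuous functor is flat, and it is the colimit of the representables weighted by itself. -/
lemma exists_isFlat_weightedColimit (hA : AxiomA Φ) (hT : PhiComplete Φ T) {g : T → M}
    (hg : ∀ t, Isomorphic V (P.obj (g t)) ((yon T).obj t).unop) (m : M) :
    ∃ (F : EnrichedFunctor V T V) (R : EnrichedFunctor V Tᵒᵖ M)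
      (π : ∀ a, F.obj a ⟶ (R.obj (op a) ⟶[V] m)),
      IsFlat Φ F ∧ (∀ a, R.obj a = g a.unop) ∧ IsWeightedColimit F R m π := by
  let P' := opFunctor P
  have hP' : ∀ x y, IsIso (P'.map x y) := fun x y => hP y.unop x.unop
  have hg' : ∀ t, Isomorphic V (P'.obj (op (g t))) ((yon T).obj t) := fun t => (hg t).op
  choose e e' he using fun t => isomorphic_iff.1 (hg' t)
  have hε : ∀ x t, IsIso (P'.map x (op (g t)) ≫ post (P'.obj x) (e t)) := fun x t =>
    IsIso.comp_isIso' (hP' _ _) ((he t).isIso_post _)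
  let Q := coreflect (yon T) P' (fun t => op (g t)) e hε
  have hQ : IsNat₁ (Q.comp V P') (yon T) e := coreflect_isNat₁ _ _ _ _ hε
  have h1 := (isWeightedLimit_yoneda (EnrichedFunctor.id V T) (P.obj m)).of_diagram
    (hQ.inv he) (fun t => (he t).symm)
  obtain ⟨π, hπ, -⟩ := h1.exists_of_fullyFaithful hP' (L := op m)
    (isomorphic_iff.2 ⟨_, _, InvPair.refl _⟩)
  exact ⟨P.obj m, unopDiagram Q, π, hA T hT _ (hPc m), fun _ => rfl, hπ⟩

end

/-- The category of `Φ`-continuous functors on a small `Φ`-complete category is locally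
`Φ`-presentable. -/
lemma PhiComplete.locallyPhiPresentable [HasColimits V] (hΦ : PhiLocallySmall.{d, w} Φ)
    (hA : AxiomA Φ) (hT : PhiComplete Φ T) (hM : Equivalent V M (Cts Φ T)) :
    LocallyPhiPresentable Φ M := by
  obtain ⟨P₀, hP₀, hs⟩ := hM
  let I : EnrichedFunctor V (Cts Φ T) (EnrichedFunctor V T V) :=
    incl (fun F : EnrichedFunctor V T V => PhiContinuous Φ F)
  let P := P₀.comp V I
  have hP : ∀ x y, IsIso (P.map x y) := fun x y =>
    IsIso.comp_isIso' (hP₀ x y) (IsIso.id _)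
  have hPc : ∀ m, PhiContinuous Φ (P.obj m) := fun m => (P₀.obj m).2
  have hPs : ∀ G, PhiContinuous Φ G → ∃ m, Isomorphic V (P.obj m) G := fun G hG =>
    (hs ⟨G, hG⟩).imp fun m hm => hm.map I
  have hr : ∀ W, ∃ (m : M) (e : 𝟙_ V ⟶ (op (P.obj m) ⟶[V] op W)), IsOrthogonal Φ e := by
    intro W
    obtain ⟨G, e, hG, he⟩ := hT.exists_reflection hΦ hA W
    obtain ⟨m, hm⟩ := hPs G hG
    obtain ⟨i, i', hi⟩ := isomorphic_iff.1 hm.op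
    refine ⟨m, i ≫ post _ e, fun H hH => ?_⟩
    rw [post_comp]
    exact IsIso.comp_isIso' (hi.isIso_post _) (he H hH)
  choose g hg using fun t : T => hPs ((yon T).obj t).unop (phiContinuous_yon t)
  refine ⟨cocomplete_of_reflection hP hPc hr, Set.range g, inferInstance, ?_, fun m => ?_⟩
  · rintro _ ⟨t, rfl⟩
    exact phiPresentable_of_isomorphic hP hPc hPs (hg t)
  · obtain ⟨F, R, π, hF, hR, hπ⟩ := exists_isFlat_weightedColimit hP hPc hPs hA hT hg m
    exact ⟨T, inferInstance, F, R, π, hF, fun a => ⟨a.unop, (hR a).symm⟩, hπ⟩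

end Backward

end PhiTheory

end

theorem mainTheorem6 {V : Type u} [Category.{v} V] [MonoidalCategory V] [SymmetricCategory V]
    [MonoidalClosed V] [HasLimits V] [HasColimits V]
    (Φ : Set (PhiTheory.Weight.{d} V)) (hΦ : PhiTheory.PhiLocallySmall.{d, w} Φ) (hA : PhiTheory.AxiomA Φ)
    (M : Type w) [EnrichedCategory V M] :
    PhiTheory.LocallyPhiPresentable Φ M ↔
      ∃ (T : Type v) (_ : EnrichedCategory V T), PhiTheory.PhiComplete Φ T ∧ PhiTheory.Equivalent V M (PhiTheory.Cts Φ T) :=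
  ⟨fun h => h.exists_equivalent hΦ hA, fun ⟨_, _, hT, hM⟩ => hT.locallyPhiPresentable hΦ hA hM⟩
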